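/- A star is a finite connected graph with at most one vertex of degree greater than $1$ (so the one-vertex graph and the single edge are stars), and $|F|$ denotes the number of vertices of $F$. An instance of the decision problem StarSubRec is a nonempty list $(F_1,m_1),\dots,(F_k,m_k)$ in which $F_1,\dots,F_k$ are stars, each given by its number of vertices and its adjacency matrix, and $m_1,\dots,m_k\in\mathbb N=\{0,1,2,\dots\}$ are encoded in unary. The question is whether there is a finite (simple, undirected, possibly empty) graph $G$ that has exactly $m_i$ subgraphs isomorphic to $F_i$, for every $i\in\{1,\dots,k\}$. Put $\ell:=\max_i|F_i|$ and $m:=\max_i m_i$. Claim: StarSubRec is solvable in time $m^{O(\ell^2)}$. Precisely, there are a multi-stack Turing machine and a constant $c\in\mathbb N$ such that, on every instance, the machine halts with the correct answer, and it does so after at most $\max(m,2)^{c\ell^2}$ steps if the stars $F_1,\dots,F_k$ are pairwise non-isomorphic, and after at most $k^{c}\cdot\max(m,2)^{c\ell^2}$ steps if stars may be repeated in the list. -/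

import Mathlib

namespace StarSubRec

/-- A star: a connected graph that has at most one vertex of degree greater than `1`
(in particular the one-vertex graph and the single edge are stars). -/
def IsStar {V : Type} (F : SimpleGraph V) : Prop :=
  F.Connected ∧ {v : V | 1 < (F.neighborSet v).ncard}.Subsingleton

/-- A constraint `(F, m)`: a star `F`, given as a graph on the vertex set `Fin order`,
together with a natural number `m`. -/
structure StarConstraint where
  /-- the number `|F|` of vertices -/
  order : ℕ
  /-- the constraint graph `F` -/
  graph : SimpleGraph (Fin order)
  /-- the constraint graph is a star -/
  isStar : IsStar graph
  /-- the prescribed number `m` of subgraphs isomorphic to `F` -/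
  count : ℕ

/-- `I` is a yes-instance: some finite graph `G` has, for every constraint `(F, m)` of `I`,
exactly `m` subgraphs isomorphic to `F`. -/
def Solvable (I : List StarConstraint) : Prop :=
  ∃ (N : ℕ) (G : SimpleGraph (Fin N)), ∀ p ∈ I, G.copyCount p.graph = p.count

/-- The answer to the instance `I` of the decision problem. -/
noncomputable def answer (I : List StarConstraint) : Bool :=
  @decide (Solvable I) (Classical.propDecidable _)

/-- `ℓ`: the maximum order of a constraint graph. -/
def maxOrder (I : List StarConstraint) : ℕ :=
  (I.map StarConstraint.order).foldr max 0

/-- `m`: the maximum count. -/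
def maxCount (I : List StarConstraint) : ℕ :=
  (I.map StarConstraint.count).foldr max 0

/-- The unary code `1ⁿ0` of `n`. -/
def encodeUnary (n : ℕ) : List Bool :=
  List.replicate n true ++ [false]

/-- The code of a graph on `Fin n`: the unary code of `n`, followed by the rows of the
adjacency matrix. -/
noncomputable def encodeGraph {n : ℕ} (F : SimpleGraph (Fin n)) : List Bool :=
  encodeUnary n ++ (List.finRange n).flatMap fun i =>
    (List.finRange n).map fun j => @decide (F.Adj i j) (Classical.propDecidable _)

/-- The binary string that codes an instance: for each constraint in turn, the graph and then
the count in unary. -/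
noncomputable def encode (I : List StarConstraint) : List Bool :=
  I.flatMap fun p => encodeGraph p.graph ++ encodeUnary p.count

/-- Started on the code of `I`, the machine `M` halts after at most `T` steps with the correct
answer as its output. -/
def AnswersInTime (M : Turing.TM2ComputableAux Bool Bool) (I : List StarConstraint) (T : ℕ) :
    Prop :=
  Nonempty (Turing.TM2OutputsInTime M.tm ((encode I).map M.inputAlphabet.invFun)
    (some ((Computability.encodeBool (answer I)).map M.outputAlphabet.invFun)) T)

end StarSubRec

/-! A copy of a star with r leaves is a centre together with r of its neighbours, so a graph has ∑ᵥ
C(deg v, r) such copies, except that for r = 1 every edge is counted twice (`mul_copyCount`). Hence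
only the degree sequence matters: the question is whether some graphic sequence has prescribed sums
of binomial coefficients.

A solvable instance has a small solution. If the smallest prescribed star has ρ ≥ 1 leaves, at most
2m vertices have degree at least ρ, and these vertices and their neighbours induce a graph with the
same counts (`exists_small_graph`); a one-vertex star fixes the number of vertices outright. So
degrees up to D = 2m + ℓ and N = (D + 1)² vertices suffice.

Graphic sequences are recognised by the Erdős–Gallai theorem (`exists_graph`, `sum_deg_le`). Split
the sorted degrees into h top degrees d₁ ≥ … ≥ d_h, all at least h, and the others, all at most h,
and let eᵢ be the number of others of degree at least i. For k ≤ h the k-th inequality becomes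
∑_{i≤k} (dᵢ + 1) ≤ k h + ∑_{i≤k} eᵢ, and the inequalities for k > h follow from the one for h. So dᵢ
and eᵢ can be guessed together in step i, with only the last pair, the slack and the accumulated
weight remembered. This is the dynamic program `Reach`; it is sound by `Reach.exists_degrees` and
complete by `exists_reach`.

All the binomial sums travel in one number: the base-B digits of (B + 1)^d mod B^(ℓ+1) are the C(d,
r), and no carries occur in sums over at most N vertices when B is large enough. By Vandermonde's
identity B = max(m, 2)^O(ℓ) is large enough, so there are max(m, 2)^O(ℓ²) states; the ℓ + 1 digits
of O(ℓ log m) bits are the source of the exponent ℓ². Evenness of the degree sum is evenness of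
digit 1. Together this is `solvable_iff`.

For the machine, structured programs on stacks are compiled to a multi-stack machine. Numbers are
kept in unary, and bounded first-order formulas are decided in time polynomial in the stack sizes
(`Fm.tri_comp`, `Fm.polyBd_cost`). The table of reachable states is filled by course-of-values
recursion. The number of constraints enters only through the input length, and it is at most ℓ if
the stars are pairwise non-isomorphic, because stars of equal order are isomorphic. -/

/-! ### Structured stack programs and their compilation to a multi-stack machine. -/

namespace StackProg

/-- The contents of countably many stacks of bits. -/
abbrev St := ℕ → List Bool

/-- The contents after stack `k` has been replaced. -/
def upd (S : St) (k : ℕ) (l : List Bool) : St := fun j => if j = k then l else S j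

@[simp] theorem upd_same (S : St) (k : ℕ) (l : List Bool) : upd S k l k = l := by simp [upd]

theorem upd_ne (S : St) {k j : ℕ} (l : List Bool) (h : j ≠ k) : upd S k l j = S j := by
  simp [upd, h]

@[simp] theorem upd_upd (S : St) (k : ℕ) (l l' : List Bool) : upd (upd S k l) k l' = upd S k l' := by
  funext j; by_cases h : j = k <;> simp [upd, h]

@[simp] theorem upd_self (S : St) (k : ℕ) : upd S k (S k) = S := by
  funext j; by_cases h : j = k <;> simp [upd, h]

theorem upd_comm (S : St) {k j : ℕ} (h : k ≠ j) (l l' : List Bool) :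
    upd (upd S k l) j l' = upd (upd S j l') k l := by
  funext x; by_cases h1 : x = k <;> by_cases h2 : x = j <;> simp [upd, h1, h2] <;> omega

/-- Structured programs on stacks of bits. The command `loop k f t` pops stack `k` until it is
empty and runs `f` or `t` after each pop, according to the bit. -/
inductive Cmd
  | skip
  | push (k : ℕ) (b : Bool)
  | seq (c₁ c₂ : Cmd)
  | case (k : ℕ) (n f t : Cmd)
  | loop (k : ℕ) (f t : Cmd)

/-- `Runs c S t S'`: started on `S`, the program `c` ends after `t` steps in `S'`. -/
inductive Runs : Cmd → St → ℕ → St → Prop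
  | skip (S) : Runs .skip S 0 S
  | push (k b S) : Runs (.push k b) S 1 (upd S k (b :: S k))
  | seq {c₁ c₂ S S₁ S₂ t₁ t₂} : Runs c₁ S t₁ S₁ → Runs c₂ S₁ t₂ S₂ →
      Runs (.seq c₁ c₂) S (t₁ + t₂) S₂
  | caseNil {k n f t S S' u} : S k = [] → Runs n S u S' → Runs (.case k n f t) S (1 + u + 1) S'
  | caseFalse {k n f t S S' u l} : S k = false :: l → Runs f (upd S k l) u S' →
      Runs (.case k n f t) S (1 + u + 1) S'
  | caseTrue {k n f t S S' u l} : S k = true :: l → Runs t (upd S k l) u S' →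
      Runs (.case k n f t) S (1 + u) S'
  | loopNil {k f t S} : S k = [] → Runs (.loop k f t) S 1 S
  | loopFalse {k f t S S₁ S₂ u v l} : S k = false :: l → Runs f (upd S k l) u S₁ →
      Runs (.loop k f t) S₁ v S₂ → Runs (.loop k f t) S (1 + u + 1 + v) S₂
  | loopTrue {k f t S S₁ S₂ u v l} : S k = true :: l → Runs t (upd S k l) u S₁ →
      Runs (.loop k f t) S₁ v S₂ → Runs (.loop k f t) S (1 + u + 1 + v) S₂

/-- Machine instructions with absolute jump addresses. -/
inductive Instr
  | push (k : ℕ) (b : Bool)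
  | pop (k : ℕ) (n f t : ℕ)
  | jump (a : ℕ)

namespace Cmd

/-- The number of instructions of the compiled program. -/
def size : Cmd → ℕ
  | skip => 0
  | push _ _ => 1
  | seq c₁ c₂ => c₁.size + c₂.size
  | case _ n f t => 1 + (n.size + 1 + (f.size + 1 + t.size))
  | loop _ f t => 1 + (f.size + 1 + (t.size + 1))

/-- The code of a program that is to be placed at address `p`. -/
def code : Cmd → ℕ → List Instr
  | skip, _ => []
  | push k b, _ => [.push k b]
  | seq c₁ c₂, p => c₁.code p ++ c₂.code (p + c₁.size)
  | case k n f t, p =>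
      .pop k (p + 1) (p + 1 + n.size + 1) (p + 1 + n.size + 1 + f.size + 1) ::
        (n.code (p + 1) ++ .jump (p + (case k n f t).size) ::
          (f.code (p + 1 + n.size + 1) ++ .jump (p + (case k n f t).size) ::
            t.code (p + 1 + n.size + 1 + f.size + 1)))
  | loop k f t, p =>
      .pop k (p + (loop k f t).size) (p + 1) (p + 1 + f.size + 1) ::
        (f.code (p + 1) ++ .jump p :: (t.code (p + 1 + f.size + 1) ++ [.jump p]))

/-- A strict upper bound of the stacks that a program uses. -/
def bd : Cmd → ℕ
  | skip => 0
  | push k _ => k + 1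
  | seq c₁ c₂ => max c₁.bd c₂.bd
  | case k n f t => max (k + 1) (max n.bd (max f.bd t.bd))
  | loop k f t => max (k + 1) (max f.bd t.bd)

theorem length_code (c : Cmd) (p : ℕ) : (c.code p).length = c.size := by
  induction c generalizing p <;> simp_all [code, size] <;> omega

end Cmd

open Turing

section Machine

variable (prog : List Instr) (d k₀ k₁ : ℕ)

/-- The target label of a jump; addresses beyond the code stand for the end of the program. -/
def target (a : ℕ) : Fin (prog.length + 1) := ⟨min a prog.length, by omega⟩

/-- The machine statement for an instruction at address `a`. -/
def instrStmt (a : ℕ) : Instr → TM2.Stmt (fun _ : Fin d => Bool) (Fin (prog.length + 1)) (Option Bool)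
  | .push k b => if h : k < d then
      .push ⟨k, h⟩ (fun _ => b) (.goto fun _ => target prog (a + 1)) else .halt
  | .pop k n f t => if h : k < d then
      .pop ⟨k, h⟩ (fun _ o => o) (.goto fun v => match v with
        | none => target prog n
        | some false => target prog f
        | some true => target prog t) else .halt
  | .jump a => .goto fun _ => target prog a

/-- The machine statement at an address. -/
def stmtAt (a : ℕ) : TM2.Stmt (fun _ : Fin d => Bool) (Fin (prog.length + 1)) (Option Bool) :=
  match prog[a]? with
  | some i => instrStmt prog d a i
  | none => .load (fun _ => none) .halt

/-- The machine with `d` stacks that executes the code `prog`. -/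
def machine (h₀ : k₀ < d) (h₁ : k₁ < d) : FinTM2 where
  K := Fin d
  k₀ := ⟨k₀, h₀⟩
  k₁ := ⟨k₁, h₁⟩
  Γ _ := Bool
  Λ := Fin (prog.length + 1)
  main := ⟨0, by omega⟩
  σ := Option Bool
  initialState := none
  m a := stmtAt prog d a

/-- `Steps prog d a S t a' S'`: `t` machine steps lead from address `a` and stacks `S` to address
`a'` and stacks `S'`, whatever the internal state. -/
def Steps (a : ℕ) (S : St) (t a' : ℕ) (S' : St) : Prop :=
  ∀ v : Option Bool, ∃ v' : Option Bool,
    (flip bind (TM2.step fun a : Fin (prog.length + 1) => stmtAt prog d a))^[t]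
      (some ⟨some (target prog a), v, fun k : Fin d => S k⟩) =
      some ⟨some (target prog a'), v', fun k : Fin d => S' k⟩

variable {prog d}

theorem Steps.refl (a : ℕ) (S : St) : Steps prog d a S 0 a S := fun v => ⟨v, rfl⟩

theorem Steps.trans {a a' a'' t t' : ℕ} {S S' S'' : St} (h : Steps prog d a S t a' S')
    (h' : Steps prog d a' S' t' a'' S'') : Steps prog d a S (t + t') a'' S'' := by
  intro v
  obtain ⟨v', hv'⟩ := h v
  obtain ⟨v'', hv''⟩ := h' v'
  exact ⟨v'', by rw [add_comm t t', Function.iterate_add_apply, hv', hv'']⟩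

theorem target_val {a : ℕ} (h : a < prog.length) : (target prog a : ℕ) = a := by
  simp [target]; omega

theorem Steps.push {a k : ℕ} {b : Bool} (h : prog[a]? = some (.push k b)) (hk : k < d) (S : St) :
    Steps prog d a S 1 (a + 1) (upd S k (b :: S k)) := by
  intro v
  refine ⟨v, ?_⟩
  have ha : a < prog.length := (List.getElem?_eq_some_iff.1 h).1
  simp only [Function.iterate_one, flip, Option.bind_eq_bind, Option.bind_some, TM2.step, stmtAt,
    target_val ha, h, instrStmt, hk, dif_pos, TM2.stepAux]
  congr 2
  funext j
  by_cases hj : j = ⟨k, hk⟩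
  · subst hj; simp
  · rw [Function.update_of_ne hj, upd_ne]
    exact fun h => hj (Fin.ext h)

theorem Steps.jump {a a' : ℕ} (h : prog[a]? = some (.jump a')) (S : St) :
    Steps prog d a S 1 a' S := by
  intro v
  refine ⟨v, ?_⟩
  have ha : a < prog.length := (List.getElem?_eq_some_iff.1 h).1
  simp only [Function.iterate_one, flip, Option.bind_eq_bind, Option.bind_some, TM2.step, stmtAt,
    target_val ha, h, instrStmt, TM2.stepAux]

theorem Steps.pop {a k n f t : ℕ} (h : prog[a]? = some (.pop k n f t)) (hk : k < d) (S : St) :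
    Steps prog d a S 1 (match (S k).head? with | none => n | some false => f | some true => t)
      (upd S k (S k).tail) := by
  intro v
  refine ⟨(S k).head?, ?_⟩
  have ha : a < prog.length := (List.getElem?_eq_some_iff.1 h).1
  simp only [Function.iterate_one, flip, Option.bind_eq_bind, Option.bind_some, TM2.step, stmtAt,
    target_val ha, h, instrStmt, hk, dif_pos, TM2.stepAux]
  congr 2
  · rcases (S k).head? with _ | _ | _ <;> rfl
  · funext j
    by_cases hj : j = ⟨k, hk⟩
    · subst hj; simp
    · rw [Function.update_of_ne hj, upd_ne]
      exact fun h => hj (Fin.ext h)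

/-- The code `l` stands at address `p` of `prog`. -/
def CodeAt (prog : List Instr) (p : ℕ) (l : List Instr) : Prop :=
  ∀ i (h : i < l.length), prog[p + i]? = some l[i]

theorem CodeAt.left {p : ℕ} {l l' : List Instr} (h : CodeAt prog p (l ++ l')) : CodeAt prog p l := by
  intro i hi
  rw [h i (by simp; omega), List.getElem_append_left hi]

theorem CodeAt.right {p : ℕ} {l l' : List Instr} (h : CodeAt prog p (l ++ l')) :
    CodeAt prog (p + l.length) l' := by
  intro i hi
  have := h (l.length + i) (by simp; omega)
  rw [add_assoc, this, List.getElem_append_right (by omega)]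
  simp

theorem CodeAt.head {p : ℕ} {x : Instr} {l : List Instr} (h : CodeAt prog p (x :: l)) :
    prog[p]? = some x := by
  exact h 0 (Nat.succ_pos _)

theorem CodeAt.tail {p : ℕ} {x : Instr} {l : List Instr} (h : CodeAt prog p (x :: l)) :
    CodeAt prog (p + 1) l :=
  CodeAt.right (l := [x]) h

/-- Correctness of the compiler, by induction on the run. The code may stand anywhere in a larger
program, since the jump addresses are computed from the address p; the internal state is arbitrary
because every pop overwrites it before it is read. -/
theorem Runs.steps {c : Cmd} {S S' : St} {t : ℕ} (h : Runs c S t S') :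
    ∀ p, CodeAt prog p (c.code p) → c.bd ≤ d → Steps prog d p S t (p + c.size) S' := by
  induction h with
  | skip S => intro p _ _; exact Steps.refl _ _
  | push k b S => intro p h hd; exact Steps.push h.head (by simp [Cmd.bd] at hd; omega) S
  | seq _ _ ih₁ ih₂ =>
    intro p h hd
    simp only [Cmd.bd, max_le_iff] at hd
    have h₂ := h.right
    rw [Cmd.length_code] at h₂
    have := (ih₁ p h.left hd.1).trans (ih₂ _ h₂ hd.2)
    rwa [add_assoc] at this
  | @caseNil k n f t S S' u hS _ ih =>
    intro p h hd
    simp only [Cmd.bd, max_le_iff] at hd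
    have h₀ := Steps.pop h.head (d := d) (by omega) S
    have h₁ := ih _ h.tail.left hd.2.1
    have h₂ := h.tail.right.head
    rw [Cmd.length_code] at h₂
    have e : upd S k [] = S := by rw [← hS, upd_self]
    simp only [hS, List.head?_nil, List.tail_nil, e] at h₀
    exact (h₀.trans h₁).trans (Steps.jump h₂ _)
  | @caseFalse k n f t S S' u l hS _ ih =>
    intro p h hd
    simp only [Cmd.bd, max_le_iff] at hd
    have h₀ := Steps.pop h.head (d := d) (by omega) S
    have h₁ := h.tail.right.tail
    rw [Cmd.length_code] at h₁
    have h₂ := h₁.right.head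
    rw [Cmd.length_code] at h₂
    have h₃ := ih _ h₁.left hd.2.2.1
    simp only [hS, List.head?_cons, List.tail_cons] at h₀
    exact (h₀.trans h₃).trans (Steps.jump h₂ _)
  -- The branch for `true` is placed last and falls through to the end, so no jump is counted here.
  | @caseTrue k n f t S S' u l hS _ ih =>
    intro p h hd
    simp only [Cmd.bd, max_le_iff] at hd
    have h₀ := Steps.pop h.head (d := d) (by omega) S
    have h₁ := h.tail.right.tail
    rw [Cmd.length_code] at h₁
    have h₂ := h₁.right.tail
    rw [Cmd.length_code] at h₂
    have h₃ := ih _ h₂ hd.2.2.2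
    simp only [hS, List.head?_cons, List.tail_cons] at h₀
    have := h₀.trans h₃
    convert this using 1
    simp only [Cmd.size]; omega
  | @loopNil k f t S hS =>
    intro p h hd
    simp only [Cmd.bd, max_le_iff] at hd
    have h₀ := Steps.pop h.head (d := d) (by omega) S
    have e : upd S k [] = S := by rw [← hS, upd_self]
    simpa [hS, e] using h₀
  | @loopFalse k f t S S₁ S₂ u v l hS _ _ ih₁ ih₂ =>
    intro p h hd
    -- After the body a jump leads back to the test, so the rest of the loop runs from the same
    -- address p.
    have h₄ := ih₂ p h hd
    simp only [Cmd.bd, max_le_iff] at hd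
    have h₀ := Steps.pop h.head (d := d) (by omega) S
    have h₁ := ih₁ _ h.tail.left hd.2.1
    have h₂ := h.tail.right.head
    rw [Cmd.length_code] at h₂
    simp only [hS, List.head?_cons, List.tail_cons] at h₀
    exact ((h₀.trans h₁).trans (Steps.jump h₂ _)).trans h₄
  | @loopTrue k f t S S₁ S₂ u v l hS _ _ ih₁ ih₂ =>
    intro p h hd
    have h₄ := ih₂ p h hd
    simp only [Cmd.bd, max_le_iff] at hd
    have h₀ := Steps.pop h.head (d := d) (by omega) S
    have h₁ := h.tail.right.tail
    rw [Cmd.length_code] at h₁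
    have h₂ := h₁.right.head
    rw [Cmd.length_code] at h₂
    have h₃ := ih₁ _ h₁.left hd.2.2
    simp only [hS, List.head?_cons, List.tail_cons] at h₀
    exact ((h₀.trans h₃).trans (Steps.jump h₂ _)).trans h₄

/-- The machine of a program produces the output of the program, one step later. -/
theorem Runs.outputsInTime {c : Cmd} {d k₀ k₁ t T : ℕ} {x y : List Bool} (h₀ : k₀ < d) (h₁ : k₁ < d)
    (hd : c.bd ≤ d) (h : Runs c (upd (fun _ => []) k₀ x) t (upd (fun _ => []) k₁ y))
    (hT : t + 1 ≤ T) :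
    Nonempty (TM2OutputsInTime (machine (c.code 0) d k₀ k₁ h₀ h₁) x (some y) T) := by
  have hs := h.steps (prog := c.code 0) (d := d) 0 (fun i hi => by simp [hi]) hd
  obtain ⟨v, hv⟩ := hs none
  refine ⟨⟨⟨t + 1, ?_⟩, hT⟩⟩
  rw [add_comm, Function.iterate_add_apply]
  have e₀ : (initList (machine (c.code 0) d k₀ k₁ h₀ h₁) x) =
      (⟨some (target (c.code 0) 0), none, fun k : Fin d => upd (fun _ => []) k₀ x k⟩ :
        TM2.Cfg (fun _ : Fin d => Bool) (Fin ((c.code 0).length + 1)) (Option Bool)) := by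
    unfold initList
    congr 1
    funext k
    by_cases hk : k = ⟨k₀, h₀⟩
    · subst hk; simp [machine]; rfl
    · rw [upd_ne _ _ (fun h => hk (Fin.ext h))]
      exact dif_neg hk
  have e₁ : (haltList (machine (c.code 0) d k₀ k₁ h₀ h₁) y) =
      (⟨none, none, fun k : Fin d => upd (fun _ => []) k₁ y k⟩ :
        TM2.Cfg (fun _ : Fin d => Bool) (Fin ((c.code 0).length + 1)) (Option Bool)) := by
    unfold haltList
    congr 1
    funext k
    by_cases hk : k = ⟨k₁, h₁⟩
    · subst hk; simp [machine]; rfl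
    · rw [upd_ne _ _ (fun h => hk (Fin.ext h))]
      exact dif_neg hk
  -- The extra step: beyond the code the machine halts and resets its internal state, as `haltList`
  -- requires the initial one.
  have e₂ : (flip bind (TM2.step fun a : Fin ((c.code 0).length + 1) => stmtAt (c.code 0) d a))
      (some ⟨some (target (c.code 0) (0 + c.size)), v,
        fun k : Fin d => upd (fun _ => []) k₁ y k⟩) =
      some ⟨none, none, fun k : Fin d => upd (fun _ => []) k₁ y k⟩ := by
    have : (target (c.code 0) (0 + c.size) : ℕ) = (c.code 0).length := by
      simp [target, Cmd.length_code]
    have h' : stmtAt (c.code 0) d (target (c.code 0) (0 + c.size)) =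
        .load (fun _ => none) .halt := by
      rw [stmtAt, List.getElem?_eq_none (by rw [this])]
    simp only [flip, Option.bind_eq_bind, Option.bind_some, TM2.step, h', TM2.stepAux]
  change _ = some (haltList (machine (c.code 0) d k₀ k₁ h₀ h₁) y)
  rw [e₁, e₀]
  refine Eq.trans ?_ e₂
  rw [← hv]
  rfl

end Machine

end StackProg

/-! ### Time-bounded execution, and programs that evaluate polynomial terms. -/

namespace StackProg

/-- Started on `S`, the program `c` ends in `S'` after at most `T` steps. -/
def Tri (c : Cmd) (S : St) (T : ℕ) (S' : St) : Prop := ∃ t ≤ T, Runs c S t S'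

namespace Tri

theorem mono {c : Cmd} {S S' : St} {T T' : ℕ} (h : Tri c S T S') (hT : T ≤ T') : Tri c S T' S' := by
  obtain ⟨t, ht, h⟩ := h
  exact ⟨t, ht.trans hT, h⟩

theorem cast {c : Cmd} {S S' S'' : St} {T T' : ℕ} (h : Tri c S T S') (hT : T ≤ T') (hS : S' = S'') :
    Tri c S T' S'' := hS ▸ h.mono hT

theorem skip (S : St) : Tri .skip S 0 S := ⟨0, le_rfl, .skip S⟩

theorem push (S : St) (k : ℕ) (b : Bool) : Tri (.push k b) S 1 (upd S k (b :: S k)) :=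
  ⟨1, le_rfl, .push k b S⟩

theorem seq {c₁ c₂ : Cmd} {S S₁ S₂ : St} {T₁ T₂ : ℕ} (h₁ : Tri c₁ S T₁ S₁) (h₂ : Tri c₂ S₁ T₂ S₂) :
    Tri (.seq c₁ c₂) S (T₁ + T₂) S₂ := by
  obtain ⟨t₁, ht₁, h₁⟩ := h₁
  obtain ⟨t₂, ht₂, h₂⟩ := h₂
  exact ⟨t₁ + t₂, by omega, h₁.seq h₂⟩

theorem caseNil {k : ℕ} {n f t : Cmd} {S S' : St} {T : ℕ} (hS : S k = []) (h : Tri n S T S') :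
    Tri (.case k n f t) S (T + 2) S' := by
  obtain ⟨u, hu, h⟩ := h
  exact ⟨1 + u + 1, by omega, .caseNil hS h⟩

theorem caseCons {k : ℕ} {n f t : Cmd} {S S' : St} {T : ℕ} {b : Bool} {l : List Bool}
    (hS : S k = b :: l) (h : Tri (bif b then t else f) (upd S k l) T S') :
    Tri (.case k n f t) S (T + 2) S' := by
  obtain ⟨u, hu, h⟩ := h
  cases b
  · exact ⟨1 + u + 1, by omega, .caseFalse hS h⟩
  · exact ⟨1 + u, by omega, .caseTrue hS h⟩

theorem loopCons {k : ℕ} {f t : Cmd} {S S₁ S₂ : St} {T T' : ℕ} {b : Bool} {l : List Bool}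
    (hS : S k = b :: l) (h : Tri (bif b then t else f) (upd S k l) T S₁)
    (h' : Tri (.loop k f t) S₁ T' S₂) : Tri (.loop k f t) S (T + 2 + T') S₂ := by
  obtain ⟨u, hu, h⟩ := h
  obtain ⟨v, hv, h'⟩ := h'
  cases b
  · exact ⟨1 + u + 1 + v, by omega, .loopFalse hS h h'⟩
  · exact ⟨1 + u + 1 + v, by omega, .loopTrue hS h h'⟩

/-- A loop that runs the same program `n` times. -/
theorem loop {k n τ : ℕ} {c : Cmd} {S : St} (hn : (S k).length = n) (F : ℕ → St)
    (h₀ : upd (F 0) k [] = upd S k [])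
    (hs : ∀ j < n, ∀ l, Tri c (upd (F j) k l) τ (upd (F (j + 1)) k l)) :
    Tri (.loop k c c) S ((τ + 2) * n + 1) (upd (F n) k []) := by
  -- Induction on what is left of the counter stack. `F j` describes the other stacks after j
  -- rounds; its own entry for stack k is always overwritten and plays no role.
  have key : ∀ l : List Bool, l.length ≤ n →
      Tri (.loop k c c) (upd (F (n - l.length)) k l) ((τ + 2) * l.length + 1) (upd (F n) k []) := by
    intro l
    induction l with
    | nil => intro _; exact ⟨1, by simp, by simpa using Runs.loopNil (by simp)⟩
    | cons b l ih =>
      intro hl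
      simp only [List.length_cons] at hl ⊢
      have h₁ := hs (n - (l.length + 1)) (by omega) l
      rw [show n - (l.length + 1) + 1 = n - l.length by omega] at h₁
      refine (loopCons (b := b) (l := l) (T := τ) (by simp) ?_ (ih (by omega))).mono
        (le_of_eq (by ring))
      simpa using h₁
  have := key (S k) hn.le
  rw [hn, Nat.sub_self] at this
  convert this using 1
  conv_lhs => rw [← upd_self S k, ← upd_upd S k [] (S k), ← h₀, upd_upd]

end Tri

namespace Cmd

/-- Empty stack `k`. -/
def clear (k : ℕ) : Cmd := .loop k .skip .skip

/-- Pour stack `a` onto stack `b`. -/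
def move (a b : ℕ) : Cmd := .loop a (.push b false) (.push b true)

/-- Push as many bits `true` onto stack `d` as stack `i` has entries, using the empty
stack `e`. -/
def copy (i d e : ℕ) : Cmd :=
  .seq (move i e)
    (.loop e (.seq (.push i false) (.push d true)) (.seq (.push i true) (.push d true)))

/-- Push `c` bits `true` onto stack `d`. -/
def pushN : ℕ → ℕ → Cmd
  | 0, _ => .skip
  | c + 1, d => .seq (pushN c d) (.push d true)

end Cmd

namespace Tri

theorem pushN (S : St) (c d : ℕ) : Tri (.pushN c d) S c (upd S d (List.replicate c true ++ S d)) := by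
  induction c with
  | zero => exact (skip S).cast le_rfl (by simp)
  | succ c ih => exact (ih.seq (push _ d true)).cast le_rfl (by simp [List.replicate_succ])

theorem clear (S : St) (k : ℕ) : Tri (.clear k) S (2 * (S k).length + 1) (upd S k []) :=
  (Tri.loop (τ := 0) (c := .skip) rfl (fun _ => S) rfl fun _ _ _ => skip _).mono (by omega)

theorem move (S : St) {a b : ℕ} (h : a ≠ b) :
    Tri (.move a b) S (3 * (S a).length + 1)
      (upd (upd S a []) b ((S a).reverse ++ S b)) := by
  generalize hl : S a = l
  induction l generalizing S with
  | nil =>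
    refine ⟨1, by simp, ?_⟩
    have : upd (upd S a []) b ([].reverse ++ S b) = S := by
      have : upd S a [] = S := by rw [← hl, upd_self]
      rw [this]; simp
    rw [this]
    exact .loopNil hl
  | cons x l ih =>
    have h₁ : Tri (bif x then .push b true else .push b false) (upd S a l) 1
        (upd (upd S a l) b (x :: S b)) := by
      have := push (upd S a l) b x
      rw [upd_ne S l h.symm] at this
      cases x <;> exact this
    have h₂ := ih (upd (upd S a l) b (x :: S b)) (by rw [upd_ne _ _ h, upd_same])
    refine (loopCons hl h₁ h₂).cast (by simp; omega) ?_
    rw [upd_same, upd_comm _ h.symm, upd_upd, upd_upd]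
    simp

/-- Stack i is poured onto e and back; two reversals restore it, and each bit on the way back leaves
a `true` on d. -/
theorem copy (S : St) {i d e : ℕ} (hid : i ≠ d) (hie : i ≠ e) (hde : d ≠ e) (he : S e = []) :
    Tri (.copy i d e) S (7 * (S i).length + 2)
      (upd S d (List.replicate (S i).length true ++ S d)) := by
  have key : ∀ (l : List Bool) (S : St), S e = l →
      Tri (.loop e (.seq (.push i false) (.push d true)) (.seq (.push i true) (.push d true))) S
        (4 * l.length + 1)
        (upd (upd (upd S e []) i (l.reverse ++ S i)) d (List.replicate l.length true ++ S d)) := by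
    intro l
    induction l with
    | nil =>
      intro S hS
      refine ⟨1, by simp, ?_⟩
      have : upd (upd (upd S e []) i ([].reverse ++ S i)) d
          (List.replicate ([] : List Bool).length true ++ S d) = S := by
        have : upd S e [] = S := by rw [← hS, upd_self]
        rw [this]; simp
      rw [this]
      exact .loopNil hS
    | cons x l ih =>
      intro S hS
      have h₁ : Tri (bif x then .seq (.push i true) (.push d true) else
          .seq (.push i false) (.push d true)) (upd S e l) (1 + 1)
          (upd (upd (upd S e l) i (x :: S i)) d (true :: S d)) := by
        have := (push (upd S e l) i x).seq (push _ d true)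
        rw [upd_ne S l hie, upd_ne _ _ hid.symm, upd_ne _ _ hde] at this
        cases x <;> exact this
      have h₂ := ih (upd (upd (upd S e l) i (x :: S i)) d (true :: S d)) (by rw [upd_ne _ _ hde.symm, upd_ne _ _ hie.symm, upd_same])
      refine (loopCons hS h₁ h₂).cast (by simp; omega) ?_
      have e₁ : upd (upd (upd S e l) i (x :: S i)) d (true :: S d) i = x :: S i := by
        rw [upd_ne _ _ hid, upd_same]
      rw [e₁, upd_same]
      funext j
      simp only [upd]
      split_ifs <;> simp_all [List.replicate_succ']
  have h₁ := move S hie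
  rw [he, List.append_nil] at h₁
  have h₂ := key (S i).reverse _ (upd_same (upd S i []) e _)
  refine (h₁.seq h₂).cast (by simp; omega) ?_
  funext j
  simp only [upd]
  split_ifs <;> simp_all

end Tri

/-- Polynomial terms. The value of `var i` is the number of entries of stack `i`. -/
inductive Tm
  | var (i : ℕ)
  | lit (c : ℕ)
  | add (t₁ t₂ : Tm)
  | mul (t₁ t₂ : Tm)

instance : Add Tm := ⟨Tm.add⟩
instance : Mul Tm := ⟨Tm.mul⟩
instance (n : ℕ) : OfNat Tm n := ⟨Tm.lit n⟩

namespace Tm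

/-- The value of a term. -/
def eval (S : St) : Tm → ℕ
  | var i => (S i).length
  | lit c => c
  | add t₁ t₂ => t₁.eval S + t₂.eval S
  | mul t₁ t₂ => t₁.eval S * t₂.eval S

/-- A strict upper bound of the stacks that occur. -/
def bd : Tm → ℕ
  | var i => i + 1
  | lit _ => 0
  | add t₁ t₂ => max t₁.bd t₂.bd
  | mul t₁ t₂ => max t₁.bd t₂.bd

/-- A bound of the value on stacks of size at most `A`. -/
def size : Tm → ℕ → ℕ
  | var _, A => A
  | lit c, _ => c
  | add t₁ t₂, A => t₁.size A + t₂.size A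
  | mul t₁ t₂, A => t₁.size A * t₂.size A

/-- The program that pushes the value of a term in unary onto stack `d`. -/
def comp : Tm → ℕ → Cmd
  | var i, d => .copy i d (d + 1)
  | lit c, d => .pushN c d
  | add t₁ t₂, d => .seq (t₁.comp d) (.seq (t₂.comp (d + 1)) (.move (d + 1) d))
  | mul t₁ t₂, d => .seq (t₁.comp (d + 1)) (.seq (t₂.comp (d + 2))
      (.seq (.loop (d + 1) (.copy (d + 2) d (d + 3)) (.copy (d + 2) d (d + 3))) (.clear (d + 2))))

/-- A time bound of `comp` on stacks of size at most `A`. -/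
def cost : Tm → ℕ → ℕ
  | var _, A => 7 * A + 2
  | lit c, _ => c
  | add t₁ t₂, A => t₁.cost A + (t₂.cost A + (3 * t₂.size A + 1))
  | mul t₁ t₂, A => t₁.cost A + (t₂.cost A +
      (((7 * t₂.size A + 2 + 2) * t₁.size A + 1) + (2 * t₂.size A + 1)))

theorem eval_congr {S S' : St} (t : Tm) (h : ∀ j < t.bd, S j = S' j) : t.eval S = t.eval S' := by
  induction t with
  | var i => simp [eval, h i (by simp [bd])]
  | lit c => rfl
  | add t₁ t₂ ih₁ ih₂ | mul t₁ t₂ ih₁ ih₂ =>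
    simp only [eval]
    rw [ih₁ fun j hj => h j (by simp [bd, hj]), ih₂ fun j hj => h j (by simp [bd, hj])]

theorem eval_le {S : St} {A : ℕ} (t : Tm) (h : ∀ j < t.bd, (S j).length ≤ A) :
    t.eval S ≤ t.size A := by
  induction t with
  | var i => exact h i (by simp [bd])
  | lit c => exact le_rfl
  | add t₁ t₂ ih₁ ih₂ =>
    exact add_le_add (ih₁ fun j hj => h j (by simp [bd, hj]))
      (ih₂ fun j hj => h j (by simp [bd, hj]))
  | mul t₁ t₂ ih₁ ih₂ =>
    exact mul_le_mul' (ih₁ fun j hj => h j (by simp [bd, hj]))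
      (ih₂ fun j hj => h j (by simp [bd, hj]))

/-- Discipline of all the compilers that follow: the inputs lie below d, the stacks from d on are
scratch space, empty before the run and, apart from the result, empty after it. -/
theorem tri_comp (t : Tm) {A : ℕ} : ∀ (d : ℕ) (S : St), t.bd ≤ d → (∀ j, d ≤ j → S j = []) →
    (∀ j < t.bd, (S j).length ≤ A) →
    Tri (t.comp d) S (t.cost A) (upd S d (List.replicate (t.eval S) true)) := by
  induction t with
  | var i =>
    intro d S hd hS hA
    simp only [bd] at hd
    have h := Tri.copy S (i := i) (d := d) (e := d + 1) (by omega) (by omega) (by omega)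
      (hS _ (by omega))
    rw [hS d le_rfl, List.append_nil] at h
    exact h.mono (by have := hA i (by simp [bd]); simp only [cost]; omega)
  | lit c =>
    intro d S hd hS hA
    exact (Tri.pushN S c d).cast le_rfl (by rw [hS d le_rfl, List.append_nil]; rfl)
  | add t₁ t₂ ih₁ ih₂ =>
    intro d S hd hS hA
    simp only [bd, max_le_iff] at hd
    have e₂ := eval_le t₂ (S := S) (A := A) fun j hj => hA j (by simp [bd, hj])
    have h₁ := ih₁ d S hd.1 hS fun j hj => hA j (by simp [bd, hj])
    have h₂ := ih₂ (d + 1) (upd S d (List.replicate (t₁.eval S) true)) (by omega)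
      (fun j hj => by rw [upd_ne _ _ (by omega), hS j (by omega)])
      (fun j hj => by rw [upd_ne _ _ (by omega)]; exact hA j (by simp [bd, hj]))
    rw [← eval_congr (S := S) t₂ fun j hj => (upd_ne _ _ (by omega)).symm] at h₂
    have h₃ := Tri.move (upd (upd S d (List.replicate (t₁.eval S) true)) (d + 1)
      (List.replicate (t₂.eval S) true)) (a := d + 1) (b := d) (by omega)
    refine (h₁.seq (h₂.seq h₃)).cast ?_ ?_
    · simp only [cost, upd_same, List.length_replicate]; omega
    · funext j
      simp only [upd, eval]
      have := hS (d + 1) (by omega)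
      split_ifs
      all_goals first | (exfalso; omega) | rfl | (simp [add_comm]; done) |
        (subst_vars; exact this.symm)
  | mul t₁ t₂ ih₁ ih₂ =>
    intro d S hd hS hA
    simp only [bd, max_le_iff] at hd
    have e₁ := eval_le t₁ (S := S) (A := A) fun j hj => hA j (by simp [bd, hj])
    have e₂ := eval_le t₂ (S := S) (A := A) fun j hj => hA j (by simp [bd, hj])
    have h₁ := ih₁ (d + 1) S (by omega) (fun j hj => hS j (by omega))
      fun j hj => hA j (by simp [bd, hj])
    have h₂ := ih₂ (d + 2) (upd S (d + 1) (List.replicate (t₁.eval S) true)) (by omega)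
      (fun j hj => by rw [upd_ne _ _ (by omega), hS j (by omega)])
      (fun j hj => by rw [upd_ne _ _ (by omega)]; exact hA j (by simp [bd, hj]))
    rw [← eval_congr (S := S) t₂ fun j hj => (upd_ne _ _ (by omega)).symm] at h₂
    set x := t₁.eval S
    set y := t₂.eval S
    set S₂ := upd (upd S (d + 1) (List.replicate x true)) (d + 2) (List.replicate y true) with hS₂
    -- A product is computed by repeated copying: after j rounds stack d holds j * y.
    have h₃ := Tri.loop (k := d + 1) (n := x) (τ := 7 * t₂.size A + 2)
      (c := .copy (d + 2) d (d + 3)) (S := S₂)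
      (by rw [hS₂, upd_ne _ _ (by omega), upd_same, List.length_replicate])
      (fun j => upd S₂ d (List.replicate (j * y) true))
      (by
        simp only [zero_mul, List.replicate_zero]
        congr 1
        have : S₂ d = [] := by
          rw [hS₂, upd_ne _ _ (by omega), upd_ne _ _ (by omega), hS d le_rfl]
        conv_lhs => rw [← this, upd_self])
      (fun j _ l => by
        have h := Tri.copy (upd (upd S₂ d (List.replicate (j * y) true)) (d + 1) l)
          (i := d + 2) (d := d) (e := d + 3) (by omega) (by omega) (by omega)
          (by simp [hS₂, upd, hS (d + 3) (by omega)])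
        refine h.cast ?_ ?_
        · simp [hS₂, upd]; omega
        · funext i
          simp only [upd, hS₂]
          split_ifs
          all_goals first | (exfalso; omega) | rfl | simp [add_mul, add_comm])
    have h₄ := Tri.clear (upd (upd S₂ d (List.replicate (x * y) true)) (d + 1) []) (d + 2)
    refine (h₁.seq (h₂.seq (h₃.seq h₄))).cast ?_ ?_
    · have : (upd (upd S₂ d (List.replicate (x * y) true)) (d + 1) [] (d + 2)).length = y := by
        simp [hS₂, upd]
      rw [this]
      simp only [cost]
      gcongr
    · funext j
      have h₁ := hS (d + 1) (by omega)
      have h₂ := hS (d + 2) (by omega)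
      simp only [upd, eval, hS₂]
      split_ifs <;> simp_all [x, y]

end Tm

end StackProg

/-! ### Bounded first-order formulas and the programs that decide them. -/

namespace StackProg

/-- Bounded first-order formulas. The formula `tab k t` reads bit number `t` of stack `k`; it is
false if there is none. -/
inductive Fm
  | le (t₁ t₂ : Tm)
  | tab (k : ℕ) (t : Tm)
  | and (φ ψ : Fm)
  | not (φ : Fm)
  | ex (i : ℕ) (t : Tm) (φ : Fm)

/-- The unary code of a natural number. -/
abbrev un (n : ℕ) : List Bool := List.replicate n true

open scoped Classical in
/-- The answer of the program that decides a formula. -/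
noncomputable def ans (p : Prop) : List Bool := if p then [true] else []

theorem ans_true {p : Prop} (h : p) : ans p = [true] := if_pos h

theorem ans_false {p : Prop} (h : ¬ p) : ans p = [] := if_neg h

theorem length_ans_le (p : Prop) : (ans p).length ≤ 1 := by
  unfold ans; split_ifs <;> simp

namespace Fm

/-- The truth of a formula. The quantifier `ex i t` binds variable `i` below `t`. -/
def Sat : Fm → St → Prop
  | le t₁ t₂, S => t₁.eval S ≤ t₂.eval S
  | tab k t, S => (S k)[t.eval S]? = some true
  | and φ ψ, S => φ.Sat S ∧ ψ.Sat S
  | not φ, S => ¬ φ.Sat S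
  | ex i t φ, S => ∃ x < t.eval S, φ.Sat (upd S i (un x))

/-- A strict upper bound of the stacks that occur. -/
def bd : Fm → ℕ
  | le t₁ t₂ => max t₁.bd t₂.bd
  | tab k t => max (k + 1) t.bd
  | and φ ψ => max φ.bd ψ.bd
  | not φ => φ.bd
  | ex i t φ => max (i + 1) (max t.bd φ.bd)

/-- The program that decides a formula; the answer yes is one bit `true` on stack `d`, the answer
no is the empty stack `d`. -/
def comp : Fm → ℕ → Cmd
  | le t₁ t₂, d => .seq (.push d true) (.seq (t₁.comp (d + 1)) (.seq (t₂.comp (d + 2))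
      (.seq (.loop (d + 1) (.case (d + 2) (.clear d) .skip .skip)
        (.case (d + 2) (.clear d) .skip .skip)) (.clear (d + 2)))))
  | tab k t, d => .seq (t.comp (d + 1)) (.seq
      (.loop (d + 1) (.case k .skip (.push (d + 2) false) (.push (d + 2) true))
        (.case k .skip (.push (d + 2) false) (.push (d + 2) true)))
      (.seq (.case k .skip (.push k false) (.seq (.push k true) (.push d true)))
        (.move (d + 2) k)))
  | and φ ψ, d => .seq (φ.comp d) (.seq (ψ.comp (d + 1))
      (.case d (.clear (d + 1)) .skip (.move (d + 1) d)))
  | not φ, d => .seq (φ.comp (d + 1)) (.case (d + 1) (.push d true) .skip .skip)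
  | ex i t φ, d => .seq (t.comp (d + 2)) (.seq (.move i (d + 1)) (.seq
      (.loop (d + 2)
        (.seq (φ.comp (d + 3)) (.seq (.case (d + 3) .skip .skip (.seq (.clear d) (.push d true)))
          (.push i true)))
        (.seq (φ.comp (d + 3)) (.seq (.case (d + 3) .skip .skip (.seq (.clear d) (.push d true)))
          (.push i true))))
      (.seq (.clear i) (.move (d + 1) i))))

/-- A time bound of `comp` on stacks of size at most `A`. -/
def cost : Fm → ℕ → ℕ
  | le t₁ t₂, A => 1 + (t₁.cost A + (t₂.cost A + ((7 * t₁.size A + 1) + (2 * t₂.size A + 1))))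
  | tab _ t, A => t.cost A + ((5 * t.size A + 1) + (4 + (3 * A + 1)))
  | and φ ψ, A => φ.cost A + (ψ.cost A + 6)
  | not φ, A => φ.cost A + 3
  | ex _ t φ, A => t.cost A + ((3 * A + 1) + (((φ.cost (A + t.size A) + 7 + 2) * t.size A + 1) +
      ((2 * t.size A + 1) + (3 * A + 1))))

theorem sat_congr {S S' : St} (φ : Fm) (h : ∀ j < φ.bd, S j = S' j) : φ.Sat S ↔ φ.Sat S' := by
  induction φ generalizing S S' with
  | le t₁ t₂ =>
    simp only [Sat]
    rw [t₁.eval_congr fun j hj => h j (by simp [bd, hj]),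
      t₂.eval_congr fun j hj => h j (by simp [bd, hj])]
  | tab k t =>
    simp only [Sat]
    rw [t.eval_congr fun j hj => h j (by simp [bd, hj]), h k (by simp [bd])]
  | and φ ψ ih₁ ih₂ =>
    simp only [Sat]
    rw [ih₁ fun j hj => h j (by simp [bd, hj]), ih₂ fun j hj => h j (by simp [bd, hj])]
  | not φ ih => exact not_congr (ih h)
  | ex i t φ ih =>
    simp only [Sat]
    rw [t.eval_congr fun j hj => h j (by simp [bd, hj])]
    refine exists_congr fun x => and_congr_right fun _ => ih fun j hj => ?_
    simp only [upd]
    split_ifs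
    · rfl
    · exact h j (by simp [bd, hj])

/-- The answer starts as yes. One unit of the second value is removed for each unit of the first,
and the answer is erased if none is left; after j rounds the flag says j ≤ y and the rest is y - j,
with truncated subtraction. -/
theorem tri_le (t₁ t₂ : Tm) {A d : ℕ} {S : St} (hd : (le t₁ t₂).bd ≤ d)
    (hS : ∀ j, d ≤ j → S j = []) (hA : ∀ j < (le t₁ t₂).bd, (S j).length ≤ A) :
    Tri ((le t₁ t₂).comp d) S ((le t₁ t₂).cost A) (upd S d (ans ((le t₁ t₂).Sat S))) := by
  simp only [bd, max_le_iff] at hd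
  have e₁ := t₁.eval_le (S := S) (A := A) fun j hj => hA j (by simp [bd, hj])
  have e₂ := t₂.eval_le (S := S) (A := A) fun j hj => hA j (by simp [bd, hj])
  have h₀ := Tri.push S d true
  rw [hS d le_rfl] at h₀
  have h₁ := t₁.tri_comp (A := A) (d + 1) (upd S d [true]) (by omega)
    (fun j hj => by rw [upd_ne _ _ (by omega), hS j (by omega)])
    (fun j hj => by rw [upd_ne _ _ (by omega)]; exact hA j (by simp [bd, hj]))
  rw [← t₁.eval_congr (S := S) fun j hj => (upd_ne _ _ (by omega)).symm] at h₁
  have h₂ := t₂.tri_comp (A := A) (d + 2) (upd (upd S d [true]) (d + 1) (un (t₁.eval S)))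
    (by omega)
    (fun j hj => by rw [upd_ne _ _ (by omega), upd_ne _ _ (by omega), hS j (by omega)])
    (fun j hj => by
      rw [upd_ne _ _ (by omega), upd_ne _ _ (by omega)]; exact hA j (by simp [bd, hj]))
  rw [← t₂.eval_congr (S := S) fun j hj =>
    by rw [upd_ne _ _ (by omega), upd_ne _ _ (by omega)]] at h₂
  set x := t₁.eval S with hx
  set y := t₂.eval S with hy
  set S₂ := upd (upd (upd S d [true]) (d + 1) (un x)) (d + 2) (un y) with hS₂
  have h₃ := Tri.loop (k := d + 1) (n := x) (τ := 5)
    (c := .case (d + 2) (.clear d) .skip .skip) (S := S₂)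
    (by rw [hS₂, upd_ne _ _ (by omega), upd_same, List.length_replicate])
    (fun j => upd (upd S₂ d (ans (j ≤ y))) (d + 2) (un (y - j)))
    (by
      congr 1
      funext j
      simp only [upd, hS₂, ans_true (Nat.zero_le y), Nat.sub_zero]
      split_ifs <;> first | rfl | omega)
    (fun j _ l => by
      by_cases hj : j < y
      · refine (Tri.caseCons (b := true) (l := un (y - (j + 1))) ?_ (Tri.skip _)).cast (by omega) ?_
        · simp only [upd, un]
          rw [show y - j = y - (j + 1) + 1 by omega, List.replicate_succ]
          simp
        · rw [ans_true hj.le, ans_true (show j + 1 ≤ y from hj)]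
          funext i; simp only [upd]; split_ifs <;> first | rfl | omega
      · refine (Tri.caseNil ?_ (Tri.clear _ d)).cast ?_ ?_
        · simp only [upd, un]
          rw [show y - j = 0 by omega]
          simp
        · have := length_ans_le (j ≤ y)
          have e : upd (upd (upd S₂ d (ans (j ≤ y))) (d + 2) (un (y - j))) (d + 1) l d =
            ans (j ≤ y) := by simp [upd]
          rw [e]; omega
        · rw [ans_false (show ¬ j + 1 ≤ y from hj), show y - j = y - (j + 1) by omega]
          funext i; simp only [upd]; split_ifs <;> first | rfl | omega)
  have h₄ := Tri.clear (upd (upd (upd S₂ d (ans (x ≤ y))) (d + 2) (un (y - x))) (d + 1) []) (d + 2)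
  refine (h₀.seq (h₁.seq (h₂.seq (h₃.seq h₄)))).cast ?_ ?_
  · have : (upd (upd (upd S₂ d (ans (x ≤ y))) (d + 2) (un (y - x))) (d + 1) [] (d + 2)).length
      ≤ y := by simp [upd]
    simp only [cost]
    gcongr
    exact this.trans e₂
  · have g₁ := hS (d + 1) (by omega)
    have g₂ := hS (d + 2) (by omega)
    funext j
    simp only [upd, hS₂, Sat]
    split_ifs <;> first | rfl | (exfalso; omega) | (subst_vars; first | exact g₁.symm | exact g₂.symm)

/-- The first x bits of stack k are set aside on d + 2, the top bit is inspected and put back, and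
the bits set aside are poured back. If the stack is too short, nothing is found and the answer is
no. -/
theorem tri_tab (k : ℕ) (t : Tm) {A d : ℕ} {S : St} (hd : (tab k t).bd ≤ d)
    (hS : ∀ j, d ≤ j → S j = []) (hA : ∀ j < (tab k t).bd, (S j).length ≤ A) :
    Tri ((tab k t).comp d) S ((tab k t).cost A) (upd S d (ans ((tab k t).Sat S))) := by
  simp only [bd, max_le_iff] at hd
  have e₁ := t.eval_le (S := S) (A := A) fun j hj => hA j (by simp [bd, hj])
  have hk := hA k (by simp [bd])
  have h₁ := t.tri_comp (A := A) (d + 1) S (by omega) (fun j hj => hS j (by omega))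
    (fun j hj => hA j (by simp [bd, hj]))
  set x := t.eval S with hx
  set S₁ := upd S (d + 1) (un x) with hS₁
  have gd := hS d (by omega)
  have g₁ := hS (d + 1) (by omega)
  have g₂ := hS (d + 2) (by omega)
  have h₂ := Tri.loop (k := d + 1) (n := x) (τ := 3)
    (c := .case k .skip (.push (d + 2) false) (.push (d + 2) true)) (S := S₁)
    (by rw [hS₁, upd_same, List.length_replicate])
    (fun j => upd (upd S₁ k ((S k).drop j)) (d + 2) ((S k).take j).reverse)
    (by
      congr 1
      funext j
      simp only [upd, hS₁]
      split_ifs <;> first | (exfalso; omega) | simp_all)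
    (fun j _ l => by
      cases hj : (S k).drop j with
      | nil =>
        refine (Tri.caseNil ?_ (Tri.skip _)).cast (by omega) ?_
        · rw [upd_ne _ _ (by omega), upd_ne _ _ (by omega), upd_same]
        · have : (S k).length ≤ j := by simpa using hj
          rw [List.drop_eq_nil_of_le (by omega), List.take_of_length_le this,
            List.take_of_length_le (by omega)]
      | cons b r =>
        have hb : (S k)[j]? = some b := by
          have := congrArg List.head? hj
          simpa [List.head?_drop] using this
        have hr : (S k).drop (j + 1) = r := by
          have := congrArg List.tail hj
          simpa [List.tail_drop] using this
        have h := Tri.push (upd (upd (upd (upd S₁ k (b :: r)) (d + 2) ((S k).take j).reverse)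
          (d + 1) l) k r) (d + 2) b
        refine (Tri.caseCons (b := b) (l := r) (T := 1) ?_ ?_).cast (by omega) rfl
        · rw [upd_ne _ _ (by omega), upd_ne _ _ (by omega), upd_same]
        · rw [show (bif b then Cmd.push (d + 2) true else .push (d + 2) false) = .push (d + 2) b by
            cases b <;> rfl]
          refine h.cast le_rfl ?_
          rw [hr, List.take_add_one, hb]
          funext i
          simp only [upd]
          split_ifs <;> first | rfl | (exfalso; omega) | simp)
  set S₃ := upd (upd (upd S₁ k ((S k).drop x)) (d + 2) ((S k).take x).reverse) (d + 1) [] with hS₃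
  have e₃ : S₃ k = (S k).drop x := by
    rw [hS₃, upd_ne _ _ (by omega), upd_ne _ _ (by omega), upd_same]
  have e₄ : S₃ d = [] := by
    rw [hS₃, upd_ne _ _ (by omega), upd_ne _ _ (by omega), upd_ne _ _ (by omega), hS₁,
      upd_ne _ _ (by omega), gd]
  have h₃ : Tri (.case k .skip (.push k false) (.seq (.push k true) (.push d true))) S₃ 4
      (upd S₃ d (ans ((S k)[x]? = some true))) := by
    rw [← List.head?_drop, ← e₃]
    cases hj : S₃ k with
    | nil =>
      refine (Tri.caseNil hj (Tri.skip _)).cast (by omega) ?_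
      rw [ans_false (by simp), ← e₄, upd_self]
    | cons b r =>
      cases b
      · refine (Tri.caseCons hj (Tri.push _ k false)).cast (by omega) ?_
        rw [ans_false (by simp), upd_same, upd_upd, ← hj, upd_self, ← e₄, upd_self]
      · refine (Tri.caseCons hj ((Tri.push _ k true).seq (Tri.push _ d true))).cast (by omega) ?_
        rw [ans_true (by simp), upd_same, upd_upd, ← hj, upd_self, e₄]
  have h₄ := Tri.move (upd S₃ d (ans ((S k)[x]? = some true))) (a := d + 2) (b := k) (by omega)
  have e₅ : upd S₃ d (ans ((S k)[x]? = some true)) (d + 2) = ((S k).take x).reverse := by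
    rw [upd_ne _ _ (by omega), hS₃, upd_ne _ _ (by omega), upd_same]
  rw [e₅, upd_ne _ _ (by omega), e₃, List.reverse_reverse, List.take_append_drop] at h₄
  refine (h₁.seq (h₂.seq (h₃.seq h₄))).cast ?_ ?_
  · simp only [cost, List.length_reverse, List.length_take]
    gcongr
    omega
  · funext j
    simp only [upd, hS₃, hS₁, Sat]
    split_ifs <;> first | rfl | (exfalso; omega) |
      (subst_vars; first | rfl | exact g₁.symm | exact g₂.symm)

theorem tri_comp (φ : Fm) : ∀ {A d : ℕ} {S : St}, φ.bd ≤ d → (∀ j, d ≤ j → S j = []) →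
    (∀ j < φ.bd, (S j).length ≤ A) → Tri (φ.comp d) S (φ.cost A) (upd S d (ans (φ.Sat S))) := by
  induction φ with
  | le t₁ t₂ => exact tri_le t₁ t₂
  | tab k t => exact tri_tab k t
  | and φ ψ ih₁ ih₂ =>
    intro A d S hd hS hA
    simp only [bd, max_le_iff] at hd
    have h₁ := ih₁ (A := A) hd.1 hS fun j hj => hA j (by simp [bd, hj])
    have h₂ := ih₂ (A := A) (d := d + 1) (S := upd S d (ans (φ.Sat S))) (by omega)
      (fun j hj => by rw [upd_ne _ _ (by omega), hS j (by omega)])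
      (fun j hj => by rw [upd_ne _ _ (by omega)]; exact hA j (by simp [bd, hj]))
    rw [← sat_congr (S := S) ψ fun j hj => (upd_ne _ _ (by omega)).symm] at h₂
    set S₂ := upd (upd S d (ans (φ.Sat S))) (d + 1) (ans (ψ.Sat S)) with hS₂
    have g := hS d le_rfl
    have g₁ := hS (d + 1) (by omega)
    have l := length_ans_le (ψ.Sat S)
    have e₀ : S₂ d = ans (φ.Sat S) := by rw [hS₂, upd_ne _ _ (by omega), upd_same]
    have h₃ : Tri (.case d (.clear (d + 1)) .skip (.move (d + 1) d)) S₂ 6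
        (upd S d (ans ((φ.and ψ).Sat S))) := by
      by_cases hφ : φ.Sat S
      · refine (Tri.caseCons (b := true) (l := []) (by rw [e₀, ans_true hφ])
          (Tri.move _ (a := d + 1) (b := d) (by omega))).cast ?_ ?_
        · rw [upd_ne _ _ (by omega), hS₂, upd_same]; omega
        · rw [upd_same, upd_ne _ _ (by omega), hS₂, upd_same]
          simp only [Sat, hφ, true_and]
          funext j
          simp only [upd]
          split_ifs <;> first
            | rfl | (by_cases h : ψ.Sat S <;> simp [ans, h]; done) |
              (subst_vars; exact g₁.symm)
      · refine (Tri.caseNil (by rw [e₀, ans_false hφ]) (Tri.clear _ (d + 1))).cast ?_ ?_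
        · rw [hS₂, upd_same]; omega
        · have : ¬ (φ.and ψ).Sat S := fun h => hφ h.1
          rw [hS₂, upd_upd, ans_false hφ, ans_false this]
          funext j
          simp only [upd]
          split_ifs <;> first | rfl | (subst_vars; exact g₁.symm)
    exact h₁.seq (h₂.seq h₃)
  | not φ ih =>
    intro A d S hd hS hA
    have hd' : φ.bd ≤ d := hd
    have h₁ := ih (A := A) (d := d + 1) (S := S) (by omega) (fun j hj => hS j (by omega)) hA
    have g := hS d le_rfl
    have g₁ := hS (d + 1) (by omega)
    refine h₁.seq (S₂ := upd S d (ans (φ.not.Sat S))) (T₂ := 3) ?_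
    by_cases hφ : φ.Sat S
    · refine (Tri.caseCons (b := true) (l := []) (by rw [upd_same, ans_true hφ])
        (Tri.skip _)).cast (by omega) ?_
      have e : upd S (d + 1) [] = S := by rw [← g₁, upd_self]
      have e' : upd S d [] = S := by rw [← g, upd_self]
      rw [ans_false (show ¬ φ.not.Sat S from not_not_intro hφ), upd_upd, e, e']
    · refine (Tri.caseNil (by rw [upd_same, ans_false hφ]) (Tri.push _ d true)).cast (by omega) ?_
      rw [ans_true (show φ.not.Sat S from hφ), ans_false hφ,
        show upd S (d + 1) [] = S by rw [← g₁, upd_self], g]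
  | ex i t φ ih =>
    intro A d S hd hS hA
    simp only [bd, max_le_iff] at hd
    have e₁ := t.eval_le (S := S) (A := A) fun j hj => hA j (by simp [bd, hj])
    have hi := hA i (by simp [bd])
    have gd := hS d le_rfl
    have g₁ := hS (d + 1) (by omega)
    have g₂ := hS (d + 2) (by omega)
    have h₁ := t.tri_comp (A := A) (d + 2) S (by omega) (fun j hj => hS j (by omega))
      (fun j hj => hA j (by simp [bd, hj]))
    set x := t.eval S with hx
    -- The bound variable may already be in use outside the quantifier; its old contents are saved
    -- on d + 1 and restored at the end.
    have h₂ := Tri.move (upd S (d + 2) (un x)) (a := i) (b := d + 1) (by omega)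
    rw [upd_ne _ _ (by omega), upd_ne _ _ (by omega), g₁, List.append_nil] at h₂
    set S₂ := upd (upd (upd S (d + 2) (un x)) i []) (d + 1) (S i).reverse with hS₂
    have h₃ := Tri.loop (k := d + 2) (n := x) (τ := φ.cost (A + t.size A) + 7)
      (c := .seq (φ.comp (d + 3)) (.seq
        (.case (d + 3) .skip .skip (.seq (.clear d) (.push d true))) (.push i true))) (S := S₂)
      (by simp [hS₂, upd, show d + 2 ≠ i by omega])
      (fun j => upd (upd S₂ d (ans (∃ y < j, φ.Sat (upd S i (un y))))) i (un j))
      (by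
        congr 1
        funext j
        simp only [upd, hS₂]
        split_ifs <;> first | rfl | (exfalso; omega) | (subst_vars; simp [ans, gd]))
      (fun j hj l => by
        set p := ∃ y < j, φ.Sat (upd S i (un y)) with hp
        set S₃ := upd (upd (upd S₂ d (ans p)) i (un j)) (d + 2) l with hS₃
        have l₁ := length_ans_le p
        have hq : (∃ y < j + 1, φ.Sat (upd S i (un y))) ↔ p ∨ φ.Sat (upd S i (un j)) := by
          constructor
          · rintro ⟨y, hy, h⟩
            rcases Nat.lt_succ_iff_lt_or_eq.1 hy with hy | rfl
            · exact .inl ⟨y, hy, h⟩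
            · exact .inr h
          · rintro (⟨y, hy, h⟩ | h)
            · exact ⟨y, by omega, h⟩
            · exact ⟨j, by omega, h⟩
        have agree : ∀ m < d, S₃ m = upd S i (un j) m := by
          intro m hm
          simp only [hS₃, hS₂, upd]
          split_ifs <;> first | rfl | (exfalso; omega)
        -- The bound variable can grow up to the value of the term t, so the body is charged for
        -- stacks of size A + t.size A.
        have h := ih (A := A + t.size A) (d := d + 3) (S := S₃) (by omega)
          (fun m hm => by
            simp only [hS₃, hS₂, upd]
            split_ifs <;> first | (exfalso; omega) | exact hS m (by omega))
          (fun m hm => by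
            rw [agree m (by omega), upd]
            split_ifs
            · simp; omega
            · exact (hA m (by simp [bd, hm])).trans (by omega))
        rw [sat_congr (S := S₃) (S' := upd S i (un j)) φ fun m hm => agree m (by omega)] at h
        have g₃ : S₃ (d + 3) = [] := by
          simp only [hS₃, hS₂, upd]
          split_ifs <;> first | (exfalso; omega) | exact hS _ (by omega)
        have e₃ : S₃ d = ans p := by
          simp only [hS₃, upd]; split_ifs <;> first | rfl | (exfalso; omega)
        have e₄ : S₃ i = un j := by
          simp only [hS₃, upd]; split_ifs <;> first | rfl | (exfalso; omega)
        have h' : Tri (.case (d + 3) .skip .skip (.seq (.clear d) (.push d true)))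
            (upd S₃ (d + 3) (ans (φ.Sat (upd S i (un j))))) 6
            (upd S₃ d (ans (p ∨ φ.Sat (upd S i (un j))))) := by
          by_cases hφ : φ.Sat (upd S i (un j))
          · refine (Tri.caseCons (b := true) (l := []) (by rw [upd_same, ans_true hφ])
              ((Tri.clear _ d).seq (Tri.push _ d true))).cast ?_ ?_
            · rw [upd_upd, upd_ne _ _ (by omega), e₃]; omega
            · rw [upd_upd, upd_same, upd_upd, ans_true (.inr hφ), ← g₃, upd_self]
          · refine (Tri.caseNil (by rw [upd_same, ans_false hφ]) (Tri.skip _)).cast (by omega) ?_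
            have : (p ∨ φ.Sat (upd S i (un j))) = p := by simp [hφ]
            rw [this, ans_false hφ, ← g₃, upd_self, ← e₃, upd_self]
        refine (h.seq (h'.seq (Tri.push _ i true))).cast (by omega) ?_
        rw [upd_ne _ _ (by omega), e₄]
        funext m
        simp only [hq, hS₃, upd, un, ← List.replicate_succ]
        split_ifs <;> first | rfl | (exfalso; omega))
    set S₄ := upd (upd (upd S₂ d (ans (∃ y < x, φ.Sat (upd S i (un y))))) i (un x)) (d + 2) []
      with hS₄
    have h₄ := Tri.clear S₄ i
    have h₅ := Tri.move (upd S₄ i []) (a := d + 1) (b := i) (by omega)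
    have e₄ : S₄ i = un x := by
      simp only [hS₄, upd]; split_ifs <;> first | rfl | (exfalso; omega)
    have e₅ : S₄ (d + 1) = (S i).reverse := by
      simp only [hS₄, hS₂, upd]; split_ifs <;> first | rfl | (exfalso; omega)
    rw [upd_same, upd_ne _ _ (by omega), e₅, List.reverse_reverse, List.append_nil] at h₅
    refine (h₁.seq (h₂.seq (h₃.seq (h₄.seq h₅)))).cast ?_ ?_
    · rw [e₄]
      simp only [cost, List.length_reverse, List.length_replicate]
      gcongr
    · funext m
      simp only [upd, hS₄, hS₂, Sat, ← hx]
      split_ifs <;> first | rfl | (exfalso; omega) |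
        (subst_vars; first | rfl | exact g₁.symm | exact g₂.symm)

end Fm

end StackProg

/-! ### Polynomial time bounds, and instructions for bounded search and for tables. -/

namespace StackProg

/-- Polynomially bounded functions. -/
def PolyBd (f : ℕ → ℕ) : Prop := ∃ C, ∀ A, 2 ≤ A → f A ≤ A ^ C

namespace PolyBd

theorem const (c : ℕ) : PolyBd fun _ => c :=
  ⟨c, fun _ hA => (Nat.lt_two_pow_self).le.trans (Nat.pow_le_pow_left hA c)⟩

theorem id : PolyBd fun A => A := ⟨1, fun A _ => by simp⟩

theorem add {f g : ℕ → ℕ} (hf : PolyBd f) (hg : PolyBd g) : PolyBd fun A => f A + g A := by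
  obtain ⟨C, hC⟩ := hf
  obtain ⟨D, hD⟩ := hg
  refine ⟨max C D + 1, fun A hA => ?_⟩
  have h₁ := (hC A hA).trans (Nat.pow_le_pow_right (by omega) (le_max_left C D))
  have h₂ := (hD A hA).trans (Nat.pow_le_pow_right (by omega) (le_max_right C D))
  calc f A + g A ≤ A ^ max C D * 2 := by omega
    _ ≤ A ^ max C D * A := Nat.mul_le_mul_left _ hA
    _ = A ^ (max C D + 1) := (pow_succ _ _).symm

theorem mul {f g : ℕ → ℕ} (hf : PolyBd f) (hg : PolyBd g) : PolyBd fun A => f A * g A := by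
  obtain ⟨C, hC⟩ := hf
  obtain ⟨D, hD⟩ := hg
  exact ⟨C + D, fun A hA => by rw [pow_add]; exact Nat.mul_le_mul (hC A hA) (hD A hA)⟩

/-- The argument A + g A is the stack size inside a quantifier, a search or a table construction
whose bound is g A. -/
theorem comp {f g : ℕ → ℕ} (hf : PolyBd f) (hg : PolyBd g) :
    PolyBd fun A => f (A + g A) := by
  obtain ⟨C, hC⟩ := hf
  obtain ⟨D, hD⟩ := add id hg
  refine ⟨D * C, fun A hA => ?_⟩
  rw [pow_mul]
  exact (hC _ (by omega)).trans (Nat.pow_le_pow_left (hD A hA) C)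

end PolyBd

theorem Tm.polyBd_size (t : Tm) : PolyBd t.size := by
  induction t with
  | var i => exact .id
  | lit c => exact .const c
  | add t₁ t₂ h₁ h₂ => exact h₁.add h₂
  | mul t₁ t₂ h₁ h₂ => exact h₁.mul h₂

theorem Tm.polyBd_cost (t : Tm) : PolyBd t.cost := by
  induction t with
  | var i => exact ((PolyBd.const 7).mul .id).add (.const 2)
  | lit c => exact .const c
  | add t₁ t₂ h₁ h₂ => exact h₁.add (h₂.add (((PolyBd.const 3).mul t₂.polyBd_size).add (.const 1)))
  | mul t₁ t₂ h₁ h₂ =>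
    exact h₁.add (h₂.add ((((((PolyBd.const 7).mul t₂.polyBd_size).add (.const 2)).add
      (.const 2)).mul t₁.polyBd_size |>.add (.const 1)).add
      (((PolyBd.const 2).mul t₂.polyBd_size).add (.const 1))))

theorem Fm.polyBd_cost (φ : Fm) : PolyBd φ.cost := by
  induction φ with
  | le t₁ t₂ =>
    exact (PolyBd.const 1).add (t₁.polyBd_cost.add (t₂.polyBd_cost.add
      ((((PolyBd.const 7).mul t₁.polyBd_size).add (.const 1)).add
        (((PolyBd.const 2).mul t₂.polyBd_size).add (.const 1)))))
  | tab k t =>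
    exact t.polyBd_cost.add ((((PolyBd.const 5).mul t.polyBd_size).add (.const 1)).add
      ((PolyBd.const 4).add (((PolyBd.const 3).mul .id).add (.const 1))))
  | and φ ψ h₁ h₂ => exact h₁.add (h₂.add (.const 6))
  | not φ h => exact h.add (.const 3)
  | ex i t φ h =>
    exact t.polyBd_cost.add ((((PolyBd.const 3).mul .id).add (.const 1)).add
      (((((h.comp t.polyBd_size).add (.const 7)).add (.const 2)).mul t.polyBd_size
        |>.add (.const 1)).add ((((PolyBd.const 2).mul t.polyBd_size).add (.const 1)).add
          (((PolyBd.const 3).mul .id).add (.const 1)))))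

open scoped Classical in
/-- The least number below `n` with property `p`, and `n` if there is none. -/
noncomputable def leastBelow (p : ℕ → Prop) : ℕ → ℕ
  | 0 => 0
  | n + 1 => if leastBelow p n < n then leastBelow p n else if p n then n else n + 1

theorem leastBelow_le (p : ℕ → Prop) (n : ℕ) : leastBelow p n ≤ n := by
  induction n with
  | zero => exact le_rfl
  | succ n ih => rw [leastBelow]; split_ifs <;> omega

theorem not_of_lt_leastBelow {p : ℕ → Prop} {n x : ℕ} (h : x < leastBelow p n) : ¬ p x := by
  induction n with
  | zero => simp [leastBelow] at h
  | succ n ih =>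
    have := leastBelow_le p n
    rw [leastBelow] at h
    split_ifs at h with h₁ h₂
    · exact ih h
    · exact ih (by omega)
    · rcases Nat.lt_succ_iff_lt_or_eq.1 h with h | rfl
      · exact ih (by omega)
      · exact h₂

theorem leastBelow_spec {p : ℕ → Prop} {n : ℕ} (h : leastBelow p n < n) : p (leastBelow p n) := by
  induction n with
  | zero => simp [leastBelow] at h
  | succ n ih =>
    rw [leastBelow] at h ⊢
    split_ifs at h ⊢ with h₁ h₂
    · exact ih h₁
    · exact h₂
    · omega

/-- A property below `n` holds first at a given number. -/
theorem leastBelow_eq {p : ℕ → Prop} {n x : ℕ} (hx : x < n) (h : p x) (h' : ∀ y < x, ¬ p y) :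
    leastBelow p n = x := by
  rcases lt_trichotomy (leastBelow p n) x with h₁ | h₁ | h₁
  · exact absurd (leastBelow_spec (h₁.trans hx)) (h' _ h₁)
  · exact h₁
  · exact absurd h (not_of_lt_leastBelow h₁)

theorem leastBelow_lt_iff {p : ℕ → Prop} {n : ℕ} : leastBelow p n < n ↔ ∃ x < n, p x := by
  constructor
  · exact fun h => ⟨_, h, leastBelow_spec h⟩
  · rintro ⟨x, hx, hp⟩
    exact lt_of_le_of_lt (not_lt.1 fun h => not_of_lt_leastBelow h hp) hx

open scoped Classical in
/-- The table of length `n` that is defined by course-of-values recursion: bit number `y` is the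
truth of `φ` when variable `i` is `y` and stack `k` holds the previous bits. -/
noncomputable def tabulate (φ : Fm) (k i : ℕ) (S : St) : ℕ → List Bool
  | 0 => []
  | n + 1 => tabulate φ k i S n ++
      [decide (φ.Sat (upd (upd S k (tabulate φ k i S n)) i (un n)))]

theorem length_tabulate (φ : Fm) (k i : ℕ) (S : St) (n : ℕ) : (tabulate φ k i S n).length = n := by
  induction n with
  | zero => rfl
  | succ n ih => simp [tabulate, ih]

theorem tabulate_prefix (φ : Fm) (k i : ℕ) (S : St) {m n : ℕ} (h : m ≤ n) :
    tabulate φ k i S m <+: tabulate φ k i S n := by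
  induction n with
  | zero => rw [Nat.le_zero.1 h]
  | succ n ih =>
    rcases Nat.le_succ_iff.1 h with h | rfl
    · exact (ih h).trans (List.prefix_append _ _)
    · exact List.prefix_rfl

theorem getElem?_tabulate_eq {φ : Fm} {k i : ℕ} {S : St} {y n : ℕ} (h : y < n) :
    (tabulate φ k i S n)[y]? = some true ↔
      φ.Sat (upd (upd S k (tabulate φ k i S y)) i (un y)) := by
  classical
  obtain ⟨l, hl⟩ := tabulate_prefix φ k i S (show y + 1 ≤ n from h)
  rw [← hl, List.getElem?_append_left (by simp [length_tabulate]), tabulate,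
    List.getElem?_append_right (by simp [length_tabulate])]
  simp [length_tabulate]

/-- When bit y is computed only the bits before it exist, and reading past them gives no. A
recursive property can therefore be stated about the finished table with the guard x < y. -/
theorem getElem?_tabulate_lt {φ : Fm} {k i : ℕ} {S : St} {x y n : ℕ} (hy : y ≤ n) :
    (tabulate φ k i S y)[x]? = some true ↔
      x < y ∧ (tabulate φ k i S n)[x]? = some true := by
  by_cases hx : x < y
  · rw [getElem?_tabulate_eq hx, getElem?_tabulate_eq (hx.trans_le hy)]
    simp [hx]
  · simp [hx, length_tabulate]

/-- Instructions on numbers and tables: assignment of a term, of a power, of the least number below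
`t` with a property (or `t`), and of a table of length `t`. -/
inductive Op
  | assign (i : ℕ) (t : Tm)
  | pow (i a b : ℕ)
  | find (i : ℕ) (t : Tm) (φ : Fm)
  | build (k i : ℕ) (t : Tm) (φ : Fm)

namespace Op

/-- The effect of an instruction. -/
noncomputable def eval : Op → St → St
  | assign i t, S => upd S i (un (t.eval S))
  | pow i a b, S => upd S i (un ((S a).length ^ (S b).length))
  | find i t φ, S => upd S i (un (leastBelow (fun x => φ.Sat (upd S i (un x))) (t.eval S)))
  | build k i t φ, S => upd (upd S i []) k (tabulate φ k i S (t.eval S))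

/-- A strict upper bound of the stacks that occur. -/
def bd : Op → ℕ
  | assign i t => max (i + 1) t.bd
  | pow i a b => max (i + 1) (max (a + 1) (b + 1))
  | find i t φ => max (i + 1) (max t.bd φ.bd)
  | build k i t φ => max (max (k + 1) (i + 1)) (max t.bd φ.bd)

/-- The program of an instruction, with work space from stack `d` on. -/
def comp : Op → ℕ → Cmd
  | assign i t, d => .seq (t.comp d) (.seq (.clear i) (.move d i))
  | pow i a b, d => .seq (.push d true) (.seq ((Tm.var b).comp (d + 1)) (.seq
      (.loop (d + 1)
        (.seq ((Tm.mul (.var d) (.var a)).comp (d + 2)) (.seq (.clear d) (.move (d + 2) d)))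
        (.seq ((Tm.mul (.var d) (.var a)).comp (d + 2)) (.seq (.clear d) (.move (d + 2) d))))
      (.seq (.clear i) (.move d i))))
  | find i t φ, d => .seq (t.comp d) (.seq (.clear i) (.seq
      (.loop d
        (.case (d + 1) (.seq (φ.comp (d + 2))
          (.case (d + 2) (.push i true) .skip (.push (d + 1) true))) .skip (.push (d + 1) true))
        (.case (d + 1) (.seq (φ.comp (d + 2))
          (.case (d + 2) (.push i true) .skip (.push (d + 1) true))) .skip (.push (d + 1) true)))
      (.clear (d + 1))))
  | build k i t φ, d => .seq (t.comp d) (.seq (.clear k) (.seq (.clear i) (.seq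
      (.loop d
        (.seq (φ.comp (d + 1)) (.seq (.move k (d + 2)) (.seq
          (.case (d + 1) (.push (d + 2) false) .skip (.push (d + 2) true))
          (.seq (.move (d + 2) k) (.push i true)))))
        (.seq (φ.comp (d + 1)) (.seq (.move k (d + 2)) (.seq
          (.case (d + 1) (.push (d + 2) false) .skip (.push (d + 2) true))
          (.seq (.move (d + 2) k) (.push i true))))))
      (.clear i))))

/-- A time bound of `comp` on stacks of size at most `A`. -/
def cost : Op → ℕ → ℕ
  | assign _ t, A => t.cost A + ((2 * A + 1) + (3 * t.size A + 1))
  | pow _ _ b, A => 1 + ((Tm.var b).cost A + ((((Tm.mul (.var 0) (.var 0)).cost A +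
      ((2 * A + 1) + (3 * A + 1)) + 2) * A + 1) + ((2 * A + 1) + (3 * A + 1))))
  | find _ t φ, A => t.cost A + ((2 * A + 1) + (((φ.cost (A + t.size A) + 5 + 2) * t.size A + 1) +
      3))
  | build _ _ t φ, A => t.cost A + ((2 * A + 1) + ((2 * A + 1) +
      (((φ.cost (A + t.size A) + ((3 * t.size A + 1) + (3 + ((3 * t.size A + 4) + 1))) + 2) *
        t.size A + 1) + (2 * t.size A + 1))))

/-- The powers that an instruction computes are at most `A`. -/
def Fits : Op → St → ℕ → Prop
  | pow _ a b, S, A => 1 ≤ (S a).length ∧ (S a).length ^ (S b).length ≤ A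
  | _, _, _ => True

theorem polyBd_cost (o : Op) : PolyBd o.cost := by
  cases o with
  | assign i t =>
    exact t.polyBd_cost.add ((((PolyBd.const 2).mul .id).add (.const 1)).add
      (((PolyBd.const 3).mul t.polyBd_size).add (.const 1)))
  | pow i a b =>
    exact (PolyBd.const 1).add ((Tm.polyBd_cost _).add ((((((Tm.polyBd_cost _).add
      ((((PolyBd.const 2).mul .id).add (.const 1)).add
        (((PolyBd.const 3).mul .id).add (.const 1)))).add (.const 2)).mul .id).add (.const 1)).add
      ((((PolyBd.const 2).mul .id).add (.const 1)).add
        (((PolyBd.const 3).mul .id).add (.const 1)))))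
  | find i t φ =>
    exact t.polyBd_cost.add ((((PolyBd.const 2).mul .id).add (.const 1)).add
      (((((φ.polyBd_cost.comp t.polyBd_size).add (.const 5)).add (.const 2)).mul
        t.polyBd_size |>.add (.const 1)).add (.const 3)))
  | build k i t φ =>
    have h := t.polyBd_size
    have h₁ := ((PolyBd.const 2).mul .id).add (.const 1)
    have h₂ := ((PolyBd.const 3).mul h).add (.const 1)
    have h₃ := (PolyBd.const 3).add ((((PolyBd.const 3).mul h).add (.const 4)).add (.const 1))
    have h₄ := ((((φ.polyBd_cost.comp h).add (h₂.add h₃)).add (.const 2)).mul h).add (.const 1)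
    exact t.polyBd_cost.add (h₁.add (h₁.add (h₄.add (((PolyBd.const 2).mul h).add (.const 1)))))

theorem eval_of_le {o : Op} {d j : ℕ} {S : St} (hd : o.bd ≤ d) (hj : d ≤ j) :
    o.eval S j = S j := by
  cases o <;> simp only [bd, max_le_iff] at hd <;> simp only [eval, upd] <;> split_ifs <;>
    first | rfl | (exfalso; omega)

theorem tri_assign (i : ℕ) (t : Tm) {A d : ℕ} {S : St} (hd : (assign i t).bd ≤ d)
    (hS : ∀ j, d ≤ j → S j = []) (hA : ∀ j < (assign i t).bd, (S j).length ≤ A) :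
    Tri ((assign i t).comp d) S ((assign i t).cost A) ((assign i t).eval S) := by
  simp only [bd, max_le_iff] at hd
  have e₁ := t.eval_le (S := S) (A := A) fun j hj => hA j (by simp [bd, hj])
  have hi := hA i (by simp [bd])
  have h₁ := t.tri_comp (A := A) d S hd.2 hS (fun j hj => hA j (by simp [bd, hj]))
  have h₂ := Tri.clear (upd S d (un (t.eval S))) i
  have h₃ := Tri.move (upd (upd S d (un (t.eval S))) i []) (a := d) (b := i) (by omega)
  rw [upd_same, upd_ne _ _ (by omega), upd_same] at h₃
  refine (h₁.seq (h₂.seq h₃)).cast ?_ ?_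
  · rw [upd_ne _ _ (by omega)]
    simp only [cost, un, List.length_replicate]
    gcongr
  · have g := hS d le_rfl
    funext m
    simp only [upd, eval]
    split_ifs <;> first | rfl | (simp; done) | (subst_vars; exact g.symm)

theorem tri_pow (i a b : ℕ) {A d : ℕ} {S : St} (hd : (pow i a b).bd ≤ d)
    (hS : ∀ j, d ≤ j → S j = []) (hA : ∀ j < d, (S j).length ≤ A)
    (hf : (pow i a b).Fits S A) :
    Tri ((pow i a b).comp d) S ((pow i a b).cost A) ((pow i a b).eval S) := by
  simp only [bd, max_le_iff] at hd
  have hi := hA i (by omega)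
  have ha := hA a (by omega)
  have hb := hA b (by omega)
  have gd := hS d le_rfl
  have g₁ := hS (d + 1) (by omega)
  have g₂ := hS (d + 2) (by omega)
  have h₀ := Tri.push S d true
  rw [gd] at h₀
  have h₁ := (Tm.var b).tri_comp (A := A) (d + 1) (upd S d [true]) (by simp [Tm.bd]; omega)
    (fun j hj => by rw [upd_ne _ _ (by omega), hS j (by omega)])
    (fun j hj => by
      simp only [Tm.bd] at hj
      rw [upd_ne _ _ (by omega)]; exact hA j (by omega))
  simp only [Tm.eval] at h₁
  rw [upd_ne _ _ (show b ≠ d by omega)] at h₁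
  set x := (S a).length with hx
  set n := (S b).length with hn
  obtain ⟨hx₁, hpow⟩ : 1 ≤ x ∧ x ^ n ≤ A := hf
  set S₁ := upd (upd S d [true]) (d + 1) (un n) with hS₁
  have h₂ := Tri.loop (k := d + 1) (n := n)
    (τ := (Tm.mul (.var 0) (.var 0)).cost A + ((2 * A + 1) + (3 * A + 1)))
    (c := .seq ((Tm.mul (.var d) (.var a)).comp (d + 2)) (.seq (.clear d) (.move (d + 2) d)))
    (S := S₁) (by rw [hS₁, upd_same, List.length_replicate])
    (fun j => upd S₁ d (un (x ^ j)))
    (by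
      congr 1
      funext m
      simp only [upd, hS₁, pow_zero]
      split_ifs <;> first | rfl | (exfalso; omega))
    (fun j hj l => by
      -- Since the base is positive, all intermediate powers stay below the final one, which is at
      -- most A by `Fits`. Powers are the only values without an a priori polynomial bound.
      have hle : x ^ (j + 1) ≤ A := (Nat.pow_le_pow_right hx₁ hj).trans hpow
      have hle' : x ^ j ≤ A := (Nat.pow_le_pow_right hx₁ hj.le).trans hpow
      set S₂ := upd (upd S₁ d (un (x ^ j))) (d + 1) l with hS₂
      have ed : S₂ d = un (x ^ j) := by rw [hS₂, upd_ne _ _ (by omega), upd_same]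
      have ea : S₂ a = S a := by
        rw [hS₂, upd_ne _ _ (by omega), upd_ne _ _ (by omega), hS₁, upd_ne _ _ (by omega),
          upd_ne _ _ (by omega)]
      have h := (Tm.mul (.var d) (.var a)).tri_comp (A := A) (d + 2) S₂
        (by simp only [Tm.bd]; omega)
        (fun m hm => by
          simp only [hS₂, hS₁, upd]
          split_ifs <;> first | (exfalso; omega) | exact hS m (by omega))
        (fun m hm => by
          simp only [Tm.bd] at hm
          by_cases hmd : m = d
          · rw [hmd, ed]; simpa using hle'
          · simp only [hS₂, hS₁, upd]
            split_ifs <;> first | (exfalso; omega) | exact hA m (by omega))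
      simp only [Tm.eval, ed, ea, List.length_replicate, ← hx, ← pow_succ] at h
      have c₂ : S₂ (d + 2) = [] := by
        simp only [hS₂, hS₁, upd]
        split_ifs <;> first | (exfalso; omega) | exact g₂
      have m₁ := Tri.clear (upd S₂ (d + 2) (un (x ^ (j + 1)))) d
      have m₂ := Tri.move (upd (upd S₂ (d + 2) (un (x ^ (j + 1)))) d []) (a := d + 2) (b := d)
        (by omega)
      rw [upd_ne _ _ (show d ≠ d + 2 by omega), ed, List.length_replicate] at m₁
      rw [upd_same, upd_ne _ _ (show d + 2 ≠ d by omega), upd_same, List.append_nil,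
        List.reverse_replicate, List.length_replicate] at m₂
      refine (h.seq (m₁.seq m₂)).cast ?_ ?_
      · have : (Tm.mul (.var d) (.var a)).cost A = (Tm.mul (.var 0) (.var 0)).cost A := rfl
        rw [this]
        gcongr
      · funext m
        simp only [upd, hS₂]
        split_ifs <;> first | rfl | (exfalso; omega) |
          (subst_vars; simp only [hS₂, upd] at c₂; split_ifs at c₂ <;> exact c₂.symm))
  set S₂ := upd (upd S₁ d (un (x ^ n))) (d + 1) [] with hS₂
  have h₃ := Tri.clear S₂ i
  have h₄ := Tri.move (upd S₂ i []) (a := d) (b := i) (by omega)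
  have ed : S₂ d = un (x ^ n) := by rw [hS₂, upd_ne _ _ (by omega), upd_same]
  have ei : S₂ i = S i := by
    rw [hS₂, upd_ne _ _ (by omega), upd_ne _ _ (by omega), hS₁, upd_ne _ _ (by omega),
      upd_ne _ _ (by omega)]
  rw [ei] at h₃
  rw [upd_same, upd_ne _ _ (show d ≠ i by omega), ed, List.append_nil, List.reverse_replicate,
    List.length_replicate] at h₄
  refine (h₀.seq (h₁.seq (h₂.seq (h₃.seq h₄)))).cast ?_ ?_
  · have : (Tm.var b).cost A = (Tm.var 0).cost A := rfl
    simp only [cost]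
    gcongr
  · funext m
    simp only [upd, hS₂, hS₁, eval, ← hx, ← hn]
    split_ifs <;> first | rfl |
      (subst_vars; first | rfl | exact g₁.symm | exact gd.symm)

/-- The loop cannot be left early. Instead a flag on d + 1 records success; once it is set, the
remaining rounds do nothing and the candidate on stack i stays frozen. -/
theorem tri_find (i : ℕ) (t : Tm) (φ : Fm) {A d : ℕ} {S : St} (hd : (find i t φ).bd ≤ d)
    (hS : ∀ j, d ≤ j → S j = []) (hA : ∀ j < (find i t φ).bd, (S j).length ≤ A) :
    Tri ((find i t φ).comp d) S ((find i t φ).cost A) ((find i t φ).eval S) := by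
  simp only [bd, max_le_iff] at hd
  have e₁ := t.eval_le (S := S) (A := A) fun j hj => hA j (by simp [bd, hj])
  have hi := hA i (by simp [bd])
  have gd := hS d le_rfl
  have g₁ := hS (d + 1) (by omega)
  have g₂ := hS (d + 2) (by omega)
  have h₁ := t.tri_comp (A := A) d S (by omega) hS (fun j hj => hA j (by simp [bd, hj]))
  set x := t.eval S with hx
  have h₂ := Tri.clear (upd S d (un x)) i
  set S₁ := upd (upd S d (un x)) i [] with hS₁
  set p : ℕ → Prop := fun x => φ.Sat (upd S i (un x)) with hp
  have h₃ := Tri.loop (k := d) (n := x) (τ := φ.cost (A + t.size A) + 5)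
    (c := .case (d + 1) (.seq (φ.comp (d + 2))
      (.case (d + 2) (.push i true) .skip (.push (d + 1) true))) .skip (.push (d + 1) true))
    (S := S₁) (by rw [hS₁, upd_ne _ _ (by omega), upd_same, List.length_replicate])
    (fun j => upd (upd S₁ (d + 1) (ans (leastBelow p j < j))) i (un (leastBelow p j)))
    (by
      congr 1
      funext m
      simp only [upd, hS₁, leastBelow]
      split_ifs <;> first | rfl | (exfalso; omega) | (subst_vars; simp [ans, g₁]))
    (fun j hj l => by
      have hle := leastBelow_le p j
      set S₂ := upd (upd (upd S₁ (d + 1) (ans (leastBelow p j < j))) i (un (leastBelow p j))) d l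
        with hS₂
      have e₁ : S₂ (d + 1) = ans (leastBelow p j < j) := by
        rw [hS₂, upd_ne _ _ (by omega), upd_ne _ _ (by omega), upd_same]
      have e₂ : S₂ i = un (leastBelow p j) := by
        rw [hS₂, upd_ne _ _ (by omega), upd_same]
      by_cases hlt : leastBelow p j < j
      · have hl' : leastBelow p (j + 1) = leastBelow p j := by rw [leastBelow, if_pos hlt]
        refine (Tri.caseCons (b := true) (l := []) (by rw [e₁, ans_true hlt])
          (Tri.push _ (d + 1) true)).cast (by omega) ?_
        rw [upd_same, upd_upd, hl', ans_true (show leastBelow p j < j + 1 by omega), hS₂,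
          ans_true hlt]
        funext m
        simp only [upd]
        split_ifs <;> first | rfl | (exfalso; omega)
      · have hj' : leastBelow p j = j := by omega
        rw [ans_false hlt] at e₁
        rw [hj'] at e₂
        have agree : ∀ m < d, S₂ m = upd S i (un j) m := by
          intro m hm
          simp only [hS₂, hS₁, upd, hj']
          split_ifs <;> first | rfl | (exfalso; omega)
        have h := φ.tri_comp (A := A + t.size A) (d := d + 2) (S := S₂) (by omega)
          (fun m hm => by
            simp only [hS₂, hS₁, upd]
            split_ifs <;> first | (exfalso; omega) | exact hS m (by omega))
          (fun m hm => by
            rw [agree m (by omega), upd]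
            split_ifs
            · simp; omega
            · exact (hA m (by simp [bd, hm])).trans (by omega))
        rw [φ.sat_congr (S := S₂) (S' := upd S i (un j)) fun m hm => agree m (by omega)] at h
        have g₃ : S₂ (d + 2) = [] := by
          simp only [hS₂, hS₁, upd]
          split_ifs <;> first | (exfalso; omega) | exact g₂
        have e₄ : upd S₂ (d + 2) [] = S₂ := by rw [← g₃, upd_self]
        have h' : Tri (.case (d + 2) (.push i true) .skip (.push (d + 1) true))
            (upd S₂ (d + 2) (ans (p j))) 3 (upd (upd (upd S₁ (d + 1)
              (ans (leastBelow p (j + 1) < j + 1))) i (un (leastBelow p (j + 1)))) d l) := by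
          by_cases hpj : p j
          · have hl' : leastBelow p (j + 1) = j := by rw [leastBelow, if_neg hlt, if_pos hpj]
            refine (Tri.caseCons (b := true) (l := []) (by rw [upd_same, ans_true hpj])
              (Tri.push _ _ true)).cast (by omega) ?_
            rw [upd_upd, e₄, e₁, hl', ans_true (Nat.lt_succ_self j), hS₂, hj']
            funext m
            simp only [upd]
            split_ifs <;> first | rfl | (exfalso; omega)
          · have hl' : leastBelow p (j + 1) = j + 1 := by rw [leastBelow, if_neg hlt, if_neg hpj]
            refine (Tri.caseNil (by rw [upd_same, ans_false hpj])
              (Tri.push _ _ true)).cast (by omega) ?_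
            rw [ans_false hpj, e₄, e₂, hl', ans_false (lt_irrefl (j + 1)), hS₂, ans_false hlt]
            funext m
            simp only [upd, un, List.replicate_succ]
            split_ifs <;> first | rfl | (exfalso; omega)
        exact (Tri.caseNil e₁ (h.seq h')).mono (by omega))
  set S₃ := upd (upd (upd S₁ (d + 1) (ans (leastBelow p x < x))) i (un (leastBelow p x))) d []
    with hS₃
  have h₄ := Tri.clear S₃ (d + 1)
  refine (h₁.seq (h₂.seq (h₃.seq h₄))).cast ?_ ?_
  · have e₃ : S₃ (d + 1) = ans (leastBelow p x < x) := by
      rw [hS₃, upd_ne _ _ (by omega), upd_ne _ _ (by omega), upd_same]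
    have := length_ans_le (leastBelow p x < x)
    rw [e₃, upd_ne _ _ (by omega)]
    simp only [cost]
    gcongr
    omega
  · funext m
    simp only [upd, hS₃, hS₁, eval, ← hx, ← hp]
    split_ifs <;> first | rfl | (exfalso; omega) |
      (subst_vars; first | rfl | exact g₁.symm | exact gd.symm)

theorem tri_build (k i : ℕ) (t : Tm) (φ : Fm) {A d : ℕ} {S : St} (hd : (build k i t φ).bd ≤ d)
    (hki : k ≠ i)
    (hS : ∀ j, d ≤ j → S j = []) (hA : ∀ j < (build k i t φ).bd, (S j).length ≤ A) :
    Tri ((build k i t φ).comp d) S ((build k i t φ).cost A) ((build k i t φ).eval S) := by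
  simp only [bd, max_le_iff] at hd
  have e₁ := t.eval_le (S := S) (A := A) fun j hj => hA j (by simp [bd, hj])
  have hi := hA i (by simp [bd])
  have hk := hA k (by simp [bd])
  have gd := hS d le_rfl
  have g₁ := hS (d + 1) (by omega)
  have g₂ := hS (d + 2) (by omega)
  have h₁ := t.tri_comp (A := A) d S (by omega) hS (fun j hj => hA j (by simp [bd, hj]))
  set x := t.eval S with hx
  have h₂ := Tri.clear (upd S d (un x)) k
  have h₂' := Tri.clear (upd (upd S d (un x)) k []) i
  set S₁ := upd (upd (upd S d (un x)) k []) i [] with hS₁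
  set f := tabulate φ k i S with hf
  have hlf : ∀ n, (f n).length = n := length_tabulate φ k i S
  have h₃ := Tri.loop (k := d) (n := x)
    (τ := φ.cost (A + t.size A) + ((3 * t.size A + 1) + (3 + ((3 * t.size A + 4) + 1))))
    (c := .seq (φ.comp (d + 1)) (.seq (.move k (d + 2)) (.seq
          (.case (d + 1) (.push (d + 2) false) .skip (.push (d + 2) true))
          (.seq (.move (d + 2) k) (.push i true)))))
    (S := S₁) (by
      rw [hS₁, upd_ne _ _ (by omega), upd_ne _ _ (by omega), upd_same, List.length_replicate])
    (fun j => upd (upd S₁ k (f j)) i (un j))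
    (by
      congr 1
      funext m
      simp only [upd, hS₁, hf, tabulate]
      split_ifs <;> rfl)
    (fun j hj l => by
      set S₂ := upd (upd (upd S₁ k (f j)) i (un j)) d l with hS₂
      set p := φ.Sat (upd (upd S k (f j)) i (un j)) with hp
      have agree : ∀ m < d, S₂ m = upd (upd S k (f j)) i (un j) m := by
        intro m hm
        simp only [hS₂, hS₁, upd]
        split_ifs <;> first | rfl | (exfalso; omega)
      have h := φ.tri_comp (A := A + t.size A) (d := d + 1) (S := S₂) (by omega)
        (fun m hm => by
          simp only [hS₂, hS₁, upd]
          split_ifs <;> first | (exfalso; omega) | exact hS m (by omega))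
        (fun m hm => by
          rw [agree m (by omega), upd, upd]
          split_ifs
          · simp; omega
          · rw [hlf]; omega
          · exact (hA m (by simp [bd, hm])).trans (by omega))
      rw [φ.sat_congr (S := S₂) (S' := upd (upd S k (f j)) i (un j))
        fun m hm => agree m (by omega)] at h
      have c₁ : S₂ (d + 1) = [] := by
        simp only [hS₂, hS₁, upd]
        split_ifs <;> first | (exfalso; omega) | exact g₁
      have c₂ : S₂ (d + 2) = [] := by
        simp only [hS₂, hS₁, upd]
        split_ifs <;> first | (exfalso; omega) | exact g₂
      have ck : S₂ k = f j := by
        simp only [hS₂, upd]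
        split_ifs <;> first | (exfalso; omega) | rfl
      have ci : S₂ i = un j := by
        simp only [hS₂, upd]
        split_ifs <;> first | (exfalso; omega) | rfl
      have m₁ := Tri.move (upd S₂ (d + 1) (ans p)) (a := k) (b := d + 2) (by omega)
      rw [upd_ne _ _ (show k ≠ d + 1 by omega), upd_ne _ _ (show d + 2 ≠ d + 1 by omega), ck, c₂,
        List.append_nil, hlf] at m₁
      classical
      -- A new bit belongs at the bottom of the table stack: the table is turned over onto d + 2,
      -- the bit is pushed there, and everything is poured back.
      have m₂ : Tri (.case (d + 1) (.push (d + 2) false) .skip (.push (d + 2) true))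
          (upd (upd (upd S₂ (d + 1) (ans p)) k []) (d + 2) (f j).reverse) 3
          (upd (upd S₂ k []) (d + 2) (f (j + 1)).reverse) := by
        have hf' : (f (j + 1)).reverse = decide p :: (f j).reverse := by
          simp only [hf, tabulate, List.reverse_append, List.reverse_singleton]; rfl
        by_cases hpj : p
        · refine (Tri.caseCons (b := true) (l := []) ?_ (Tri.push _ _ true)).cast (by omega) ?_
          · rw [upd_ne _ _ (by omega), upd_ne _ _ (by omega), upd_same, ans_true hpj]
          · rw [hf', decide_eq_true hpj, upd_ne _ _ (show d + 2 ≠ d + 1 by omega), upd_same]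
            funext m
            simp only [upd]
            split_ifs <;> first | rfl | (subst_vars; exact c₁.symm)
        · refine (Tri.caseNil ?_ (Tri.push _ _ false)).cast (by omega) ?_
          · rw [upd_ne _ _ (by omega), upd_ne _ _ (by omega), upd_same, ans_false hpj]
          · rw [hf', decide_eq_false hpj, upd_same, ans_false hpj]
            funext m
            simp only [upd]
            split_ifs <;> first | rfl | (subst_vars; exact c₁.symm)
      have m₃ := Tri.move (upd (upd S₂ k []) (d + 2) (f (j + 1)).reverse) (a := d + 2) (b := k)
        (by omega)
      rw [upd_same, upd_ne _ _ (show k ≠ d + 2 by omega), upd_same, List.append_nil,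
        List.reverse_reverse, List.length_reverse, hlf] at m₃
      refine (h.seq (m₁.seq (m₂.seq (m₃.seq (Tri.push _ i true))))).cast (by omega) ?_
      have ci' : upd (upd (upd (upd S₂ k []) (d + 2) (f (j + 1)).reverse) (d + 2) []) k
          (f (j + 1)) i = un j := by
        rw [upd_ne _ _ hki.symm, upd_ne _ _ (by omega), upd_ne _ _ (by omega),
          upd_ne _ _ hki.symm, ci]
      rw [ci']
      funext m
      simp only [upd, hS₂, un, List.replicate_succ]
      split_ifs <;> first | rfl | (exfalso; omega) |
        (subst_vars; simp only [hS₂, upd] at c₂; split_ifs at c₂ <;> exact c₂.symm))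
  set S₃ := upd (upd (upd S₁ k (f x)) i (un x)) d [] with hS₃
  have h₄ := Tri.clear S₃ i
  refine (h₁.seq (h₂.seq (h₂'.seq (h₃.seq h₄)))).cast ?_ ?_
  · have e₃ : S₃ i = un x := by
      rw [hS₃, upd_ne _ _ (by omega), upd_same]
    rw [e₃, upd_ne _ _ (by omega), upd_ne _ _ hki.symm, upd_ne _ _ (by omega)]
    simp only [cost, List.length_replicate]
    gcongr
  · funext m
    simp only [upd, hS₃, hS₁, eval, ← hx, ← hf]
    split_ifs <;> first | rfl | (exfalso; omega) |
      (subst_vars; first | rfl | exact gd.symm)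

end Op

end StackProg

/-! ### From a list of instructions to a machine. -/

namespace StackProg

namespace Op

/-- The table that an instruction builds is not its own index variable. -/
def WF : Op → Prop
  | build k i _ _ => k ≠ i
  | _ => True

theorem tri_comp (o : Op) {A d : ℕ} {S : St} (hd : o.bd ≤ d) (hw : o.WF)
    (hS : ∀ j, d ≤ j → S j = []) (hA : ∀ j < d, (S j).length ≤ A) (hf : o.Fits S A) :
    Tri (o.comp d) S (o.cost A) (o.eval S) := by
  cases o with
  | assign i t => exact tri_assign i t hd hS fun j hj => hA j (by omega)
  | pow i a b => exact tri_pow i a b hd hS hA hf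
  | find i t φ => exact tri_find i t φ hd hS fun j hj => hA j (by omega)
  | build k i t φ => exact tri_build k i t φ hd hw hS fun j hj => hA j (by omega)

/-- The effect of a list of instructions. -/
noncomputable def evalAll : List Op → St → St
  | [], S => S
  | o :: os, S => evalAll os (o.eval S)

/-- The program of a list of instructions. -/
def compAll : List Op → ℕ → Cmd
  | [], _ => .skip
  | o :: os, d => .seq (o.comp d) (compAll os d)

/-- A time bound of `compAll`. -/
def costAll : List Op → ℕ → ℕ
  | [], _ => 0
  | o :: os, A => o.cost A + costAll os A

/-- All stacks below `d` have size at most `A` throughout the execution. -/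
def Ok (d A : ℕ) : List Op → St → Prop
  | [], S => ∀ j < d, (S j).length ≤ A
  | o :: os, S => (∀ j < d, (S j).length ≤ A) ∧ o.Fits S A ∧ Ok d A os (o.eval S)

theorem Ok.last {d A : ℕ} {os : List Op} {S : St} (h : Ok d A os S) :
    ∀ j < d, (evalAll os S j).length ≤ A := by
  induction os generalizing S with
  | nil => exact h
  | cons o os ih => exact ih h.2.2

theorem polyBd_costAll (os : List Op) : PolyBd (costAll os) := by
  induction os with
  | nil => exact .const 0
  | cons o os ih => exact o.polyBd_cost.add ih

theorem evalAll_of_le {d j : ℕ} {os : List Op} {S : St} (hd : ∀ o ∈ os, o.bd ≤ d) (hj : d ≤ j) :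
    evalAll os S j = S j := by
  induction os generalizing S with
  | nil => rfl
  | cons o os ih =>
    rw [evalAll, ih fun o ho => hd o (by simp [ho]), eval_of_le (hd o (by simp)) hj]

theorem tri_compAll {A d : ℕ} {os : List Op} {S : St} (hd : ∀ o ∈ os, o.bd ≤ d)
    (hw : ∀ o ∈ os, o.WF) (hS : ∀ j, d ≤ j → S j = []) (hok : Ok d A os S) :
    Tri (compAll os d) S (costAll os A) (evalAll os S) := by
  induction os generalizing S with
  | nil => exact Tri.skip S
  | cons o os ih =>
    obtain ⟨h₁, h₂, h₃⟩ := hok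
    have hd' := hd o (by simp)
    refine (o.tri_comp hd' (hw o (by simp)) hS h₁ h₂).seq
      (ih (fun o ho => hd o (by simp [ho])) (fun o ho => hw o (by simp [ho])) (fun j hj => ?_) h₃)
    rw [eval_of_le hd' hj, hS j hj]

end Op

namespace Cmd

/-- Empty all stacks below `d`. -/
def clearAll : ℕ → Cmd
  | 0 => .skip
  | d + 1 => .seq (clearAll d) (.clear d)

end Cmd

theorem Tri.clearAll {A d : ℕ} {S : St} (hA : ∀ j < d, (S j).length ≤ A) :
    Tri (.clearAll d) S (d * (2 * A + 1)) (fun j => if j < d then [] else S j) := by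
  induction d with
  | zero => exact (skip S).cast (by omega) (by simp)
  | succ d ih =>
    have h := (ih fun j hj => hA j (by omega)).seq (clear _ d)
    have := hA d (by omega)
    refine h.cast ?_ ?_
    · simp only [lt_irrefl, if_false]
      rw [add_mul, one_mul]; omega
    · funext j
      simp only [upd]
      split_ifs <;> first | rfl | (exfalso; omega)

/-- A list of instructions whose answer is yes if and only if stack `r` is empty in the end, as a
machine. -/
theorem exists_machine (os : List Op) {d r : ℕ} (hd : ∀ o ∈ os, o.bd ≤ d) (hw : ∀ o ∈ os, o.WF)
    (hr : r < d) :
    ∃ (M : Turing.TM2ComputableAux Bool Bool) (C : ℕ), (∀ s : M.tm.K, Finite (M.tm.Γ s)) ∧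
      ∀ (x : List Bool) (A : ℕ) (b : Bool), 2 ≤ A → Op.Ok d A os (upd (fun _ => []) 0 x) →
        (b = true ↔ Op.evalAll os (upd (fun _ => []) 0 x) r = []) →
        ∀ T, A ^ C ≤ T →
        Nonempty (Turing.TM2OutputsInTime M.tm (x.map M.inputAlphabet.invFun)
          (some ((Computability.encodeBool b).map M.outputAlphabet.invFun)) T) := by
  set c : Cmd := .seq (Op.compAll os d) (.seq
    (.case r (.push d true) (.push d false) (.push d false)) (.clearAll d)) with hc
  set D := max c.bd (d + 1) with hD
  have h₀ : 0 < D := by omega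
  have h₁ : d < D := by omega
  -- The exponent depends on the instructions only, not on the input.
  obtain ⟨C, hC⟩ : PolyBd fun A => Op.costAll os A + (3 + d * (2 * A + 1)) + 1 :=
    ((Op.polyBd_costAll os).add ((PolyBd.const 3).add ((PolyBd.const d).mul
      (((PolyBd.const 2).mul .id).add (.const 1))))).add (.const 1)
  refine ⟨⟨machine (c.code 0) D 0 d h₀ h₁, Equiv.refl Bool, Equiv.refl Bool⟩, C,
    fun _ => inferInstanceAs (Finite Bool), fun x A b hA hok hb T hT => ?_⟩
  set S := Op.evalAll os (upd (fun _ => []) 0 x) with hS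
  have hlast := hok.last
  rw [← hS] at hlast
  have t₁ := Op.tri_compAll hd hw (fun j hj => by rw [upd_ne _ _ (by omega)]) hok
  have eS : S d = [] := by
    rw [hS, Op.evalAll_of_le hd le_rfl, upd_ne _ _ (by omega)]
  -- The answer is put on stack d, which no instruction uses, so that clearing the stacks below d
  -- leaves exactly the output.
  have t₂ : ∃ S', Tri (.case r (.push d true) (.push d false) (.push d false)) S 3 S' ∧
      (∀ j < d, (S' j).length ≤ A) ∧ S' d = [b] ∧ ∀ j, d < j → S' j = [] := by
    have e : ∀ j, d < j → S j = [] := fun j hj => by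
      rw [hS, Op.evalAll_of_le hd hj.le, upd_ne _ _ (by omega)]
    cases hSr : S r with
    | nil =>
      refine ⟨_, Tri.caseNil hSr (Tri.push _ d true), fun j hj => ?_, ?_, fun j hj => ?_⟩
      · rw [upd_ne _ _ (by omega)]; exact hlast j hj
      · rw [upd_same, eS, hb.2 hSr]
      · rw [upd_ne _ _ (by omega), e j hj]
    | cons y l =>
      have hb' : b = false := by
        rw [← Bool.not_eq_true, hb, hSr]; simp
      refine ⟨_, Tri.caseCons hSr (b := y) (l := l) (T := 1)
        (S' := upd (upd S r l) d (false :: upd S r l d)) ?_, fun j hj => ?_, ?_, fun j hj => ?_⟩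
      · cases y <;> exact Tri.push _ d false
      · rw [upd_ne _ _ (by omega)]
        have h' := hlast j hj
        by_cases hjr : j = r
        · rw [hjr, hSr] at h'
          rw [hjr, upd_same]
          simp at h'; omega
        · rw [upd_ne _ _ hjr]; exact h'
      · rw [upd_same, upd_ne _ _ (by omega), eS, hb']
      · rw [upd_ne _ _ (by omega), upd_ne _ _ (by omega), e j hj]
  obtain ⟨S', t₂, hA', hd', hj'⟩ := t₂
  have t₃ := t₁.seq (t₂.seq (Tri.clearAll hA'))
  have e : (fun j => if j < d then [] else S' j) = upd (fun _ => []) d [b] := by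
    funext j
    simp only [upd]
    split_ifs with h h' h'
    · omega
    · rfl
    · rw [h', hd']
    · exact hj' j (by omega)
  rw [e] at t₃
  obtain ⟨t, ht, hrun⟩ := t₃
  have := hrun.outputsInTime h₀ h₁ (le_max_left _ _) (T := T)
    (by have := hC A hA; simp only at this; omega)
  have e₁ : x.map (Equiv.refl Bool).invFun = x := List.map_id x
  have e₂ : (Computability.encodeBool b).map (Equiv.refl Bool).invFun = [b] := rfl
  have key : ∀ y z : List Bool, y = x → z = [b] → Nonempty (Turing.TM2OutputsInTime
      (machine (c.code 0) D 0 d h₀ h₁) y (some z) T) := by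
    rintro _ _ rfl rfl; exact this
  exact key _ _ e₁ e₂

end StackProg

/-! ### The Erdős–Gallai theorem. -/

namespace ErdosGallai

open Finset SimpleGraph

open scoped Classical in
/-- The degree of a vertex, without instance arguments. -/
noncomputable def deg {V : Type*} [Fintype V] (G : SimpleGraph V) (v : V) : ℕ :=
  #{w | G.Adj v w}

section

variable {V : Type*} [Fintype V] {G : SimpleGraph V}

open scoped Classical in
theorem deg_eq_sum (v : V) : deg G v = ∑ w, if G.Adj v w then 1 else 0 := by
  rw [deg, card_filter]

/-- Degree changes are recorded as sums of indicators, so that those of a whole edge exchange add up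
by linear arithmetic. -/
theorem deg_add {u v : V} (huv : u ≠ v) (h : ¬ G.Adj u v) (x : V) [DecidableEq V] :
    deg (G ⊔ edge u v) x = deg G x + (if x = u then 1 else 0) + if x = v then 1 else 0 := by
  classical
  have hadj : ∀ a b, (G ⊔ edge u v).Adj a b ↔ G.Adj a b ∨ (a = u ∧ b = v ∨ a = v ∧ b = u) := by
    intro a b
    simp only [sup_adj, edge_adj]
    constructor
    · rintro (h | h)
      · exact .inl h
      · exact .inr (by tauto)
    · rintro (h | h | h)
      · exact .inl h
      · exact .inr ⟨.inl (by tauto), by rw [h.1, h.2]; exact huv⟩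
      · exact .inr ⟨.inr (by tauto), by rw [h.1, h.2]; exact huv.symm⟩
  simp only [deg_eq_sum, hadj]
  have : ∀ w, (if G.Adj x w ∨ (x = u ∧ w = v ∨ x = v ∧ w = u) then 1 else 0) =
      (if G.Adj x w then 1 else 0) + (if x = u then if w = v then 1 else 0 else 0) +
        (if x = v then if w = u then 1 else 0 else 0) := by
    intro w
    have h' : ¬ G.Adj v u := fun h' => h h'.symm
    by_cases h₁ : x = u
    · subst h₁
      by_cases h₂ : w = v
      · subst h₂; simp [h, huv]
      · simp [h₂, huv]
    · by_cases h₂ : x = v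
      · subst h₂
        by_cases h₃ : w = u
        · subst h₃; simp [h', huv.symm]
        · simp [h₁, h₃]
      · simp [h₁, h₂]
  simp only [this, sum_add_distrib]
  congr 1
  · congr 1
    split_ifs <;> simp
  · split_ifs <;> simp

theorem deg_del {u v : V} (h : G.Adj u v) (x : V) [DecidableEq V] :
    deg (G.deleteEdges {s(u, v)}) x + (if x = u then 1 else 0) + (if x = v then 1 else 0) =
      deg G x := by
  rw [← deg_add h.ne (by simp)]
  congr 1
  ext a b
  simp only [sup_adj, deleteEdges_adj, edge_adj, Set.mem_singleton_iff, Sym2.eq_iff]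
  constructor
  · rintro (h' | ⟨(⟨rfl, rfl⟩ | ⟨rfl, rfl⟩), _⟩)
    · exact h'.1
    · exact h
    · exact h.symm
  · intro h'
    by_cases hab : a = u ∧ b = v ∨ a = v ∧ b = u
    · exact .inr ⟨by tauto, h'.ne⟩
    · exact .inl ⟨h', by tauto⟩

/-- The neighbourhoods are compared after removing r from that of i and i from that of r. If i and r
are adjacent both lose one element, so the strict inequality between the degrees survives. -/
theorem exists_adj_of_deg_lt {i r : V} (h : deg G r < deg G i) :
    ∃ u, G.Adj i u ∧ ¬ G.Adj r u ∧ u ≠ r := by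
  classical
  by_contra! hc
  have hir : i ≠ r := by rintro rfl; exact lt_irrefl _ h
  refine absurd h (not_lt.2 ?_)
  unfold deg
  by_cases hadj : G.Adj i r
  · have h₁ : ({w | G.Adj i w} : Finset V).erase r ⊆ ({w | G.Adj r w} : Finset V).erase i := by
      intro w hw
      simp only [mem_erase, mem_filter, mem_univ, true_and] at hw ⊢
      refine ⟨hw.2.ne', ?_⟩
      by_contra hr
      exact hw.1 (hc w hw.2 hr)
    have h₂ := card_le_card h₁
    rw [card_erase_of_mem (by simp [hadj]), card_erase_of_mem (by simp [hadj.symm])] at h₂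
    have h₃ : 0 < #{w | G.Adj r w} := card_pos.2 ⟨i, by simp [hadj.symm]⟩
    omega
  · refine card_le_card fun w hw => ?_
    simp only [mem_filter, mem_univ, true_and] at hw ⊢
    by_contra hr
    have := hc w hw hr
    exact hadj (this ▸ hw)

end

variable {n : ℕ} {d : Fin n → ℕ}

/-- A graph whose degrees are at most `d`, and equal to `d` before `r`, without edges behind `r`. -/
structure Partial (d : Fin n → ℕ) (r : Fin n) (G : SimpleGraph (Fin n)) : Prop where
  full : ∀ i < r, deg G i = d i
  le : ∀ i, deg G i ≤ d i
  indep : ∀ i j, r < i → r < j → ¬ G.Adj i j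

/-- The change of the degree of `x` when one endpoint is `u`. -/
local notation "δ(" x ", " u ")" => (if x = u then 1 else 0)

/-- As d i ≥ d r > deg r, the vertex i has a neighbour u that is not a neighbour of r. Exchanging
the edge iu for ru and ri raises the degree of r by two and changes no other. This is too much if
only one unit is missing at r. -/
theorem Partial.improve_of_not_adj {r : Fin n} {G : SimpleGraph (Fin n)} (h : Partial d r G)
    (hd : Antitone d) (heven : Even (∑ i, d i)) (hlt : deg G r < d r)
    (h₀ : ∀ k, r < k → ¬ G.Adj r k → deg G k = d k) {i : Fin n} (hi : i < r) (hri : ¬ G.Adj r i) :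
    ∃ G', Partial d r G' ∧ deg G r < deg G' r := by
  classical
  have hdi := h.full i hi
  have hdr : d r ≤ d i := hd hi.le
  obtain ⟨u, hiu, hru, hur⟩ := exists_adj_of_deg_lt (G := G) (i := i) (r := r) (by omega)
  have hui := hiu.ne'
  have hir := hi.ne
  by_cases hgap : deg G r + 2 ≤ d r
  · set G₁ := G.deleteEdges {s(i, u)} with hG₁
    set G₂ := G₁ ⊔ edge r u with hG₂
    set G₃ := G₂ ⊔ edge r i with hG₃
    have e₁ := deg_del hiu
    have e₂ := deg_add (G := G₁) (u := r) (v := u) hur.symm (by simp [hG₁, hru])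
    have e₃ := deg_add (G := G₂) (u := r) (v := i) hir.symm
      (by simp [hG₂, hG₁, hri, edge_adj, hur.symm, hir, hui.symm])
    rw [← hG₁] at e₁; rw [← hG₂] at e₂; rw [← hG₃] at e₃
    have e : ∀ x, deg G₃ x = deg G x + δ(x, r) + δ(x, r) := by
      intro x
      have := e₁ x; have := e₂ x; have := e₃ x
      omega
    refine ⟨G₃, ⟨fun x hx => ?_, fun x => ?_, fun x y hx hy => ?_⟩, ?_⟩
    · rw [e, if_neg hx.ne, h.full x hx]; rfl
    · rw [e]
      by_cases hx : x = r
      · subst hx; simp; omega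
      · simpa [hx] using h.le x
    · have := h.indep x y hx hy
      simp [hG₃, hG₂, hG₁, edge_adj, this, hx.ne', hy.ne']
    · rw [e]; simp
  -- Exactly one unit is missing at r. The sum of d and the sum of the degrees are both even, so
  -- another vertex k is deficient too. It lies behind r and is adjacent to r by `h₀`, and removing
  -- the edge rk as well corrects the surplus.
  · obtain ⟨k, hkr, hk⟩ : ∃ k, k ≠ r ∧ deg G k < d k := by
      by_contra! hc
      have h₁ : ∑ x, d x = ∑ x, deg G x + 1 := by
        have : ∀ x, d x = deg G x + δ(x, r) := by
          intro x
          by_cases hx : x = r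
          · subst hx; simp; omega
          · simp only [hx, if_false]
            exact le_antisymm (hc x hx) (h.le x)
        rw [sum_congr rfl fun x _ => this x, sum_add_distrib]
        simp
      have h₂ : Even (∑ x, deg G x) := by
        have := G.sum_degrees_eq_twice_card_edges
        have e : ∀ x, deg G x = G.degree x := by
          intro x
          rw [deg, ← card_neighborFinset_eq_degree, neighborFinset_eq_filter]
        rw [sum_congr rfl fun x _ => e x, this]
        exact even_two_mul _
      rw [h₁] at heven
      exact (Nat.even_add_one.1 heven) h₂
    have hrk : r < k := by
      rcases lt_trichotomy k r with h' | h' | h'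
      · have := h.full k h'; omega
      · exact absurd h' hkr
      · exact h'
    have hadj : G.Adj r k := by
      by_contra h'
      have := h₀ k hrk h'; omega
    have hku : k ≠ u := by rintro rfl; exact hru hadj
    have hki : k ≠ i := (hi.trans hrk).ne'
    set G₀ := G.deleteEdges {s(r, k)} with hG₀
    set G₁ := G₀.deleteEdges {s(i, u)} with hG₁
    set G₂ := G₁ ⊔ edge r u with hG₂
    set G₃ := G₂ ⊔ edge r i with hG₃
    have e₀ := deg_del hadj
    have e₁ := deg_del (G := G₀) (u := i) (v := u) (by simp [hG₀, hiu, hir, hki.symm])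
    have e₂ := deg_add (G := G₁) (u := r) (v := u) hur.symm (by simp [hG₁, hG₀, hru])
    have e₃ := deg_add (G := G₂) (u := r) (v := i) hir.symm
      (by simp [hG₂, hG₁, hG₀, hri, edge_adj, hur.symm, hir, hui.symm])
    rw [← hG₀] at e₀; rw [← hG₁] at e₁; rw [← hG₂] at e₂; rw [← hG₃] at e₃
    have e : ∀ x, deg G₃ x + δ(x, k) = deg G x + δ(x, r) := by
      intro x
      have := e₀ x; have := e₁ x; have := e₂ x; have := e₃ x
      omega
    refine ⟨G₃, ⟨fun x hx => ?_, fun x => ?_, fun x y hx hy => ?_⟩, ?_⟩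
    · have := e x
      rw [if_neg hx.ne, if_neg (hx.trans hrk).ne] at this
      have := h.full x hx; omega
    · have h₁ := e x
      have h₂ := h.le x
      by_cases hx : x = r
      · subst hx
        rw [if_pos rfl] at h₁; omega
      · rw [if_neg hx] at h₁; omega
    · have := h.indep x y hx hy
      simp [hG₃, hG₂, hG₁, hG₀, edge_adj, this, hx.ne', hy.ne']
    · have := e r
      rw [if_pos rfl, if_neg hkr.symm] at this
      omega

/-- If none of the local exchanges applies, the vertices up to r form a clique, every deficient
vertex behind r is joined to all of them, and every other vertex behind r has all its neighbours
among them. Counting edges then contradicts the Erdős–Gallai inequality at r. -/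
theorem Partial.improve {r : Fin n} {G : SimpleGraph (Fin n)} (h : Partial d r G)
    (hd : Antitone d) (heven : Even (∑ i, d i)) (hlt : deg G r < d r)
    (hEG : ∑ i ∈ Iic r, d i ≤ (r + 1) * r + ∑ k ∈ Ioi r, min (d k) (r + 1)) :
    ∃ G', Partial d r G' ∧ deg G r < deg G' r := by
  classical
  by_cases h₀ : ∀ k, r < k → ¬ G.Adj r k → deg G k = d k
  swap
  · push Not at h₀
    obtain ⟨k, hrk, hadj, hk⟩ := h₀
    have e := deg_add (G := G) (u := r) (v := k) hrk.ne hadj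
    have hk' : deg G k < d k := lt_of_le_of_ne (h.le k) hk
    refine ⟨G ⊔ edge r k, ⟨fun x hx => ?_, fun x => ?_, fun x y hx hy => ?_⟩, ?_⟩
    · rw [e, if_neg hx.ne, if_neg (hx.trans hrk).ne, h.full x hx]; rfl
    · rw [e]
      by_cases h₁ : x = r
      · subst h₁; rw [if_pos rfl, if_neg hrk.ne]; omega
      · by_cases h₂ : x = k
        · subst h₂; rw [if_pos rfl, if_neg h₁]; omega
        · rw [if_neg h₁, if_neg h₂]; exact h.le x
    · have := h.indep x y hx hy
      simp [edge_adj, this, hx.ne', hy.ne']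
    · rw [e, if_pos rfl, if_neg hrk.ne]; omega
  by_cases h₁ : ∀ i < r, G.Adj r i
  swap
  · push Not at h₁
    obtain ⟨i, hi, hri⟩ := h₁
    exact h.improve_of_not_adj hd heven hlt h₀ hi hri
  -- All vertices before r are adjacent to r by now, so a neighbour of i that is not adjacent to r
  -- lies behind r, where degrees need not be kept.
  have hex : ∀ i < r, ∃ u, G.Adj i u ∧ ¬ G.Adj r u ∧ r < u := by
    intro i hi
    have hdi := h.full i hi
    have hdr : d r ≤ d i := hd hi.le
    obtain ⟨u, hiu, hru, hur⟩ := exists_adj_of_deg_lt (G := G) (i := i) (r := r) (by omega)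
    refine ⟨u, hiu, hru, lt_of_not_ge fun hle => ?_⟩
    exact hru (h₁ u (lt_of_le_of_ne hle hur))
  by_cases h₂ : ∀ k, r < k → deg G k < d k → ∀ i < r, G.Adj k i
  swap
  · push Not at h₂
    obtain ⟨k, hrk, hk, i, hi, hki⟩ := h₂
    obtain ⟨u, hiu, hru, hur⟩ := hex i hi
    have hrk' : G.Adj r k := by
      by_contra h'
      have := h₀ k hrk h'; omega
    have hku : k ≠ u := by rintro rfl; exact hru hrk'
    have hik : i ≠ k := (hi.trans hrk).ne
    have hui := hiu.ne'
    set G₁ := G.deleteEdges {s(i, u)} with hG₁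
    set G₂ := G₁ ⊔ edge r u with hG₂
    set G₃ := G₂ ⊔ edge i k with hG₃
    have hik' : ¬ G.Adj i k := fun h' => hki h'.symm
    have e₁ := deg_del hiu
    have e₂ := deg_add (G := G₁) (u := r) (v := u) hur.ne (by simp [hG₁, hru])
    have e₃ := deg_add (G := G₂) (u := i) (v := k) hik
      (by simp [hG₂, hG₁, hik', edge_adj, hi.ne, hui.symm])
    rw [← hG₁] at e₁; rw [← hG₂] at e₂; rw [← hG₃] at e₃
    have e : ∀ x, deg G₃ x = deg G x + δ(x, r) + δ(x, k) := by
      intro x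
      have := e₁ x; have := e₂ x; have := e₃ x
      omega
    refine ⟨G₃, ⟨fun x hx => ?_, fun x => ?_, fun x y hx hy => ?_⟩, ?_⟩
    · rw [e, if_neg hx.ne, if_neg (hx.trans hrk).ne, h.full x hx]; rfl
    · rw [e]
      by_cases h₁ : x = r
      · subst h₁; rw [if_pos rfl, if_neg hrk.ne]; omega
      · by_cases h₂ : x = k
        · subst h₂; rw [if_pos rfl, if_neg h₁]; omega
        · rw [if_neg h₁, if_neg h₂]; exact h.le x
    · have := h.indep x y hx hy
      simp [hG₃, hG₂, hG₁, edge_adj, this, hx.ne', hy.ne', (hi.trans hx).ne', (hi.trans hy).ne']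
    · rw [e, if_pos rfl, if_neg hrk.ne]; omega
  by_cases h₃ : ∀ i < r, ∀ j < r, i ≠ j → G.Adj i j
  swap
  -- The edges iu and jw are exchanged for ij and ru. Only r gains and only w loses a degree; this
  -- stays true if u = w.
  · push Not at h₃
    obtain ⟨i, hi, j, hj, hij, hadj⟩ := h₃
    obtain ⟨u, hiu, hru, hur⟩ := hex i hi
    obtain ⟨w, hjw, hrw, hwr⟩ := hex j hj
    have hiw : i ≠ w := (hi.trans hwr).ne
    have hju : j ≠ u := (hj.trans hur).ne
    have hiu' := hiu.ne
    set G₀ := G.deleteEdges {s(i, u)} with hG₀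
    set G₁ := G₀.deleteEdges {s(j, w)} with hG₁
    set G₂ := G₁ ⊔ edge r u with hG₂
    set G₃ := G₂ ⊔ edge i j with hG₃
    have e₀ := deg_del hiu
    have e₁ := deg_del (G := G₀) (u := j) (v := w) (by simp [hG₀, hjw, hij.symm, hju])
    have e₂ := deg_add (G := G₁) (u := r) (v := u) hur.ne (by simp [hG₁, hG₀, hru])
    have e₃ := deg_add (G := G₂) (u := i) (v := j) hij
      (by simp [hG₂, hG₁, hG₀, hadj, edge_adj, hi.ne, hiu'])
    rw [← hG₀] at e₀; rw [← hG₁] at e₁; rw [← hG₂] at e₂; rw [← hG₃] at e₃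
    have e : ∀ x, deg G₃ x + δ(x, w) = deg G x + δ(x, r) := by
      intro x
      have := e₀ x; have := e₁ x; have := e₂ x; have := e₃ x
      omega
    refine ⟨G₃, ⟨fun x hx => ?_, fun x => ?_, fun x y hx hy => ?_⟩, ?_⟩
    · have := e x
      rw [if_neg hx.ne, if_neg (hx.trans hwr).ne] at this
      have := h.full x hx; omega
    · have h₁ := e x
      have h₂ := h.le x
      by_cases hx : x = r
      · subst hx
        rw [if_pos rfl] at h₁; omega
      · rw [if_neg hx] at h₁; omega
    · have := h.indep x y hx hy
      simp [hG₃, hG₂, hG₁, hG₀, edge_adj, this, hx.ne', hy.ne', (hi.trans hx).ne', (hi.trans hy).ne']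
    · have := e r
      rw [if_pos rfl, if_neg hwr.ne] at this
      omega
  -- No exchange is left; from here on the edges at the vertices up to r are counted.
  exfalso
  have hclique : ∀ i ≤ r, ∀ j ≤ r, i ≠ j → G.Adj i j := by
    intro i hi j hj hij
    rcases hi.lt_or_eq with hi | rfl
    · rcases hj.lt_or_eq with hj | rfl
      · exact h₃ i hi j hj hij
      · exact (h₁ i hi).symm
    · exact h₁ j (lt_of_le_of_ne hj hij.symm)
  have hsplit : (univ : Finset (Fin n)) = Iic r ∪ Ioi r := by
    ext x; simp [le_or_gt]
  have hdisj : Disjoint (Iic r) (Ioi r) := by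
    rw [Finset.disjoint_left]; intro x; simp
  set a : Fin n → Fin n → ℕ := fun i j => if G.Adj i j then 1 else 0 with ha
  have hdeg : ∀ i, deg G i = ∑ j ∈ Iic r, a i j + ∑ j ∈ Ioi r, a i j := by
    intro i
    rw [deg_eq_sum, hsplit, sum_union hdisj]
  have hcard : #(Iic r) = r + 1 := by simp
  have hin : ∀ i ∈ Iic r, ∑ j ∈ Iic r, a i j = r := by
    intro i hi
    rw [← add_sum_erase _ _ hi, ha]
    simp only [SimpleGraph.irrefl, if_false, zero_add]
    rw [sum_congr rfl fun j hj => if_pos (hclique i (by simpa using hi) j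
      (by simpa using mem_of_mem_erase hj) (ne_of_mem_erase hj).symm)]
    rw [sum_const, card_erase_of_mem hi, hcard]; simp
  have hout : ∀ k ∈ Ioi r, min (d k) (r + 1) ≤ ∑ i ∈ Iic r, a i k := by
    intro k hk
    have hk : r < k := by simpa using hk
    by_cases hlt : deg G k < d k
    · have : ∀ i ∈ Iic r, a i k = 1 := by
        intro i hi
        rcases (show i ≤ r by simpa using hi).lt_or_eq with hi | rfl
        · exact if_pos (h₂ k hk hlt i hi).symm
        · refine if_pos ?_
          by_contra h'
          have := h₀ k hk h'; omega
      rw [sum_congr rfl this, sum_const, hcard]; simp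
    · have h₁ := hdeg k
      rw [sum_eq_zero (s := Ioi r) fun j hj => if_neg (h.indep k j hk (by simpa using hj))] at h₁
      have h₂ : ∑ i ∈ Iic r, a i k = ∑ i ∈ Iic r, a k i :=
        sum_congr rfl fun i _ => by simp only [ha, G.adj_comm]
      have := h.le k
      rw [h₂, min_le_iff]; left; omega
  have hsum : ∑ i ∈ Iic r, d i ≤ ∑ i ∈ Iic r, deg G i := by
    rw [sum_congr rfl fun i _ => hdeg i, sum_add_distrib, sum_congr rfl hin, sum_const, hcard,
      sum_comm, smul_eq_mul]
    exact hEG.trans (Nat.add_le_add_left (sum_le_sum hout) _)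
  exact absurd hsum (not_le.2 (sum_lt_sum (fun i _ => h.le i) ⟨r, by simp, hlt⟩))

/-- **Erdős–Gallai theorem**, sufficiency. -/
theorem exists_graph (hd : Antitone d) (heven : Even (∑ i, d i))
    (hEG : ∀ r : Fin n, ∑ i ∈ Iic r, d i ≤ (r + 1) * r + ∑ k ∈ Ioi r, min (d k) (r + 1)) :
    ∃ G : SimpleGraph (Fin n), ∀ i, deg G i = d i := by
  have key : ∀ m ≤ n, ∃ G : SimpleGraph (Fin n), (∀ i : Fin n, (i : ℕ) < m → deg G i = d i) ∧
      (∀ i, deg G i ≤ d i) ∧ ∀ i j : Fin n, m ≤ (i : ℕ) → m ≤ (j : ℕ) → ¬ G.Adj i j := by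
    intro m
    induction m with
    | zero => exact fun _ => ⟨⊥, by simp, by simp [deg], by simp⟩
    | succ m ih =>
      intro hm
      obtain ⟨G, h₁, h₂, h₃⟩ := ih (by omega)
      set r : Fin n := ⟨m, hm⟩ with hr
      have hP : Partial d r G := ⟨fun i hi => h₁ i hi, h₂, fun i j hi hj =>
        h₃ i j (le_of_lt hi) (le_of_lt hj)⟩
      -- Induction on the number of units that are missing at r.
      have : ∀ g (G : SimpleGraph (Fin n)), Partial d r G → d r - deg G r = g →
          ∃ G', Partial d r G' ∧ deg G' r = d r := by
        intro g
        induction g using Nat.strong_induction_on with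
        | _ g ih =>
          intro G hG hg
          rcases (hG.le r).lt_or_eq with hlt | heq
          · obtain ⟨G', hG', hlt'⟩ := hG.improve hd heven hlt (hEG r)
            exact ih _ (by have := hG'.le r; omega) G' hG' rfl
          · exact ⟨G, hG, heq⟩
      obtain ⟨G', hG', he⟩ := this _ G hP rfl
      refine ⟨G', fun i hi => ?_, hG'.le, fun i j hi hj => hG'.indep i j hi hj⟩
      rcases Nat.lt_succ_iff_lt_or_eq.1 hi with hi | hi
      · exact hG'.full i hi
      · rw [show i = r from Fin.ext hi, he]
  obtain ⟨G, hG, _⟩ := key n le_rfl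
  exact ⟨G, fun i => hG i i.2⟩

/-- **Erdős–Gallai theorem**, necessity. -/
theorem sum_deg_le (G : SimpleGraph (Fin n)) (k : ℕ) :
    ∑ i : Fin n with i.val < k, deg G i ≤
      k * (k - 1) + ∑ j : Fin n with k ≤ j.val, min (deg G j) k := by
  classical
  set a : Fin n → Fin n → ℕ := fun i j => if G.Adj i j then 1 else 0 with ha
  set L : Finset (Fin n) := {i | (i : ℕ) < k} with hL
  set R : Finset (Fin n) := {i | k ≤ (i : ℕ)} with hR
  have hcard : #L ≤ k := by
    have h := card_le_card_of_injOn (s := L) (t := range k) (fun i => (i : ℕ))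
      (by intro x hx; simpa [hL] using hx) (fun x _ y _ h => Fin.ext h)
    simpa using h
  have hdeg : ∀ i, deg G i = ∑ j ∈ L, a i j + ∑ j ∈ R, a i j := by
    intro i
    rw [deg_eq_sum, ← sum_filter_add_sum_filter_not univ (fun j : Fin n => (j : ℕ) < k)]
    simp only [not_lt, ha, hL, hR]
  have hin : ∀ i ∈ L, ∑ j ∈ L, a i j ≤ k - 1 := by
    intro i hi
    rw [← add_sum_erase _ _ hi, ha]
    simp only [SimpleGraph.irrefl, if_false, zero_add]
    refine (sum_le_card_nsmul _ _ 1 fun j _ => by split_ifs <;> simp).trans ?_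
    rw [card_erase_of_mem hi]; simp; omega
  have hout : ∀ j ∈ R, ∑ i ∈ L, a i j ≤ min (deg G j) k := by
    intro j hj
    rw [le_min_iff]
    constructor
    · rw [hdeg j]
      refine le_trans (le_of_eq ?_) (Nat.le_add_right _ _)
      exact sum_congr rfl fun i _ => by simp only [ha, G.adj_comm]
    · refine (sum_le_card_nsmul _ _ 1 fun i _ => by simp only [ha]; split_ifs <;> simp).trans ?_
      simpa using hcard
  rw [sum_congr rfl fun i _ => hdeg i, sum_add_distrib, sum_comm (s := L) (t := R)]
  refine add_le_add ((sum_le_card_nsmul _ _ _ hin).trans ?_) (sum_le_sum hout)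
  rw [smul_eq_mul]
  exact Nat.mul_le_mul_right _ hcard

end ErdosGallai

/-! ### Counting copies of stars by binomial coefficients of degrees. -/

namespace StarSubRec

open Finset SimpleGraph ErdosGallai

/-- Let c be the vertex of degree greater than 1, or any vertex if there is none. If v ≠ c were not
adjacent to c, a walk from v to c would leave the closed neighbourhood of v at a neighbour w of v.
Then w has two neighbours, so w = c, which makes v adjacent to c. -/
theorem IsStar.exists_center {V : Type} [Finite V] {F : SimpleGraph V} (h : IsStar F) :
    ∃ c, ∀ a b, F.Adj a b ↔ (a = c ∧ b ≠ c) ∨ (b = c ∧ a ≠ c) := by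
  obtain ⟨hc, hs⟩ := h
  have hdeg : ∀ x y z, F.Adj x y → F.Adj x z → y ≠ z → x ∈ {v : V | 1 < (F.neighborSet v).ncard} :=
    fun x y z hy hz hyz => (Set.one_lt_ncard_iff (Set.toFinite _)).2 ⟨y, z, hy, hz, hyz⟩
  obtain ⟨c, hcs⟩ : ∃ c, ∀ v ∈ {v : V | 1 < (F.neighborSet v).ncard}, v = c := by
    by_cases hex : ∃ c, c ∈ {v : V | 1 < (F.neighborSet v).ncard}
    · obtain ⟨c, hc'⟩ := hex
      exact ⟨c, fun v hv => hs hv hc'⟩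
    · obtain ⟨c⟩ := hc.nonempty
      exact ⟨c, fun v hv => absurd ⟨v, hv⟩ hex⟩
  have hadj : ∀ v, v ≠ c → F.Adj v c := by
    intro v hv
    by_contra hvc
    obtain ⟨p⟩ := hc.preconnected v c
    obtain ⟨e, -, he₁, he₂⟩ := p.exists_boundary_dart ({v} ∪ F.neighborSet v) (by simp)
      (by simp [hv.symm, hvc])
    simp only [Set.singleton_union, Set.mem_insert_iff, mem_neighborSet, not_or] at he₁ he₂
    rcases he₁ with he₁ | he₁
    · exact he₂.2 (he₁ ▸ e.adj)
    · exact hvc (hcs _ (hdeg e.fst v e.snd he₁.symm e.adj (Ne.symm he₂.1)) ▸ he₁)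
  refine ⟨c, fun a b => ⟨fun hab => ?_, ?_⟩⟩
  · by_cases ha : a = c
    · exact .inl ⟨ha, fun hb => hab.ne (ha.trans hb.symm)⟩
    · by_cases hb : b = c
      · exact .inr ⟨hb, ha⟩
      · exact absurd (hcs a (hdeg a b c hab (hadj a ha) hb)) ha
  · rintro (⟨rfl, hb⟩ | ⟨rfl, ha⟩)
    · exact (hadj b hb).symm
    · exact hadj a ha

section Count

variable {V : Type} {G : SimpleGraph V}

/-- The subgraph of `G` that consists of the edges from `v` to `S`. -/
def starSubgraph [DecidableEq V] (G : SimpleGraph V) (v : V) (S : Finset V) : G.Subgraph where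
  verts := ↑(insert v S)
  Adj a b := G.Adj a b ∧ ((a = v ∧ b ∈ S) ∨ (b = v ∧ a ∈ S))
  adj_sub h := h.1
  edge_vert := by
    rintro a b ⟨_, ⟨rfl, _⟩ | ⟨_, h⟩⟩
    · simp
    · simp [h]
  symm := ⟨by
    rintro a b ⟨h, h'⟩
    exact ⟨h.symm, h'.symm⟩⟩

variable {n : ℕ} {F : SimpleGraph (Fin n)} {c : Fin n}

theorem starSubgraph_iso [DecidableEq V]
    (hF : ∀ a b, F.Adj a b ↔ (a = c ∧ b ≠ c) ∨ (b = c ∧ a ≠ c)) {v : V} {S : Finset V}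
    (hS : ∀ x ∈ S, G.Adj v x) (hn : #S + 1 = n) :
    Nonempty (F ≃g (starSubgraph G v S).coe) := by
  have hv : v ∉ S := fun h => (hS v h).ne rfl
  have hcard : Fintype.card (Fin n) = Fintype.card (insert v S : Finset V) := by
    rw [Fintype.card_fin, Fintype.card_coe, card_insert_of_notMem hv, hn]
  set e₀ : Fin n ≃ (insert v S : Finset V) := Fintype.equivOfCardEq hcard
  -- An arbitrary bijection, corrected by a transposition so that the centre goes to v.
  set e := e₀.trans (Equiv.swap (e₀ c) ⟨v, mem_insert_self v S⟩) with he
  have hc : (e c : V) = v := by simp [he]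
  have heq : ∀ a, (e a : V) = v ↔ a = c := fun a =>
    ⟨fun h => e.injective (Subtype.ext (h.trans hc.symm)), fun h => h ▸ hc⟩
  have hmem : ∀ a, (e a : V) ∈ S ↔ a ≠ c := by
    intro a
    have h₂ := mem_insert.1 (e a).2
    constructor
    · rintro h rfl
      exact hv (hc ▸ h)
    · exact fun h => h₂.resolve_left fun h' => h ((heq a).1 h')
  refine ⟨⟨e, @fun a b => ?_⟩⟩
  change (G.Adj (e a) (e b) ∧ (((e a : V) = v ∧ (e b : V) ∈ S) ∨ ((e b : V) = v ∧ (e a : V) ∈ S))) ↔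
    F.Adj a b
  rw [hF, heq, heq, hmem, hmem, and_iff_right_iff_imp]
  rintro (⟨ha, hb⟩ | ⟨hb, ha⟩)
  · rw [(heq a).2 ha]; exact hS _ ((hmem b).2 hb)
  · rw [(heq b).2 hb]; exact (hS _ ((hmem a).2 ha)).symm

theorem exists_eq_starSubgraph [Fintype V] [DecidableEq V]
    (hF : ∀ a b, F.Adj a b ↔ (a = c ∧ b ≠ c) ∨ (b = c ∧ a ≠ c)) {G' : G.Subgraph}
    (e : F ≃g G'.coe) :
    ∃ v S, (∀ x ∈ S, G.Adj v x) ∧ #S + 1 = n ∧ starSubgraph G v S = G' := by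
  classical
  set v : V := (e c : V) with hv
  have hvm : v ∈ G'.verts := (e c).2
  set S : Finset V := G'.verts.toFinset.erase v with hS
  have hG' : ∀ a b : G'.verts, G'.Adj a b ↔ ((a : V) = v ∧ (b : V) ≠ v) ∨ ((b : V) = v ∧ (a : V) ≠ v) := by
    intro a b
    have h := e.symm.map_rel_iff (a := a) (b := b)
    rw [Subgraph.coe_adj] at h
    rw [← h]
    have h' : ∀ x : G'.verts, (x : V) = v ↔ e.symm x = c := fun x => by
      rw [hv, ← Subtype.ext_iff]
      constructor
      · rintro rfl; simp
      · intro h; rw [← h]; simp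
    exact (hF _ _).trans (by simp only [ne_eq, h'])
  have hadj : ∀ x ∈ S, G'.Adj v x := by
    intro x hx
    simp only [hS, mem_erase, Set.mem_toFinset] at hx
    exact (hG' ⟨v, hvm⟩ ⟨x, hx.2⟩).2 (.inl ⟨rfl, hx.1⟩)
  refine ⟨v, S, fun x hx => (hadj x hx).adj_sub, ?_, ?_⟩
  · have h₁ : Fintype.card G'.verts = n := by
      rw [← Fintype.card_congr e.toEquiv, Fintype.card_fin]
    have hvm' : v ∈ G'.verts.toFinset := by simpa using hvm
    rw [hS, card_erase_add_one hvm', Set.toFinset_card, h₁]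
  · ext a b
    · simp only [starSubgraph, hS, coe_insert, coe_erase, Set.coe_toFinset, Set.insert_sdiff_singleton,
        Set.insert_eq_of_mem hvm]
    · change (G.Adj a b ∧ ((a = v ∧ b ∈ S) ∨ (b = v ∧ a ∈ S))) ↔ G'.Adj a b
      constructor
      · rintro ⟨_, ⟨rfl, h⟩ | ⟨rfl, h⟩⟩
        · exact hadj b h
        · exact (hadj a h).symm
      · intro h
        refine ⟨h.adj_sub, ?_⟩
        have ha := h.fst_mem
        have hb := h.snd_mem
        have := (hG' ⟨a, ha⟩ ⟨b, hb⟩).1 h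
        simpa only [hS, mem_erase, Set.mem_toFinset, ha, hb, and_true] using this

/-- If the two centres differ, w is a leaf of the star at v. As the number of leaves is not 1, there
is another leaf x, and the edge vx avoids w, which is impossible in a star centred at w. -/
theorem starSubgraph_eq_iff [DecidableEq V] {v w : V} {S T : Finset V} (hS : ∀ x ∈ S, G.Adj v x)
    (hT : ∀ x ∈ T, G.Adj w x) (hne : #S ≠ 1) :
    starSubgraph G w T = starSubgraph G v S ↔ w = v ∧ T = S := by
  constructor
  swap
  · rintro ⟨rfl, rfl⟩; rfl
  intro h
  have hv : v ∉ S := fun h => (hS v h).ne rfl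
  have hw : w ∉ T := fun h => (hT w h).ne rfl
  have hverts : insert w T = insert v S := by
    have := congrArg Subgraph.verts h
    exact Finset.coe_injective this
  have hwv : w = v := by
    by_contra hwv
    have hwS : w ∈ S := (mem_insert.1 (hverts ▸ mem_insert_self w T)).resolve_left hwv
    obtain ⟨x, hx, hxw⟩ : ∃ x ∈ S, x ≠ w := by
      by_contra! hc
      exact hne (card_eq_one.2 ⟨w, eq_singleton_iff_unique_mem.2 ⟨hwS, hc⟩⟩)
    have hadj : (starSubgraph G w T).Adj v x := h ▸ ⟨hS x hx, .inl ⟨rfl, hx⟩⟩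
    rcases hadj.2 with h' | h'
    · exact hwv h'.1.symm
    · exact hxw h'.1
  subst hwv
  refine ⟨rfl, ?_⟩
  rw [← erase_insert hw, hverts, erase_insert hv]

theorem starSubgraph_singleton_eq_iff [DecidableEq V] {v w x : V} {T : Finset V} (hx : G.Adj v x)
    (hT : ∀ x ∈ T, G.Adj w x) :
    starSubgraph G w T = starSubgraph G v {x} ↔ (w = v ∧ T = {x}) ∨ (w = x ∧ T = {v}) := by
  have hw : w ∉ T := fun h => (hT w h).ne rfl
  have hvx := hx.ne
  constructor
  · intro h
    have hverts : insert w T = insert v {x} := by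
      have := congrArg Subgraph.verts h
      exact Finset.coe_injective this
    have hwm : w = v ∨ w = x := by
      have := hverts ▸ mem_insert_self w T
      simpa using this
    rcases hwm with rfl | rfl
    · left
      refine ⟨rfl, ?_⟩
      rw [← erase_insert hw, hverts, erase_insert (by simpa using hvx)]
    · right
      refine ⟨rfl, ?_⟩
      rw [← erase_insert hw, hverts, pair_comm, erase_insert (by simpa using hvx.symm)]
  · rintro (⟨rfl, rfl⟩ | ⟨rfl, rfl⟩)
    · rfl
    · ext a b
      · simp [starSubgraph, or_comm]
      · simp only [starSubgraph, mem_singleton]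
        tauto

open scoped Classical in
/-- The number of copies of a star is the sum of binomial coefficients of the degrees, except that
every copy of the single edge is counted twice. -/
theorem mul_copyCount [Fintype V] (hF : IsStar F) :
    (if n = 2 then 2 else 1) * G.copyCount F = ∑ v, (deg G v).choose (n - 1) := by
  obtain ⟨c, hc⟩ := hF.exists_center
  have hn : 0 < n := c.pos
  set P : Finset (Σ _ : V, Finset V) :=
    univ.sigma fun v => powersetCard (n - 1) {w | G.Adj v w} with hP
  have hmem : ∀ p : Σ _ : V, Finset V, p ∈ P ↔ (∀ x ∈ p.2, G.Adj p.1 x) ∧ #p.2 + 1 = n := by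
    rintro ⟨v, S⟩
    simp only [hP, mem_sigma, mem_univ, true_and, mem_powersetCard]
    refine and_congr ?_ (by omega)
    simp [subset_iff]
  have hPcard : #P = ∑ v, (deg G v).choose (n - 1) := by
    rw [hP, card_sigma]
    exact sum_congr rfl fun v _ => by rw [card_powersetCard, deg]
  set T : Finset G.Subgraph := {G' : G.Subgraph | Nonempty (F ≃g G'.coe)} with hT
  have hTcard : G.copyCount F = #T := by
    rw [copyCount]
  have hmaps : Set.MapsTo (fun p : Σ _ : V, Finset V => starSubgraph G p.1 p.2) P T := by
    intro p hp
    obtain ⟨h₁, h₂⟩ := (hmem p).1 hp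
    simpa [hT] using starSubgraph_iso hc h₁ h₂
  -- Pairs of a centre and a leaf set are grouped by the copy that they span. The fibres are
  -- singletons, except that an edge can be centred at either end.
  rw [← hPcard, card_eq_sum_card_fiberwise hmaps, hTcard, mul_comm, ← smul_eq_mul]
  refine (sum_const_nat fun G' hG' => ?_).symm
  obtain ⟨e⟩ : Nonempty (F ≃g G'.coe) := by simpa [hT] using hG'
  obtain ⟨v, S, hS, hcard, rfl⟩ := exists_eq_starSubgraph hc e
  by_cases h2 : n = 2
  · rw [if_pos h2]
    obtain ⟨x, rfl⟩ := card_eq_one.1 (show #S = 1 by omega)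
    have hvx : G.Adj v x := hS x (by simp)
    have : ({p ∈ P | starSubgraph G p.1 p.2 = starSubgraph G v {x}} : Finset _) =
        {⟨v, {x}⟩, ⟨x, {v}⟩} := by
      ext ⟨w, U⟩
      simp only [mem_filter, hmem, mem_insert, mem_singleton, Sigma.mk.injEq, heq_eq_eq]
      constructor
      · rintro ⟨⟨h₁, h₂⟩, h₃⟩
        exact (starSubgraph_singleton_eq_iff hvx h₁).1 h₃
      · intro h
        have h₁ : (∀ y ∈ U, G.Adj w y) ∧ #U + 1 = n := by
          rcases h with ⟨rfl, rfl⟩ | ⟨rfl, rfl⟩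
          · exact ⟨hS, hcard⟩
          · exact ⟨by simpa using hvx.symm, by simp [h2]⟩
        exact ⟨h₁, (starSubgraph_singleton_eq_iff hvx h₁.1).2 h⟩
    rw [this, card_pair]
    intro h
    exact hvx.ne (congrArg Sigma.fst h)
  · rw [if_neg h2]
    have : ({p ∈ P | starSubgraph G p.1 p.2 = starSubgraph G v S} : Finset _) = {⟨v, S⟩} := by
      ext ⟨w, U⟩
      simp only [mem_filter, hmem, mem_singleton, Sigma.mk.injEq, heq_eq_eq]
      constructor
      · rintro ⟨⟨h₁, h₂⟩, h₃⟩
        exact (starSubgraph_eq_iff hS h₁ (by omega)).1 h₃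
      · rintro ⟨rfl, rfl⟩
        exact ⟨⟨hS, hcard⟩, rfl⟩
    rw [this, card_singleton]

end Count

/-- Two stars of the same order are isomorphic. -/
theorem IsStar.nonempty_iso {n : ℕ} {F F' : SimpleGraph (Fin n)} (h : IsStar F) (h' : IsStar F') :
    Nonempty (F ≃g F') := by
  obtain ⟨c, hc⟩ := h.exists_center
  obtain ⟨c', hc'⟩ := h'.exists_center
  refine ⟨⟨Equiv.swap c c', @fun a b => ?_⟩⟩
  have e : ∀ x, Equiv.swap c c' x = c' ↔ x = c := fun x =>
    ⟨fun h => (Equiv.swap c c').injective (h.trans (Equiv.swap_apply_left c c').symm),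
      fun h => h ▸ Equiv.swap_apply_left c c'⟩
  rw [hc, hc']
  simp only [ne_eq, e]

end StarSubRec

/-! ### Dynamic programming over graphic degree sequences. -/

namespace ErdosGallai

open Finset

theorem sum_fin_filter {n : ℕ} (p : ℕ → Prop) [DecidablePred p] (f : ℕ → ℕ) :
    ∑ i : Fin n with p i.val, f i = ∑ i ∈ range n with p i, f i := by
  rw [sum_filter, sum_filter, Fin.sum_univ_eq_sum_range (fun i => if p i then f i else 0)]

/-- The sufficiency part of the Erdős–Gallai theorem, with sums over natural numbers. -/
theorem exists_graph_of_nat {n : ℕ} {f : ℕ → ℕ} (hf : ∀ i j, i ≤ j → j < n → f j ≤ f i)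
    (heven : Even (∑ i ∈ range n, f i))
    (hEG : ∀ k, 1 ≤ k → k ≤ n →
      ∑ i ∈ range k, f i ≤ k * (k - 1) + ∑ j ∈ Ico k n, min (f j) k) :
    ∃ G : SimpleGraph (Fin n), ∀ i, deg G i = f i := by
  refine exists_graph (d := fun i => f i) (fun i j hij => hf i j hij j.2) ?_ fun r => ?_
  · rwa [Fin.sum_univ_eq_sum_range]
  · have h := hEG (r + 1) (by omega) r.2
    have h₁ : ∑ i ∈ Iic r, f i = ∑ i ∈ range (r + 1), f i := by
      have : Iic r = ({i : Fin n | i.val ≤ r.val} : Finset _) := by ext; simp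
      rw [this, sum_fin_filter (fun i => i ≤ r.val)]
      refine sum_congr ?_ fun _ _ => rfl
      ext; simp; omega
    have h₂ : ∑ i ∈ Ioi r, min (f i) (r + 1) = ∑ i ∈ Ico (r.val + 1) n, min (f i) (r + 1) := by
      have : Ioi r = ({i : Fin n | r.val < i.val} : Finset _) := by ext; simp
      rw [this, sum_fin_filter (fun i => r.val < i) fun i => min (f i) (r + 1)]
      refine sum_congr ?_ fun _ _ => rfl
      ext; simp; omega
    rw [h₁, h₂]
    simpa using h

/-- The necessity part of the Erdős–Gallai theorem, with sums over natural numbers. -/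
theorem sum_deg_le_of_nat {n : ℕ} (G : SimpleGraph (Fin n)) {f : ℕ → ℕ} (hf : ∀ i, deg G i = f i)
    {k : ℕ} (hk : k ≤ n) :
    ∑ i ∈ range k, f i ≤ k * (k - 1) + ∑ j ∈ Ico k n, min (f j) k := by
  have h := sum_deg_le G k
  simp only [hf] at h
  rw [sum_fin_filter (fun i => i < k), sum_fin_filter (fun i => k ≤ i) fun i => min (f i) k] at h
  have h₁ : ({i ∈ range n | i < k} : Finset ℕ) = range k := by ext; simp; omega
  have h₂ : ({i ∈ range n | k ≤ i} : Finset ℕ) = Ico k n := by ext; simp; omega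
  rwa [h₁, h₂] at h

/-- Double counting of the pairs (j, t) with t < min (g j) k. This turns the right-hand side of an
Erdős–Gallai inequality into a sum of the tail counts that the search guesses. -/
theorem sum_min_eq (J : Finset ℕ) (g : ℕ → ℕ) (k : ℕ) :
    ∑ j ∈ J, min (g j) k = ∑ t ∈ range k, #{j ∈ J | t + 1 ≤ g j} := by
  have : ∀ j, min (g j) k = ∑ t ∈ range k, if t + 1 ≤ g j then 1 else 0 := by
    intro j
    rw [← sum_filter, sum_const, smul_eq_mul, mul_one]
    have : ({t ∈ range k | t + 1 ≤ g j} : Finset ℕ) = range (min (g j) k) := by ext; simp; omega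
    rw [this, card_range]
  simp only [this]
  rw [sum_comm]
  exact sum_congr rfl fun t _ => by rw [card_filter]

/-- The number of j with g j = i is the difference of two consecutive tail counts; the search knows
only these counts. -/
theorem sum_comp_eq (J : Finset ℕ) (g P : ℕ → ℕ) {h : ℕ} (hg : ∀ j ∈ J, g j ≤ h) :
    ∑ j ∈ J, P (g j) =
      ∑ i ∈ range h, (#{j ∈ J | i ≤ g j} - #{j ∈ J | i + 1 ≤ g j}) * P i +
        #{j ∈ J | h ≤ g j} * P h := by
  have h₁ : ∑ j ∈ J, P (g j) = ∑ i ∈ range (h + 1), #{j ∈ J | g j = i} * P i := by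
    rw [← sum_fiberwise_of_maps_to (g := g) (t := range (h + 1))
      fun j hj => mem_range.2 (Nat.lt_succ_of_le (hg j hj))]
    refine sum_congr rfl fun i _ => ?_
    rw [sum_congr rfl (g := fun _ => P i) fun j hj => by rw [(mem_filter.1 hj).2], sum_const,
      smul_eq_mul]
  rw [h₁, sum_range_succ]
  congr 1
  · refine sum_congr rfl fun i _ => ?_
    congr 1
    rw [← card_sdiff_of_subset]
    · congr 1
      ext j; by_cases hj : j ∈ J <;> simp [hj]; omega
    · intro j
      simp only [mem_filter]
      exact fun hj => ⟨hj.1, (Nat.le_succ i).trans hj.2⟩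
  · congr 2
    ext j
    simp only [mem_filter]
    exact and_congr_right fun hj => ⟨fun h => h.ge, fun h => (hg j hj).antisymm h⟩

/-- The search for a degree sequence by dynamic programming, for a fixed number `h` of vertices of
degree at least `h`. After `i` steps, `d` is the `i`-th largest degree, `e` the number of other
vertices of degree at least `i`, `s` the slack in the `i`-th Erdős–Gallai inequality, and `X` the
weight of the vertices that are dealt with. -/
def Reach (P : ℕ → ℕ) (N D h : ℕ) : ℕ → ℕ → ℕ → ℕ → ℕ → Prop
  | 0, d, e, s, X => d = D ∧ h + e ≤ N ∧ s = 0 ∧ X = 0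
  | i + 1, d, e, s, X => i < h ∧ h ≤ d ∧ ∃ d₀ e₀ s₀ X₀, Reach P N D h i d₀ e₀ s₀ X₀ ∧
      d ≤ d₀ ∧ e ≤ e₀ ∧ s + d + 1 = s₀ + h + e ∧ X = X₀ + P d + (e₀ - e) * P i

theorem reach_of_seq {P : ℕ → ℕ} {N D h : ℕ} {dd ee ss XX : ℕ → ℕ} (hD : dd 0 = D)
    (hN : h + ee 0 ≤ N) (hs : ss 0 = 0) (hX : XX 0 = 0)
    (step : ∀ i < h, h ≤ dd (i + 1) ∧ dd (i + 1) ≤ dd i ∧ ee (i + 1) ≤ ee i ∧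
      ss (i + 1) + dd (i + 1) + 1 = ss i + h + ee (i + 1) ∧
      XX (i + 1) = XX i + P (dd (i + 1)) + (ee i - ee (i + 1)) * P i) :
    ∀ i ≤ h, Reach P N D h i (dd i) (ee i) (ss i) (XX i)
  | 0, _ => ⟨hD, hN, hs, hX⟩
  | i + 1, hi => by
    obtain ⟨h₁, h₂, h₃, h₄, h₅⟩ := step i hi
    exact ⟨hi, h₁, _, _, _, _, reach_of_seq hD hN hs hX step i (by omega), h₂, h₃, h₄, h₅⟩

theorem Reach.exists_seq {P : ℕ → ℕ} {N D h : ℕ} : ∀ {i d e s X : ℕ}, Reach P N D h i d e s X →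
    ∃ dd ee ss XX : ℕ → ℕ, dd i = d ∧ ee i = e ∧ ss i = s ∧ XX i = X ∧
      dd 0 = D ∧ h + ee 0 ≤ N ∧ ss 0 = 0 ∧ XX 0 = 0 ∧
      ∀ j < i, h ≤ dd (j + 1) ∧ dd (j + 1) ≤ dd j ∧ ee (j + 1) ≤ ee j ∧
        ss (j + 1) + dd (j + 1) + 1 = ss j + h + ee (j + 1) ∧
        XX (j + 1) = XX j + P (dd (j + 1)) + (ee j - ee (j + 1)) * P j
  | 0, d, e, s, X, ⟨h₁, h₂, h₃, h₄⟩ =>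
    ⟨fun _ => d, fun _ => e, fun _ => s, fun _ => X, rfl, rfl, rfl, rfl, h₁, h₂, h₃, h₄,
      fun j hj => absurd hj (by omega)⟩
  | i + 1, d, e, s, X, ⟨_, h₂, _, _, _, _, h₃, h₄, h₅, h₆, h₇⟩ => by
    obtain ⟨dd, ee, ss, XX, rfl, rfl, rfl, rfl, hD, hN, hs, hX, step⟩ := h₃.exists_seq
    refine ⟨Function.update dd (i + 1) d, Function.update ee (i + 1) e,
      Function.update ss (i + 1) s, Function.update XX (i + 1) X, by simp, by simp, by simp,
      by simp, by simpa using hD, by simpa using hN, by simpa using hs, by simpa using hX, ?_⟩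
    intro j hj
    rcases Nat.lt_succ_iff_lt_or_eq.1 hj with hj | rfl
    · have h₁ : j + 1 ≠ i + 1 := by omega
      have h₂ : j ≠ i + 1 := by omega
      simpa only [Function.update_of_ne h₁, Function.update_of_ne h₂] using step j hj
    · have h₁ : j ≠ j + 1 := by omega
      simp only [Function.update_self, Function.update_of_ne h₁]
      exact ⟨h₂, h₄, h₅, h₆, h₇⟩

/-- The slack grows by less than h + e ≤ N in each step. With E the initial value of e, after i
steps i top vertices and E - e low vertices have been dealt with, each of weight at most Q; this is
the invariant for X. -/
theorem Reach.bounds {P : ℕ → ℕ} {N D h Q : ℕ} (hP : ∀ n, P n ≤ Q) :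
    ∀ {i d e s X : ℕ}, Reach P N D h i d e s X →
      d ≤ D ∧ i ≤ h ∧ h + e ≤ N ∧ s ≤ i * N ∧ ∃ E, h + E ≤ N ∧ X + e * Q ≤ (i + E) * Q
  | 0, d, e, s, X, ⟨h₁, h₂, h₃, h₄⟩ =>
    ⟨h₁.le, h.zero_le, h₂, by omega, e, h₂, by rw [h₄, zero_add, zero_add]⟩
  | i + 1, d, e, s, X, ⟨h₁, h₂, d₀, e₀, s₀, X₀, h₃, h₄, h₅, h₆, h₇⟩ => by
    obtain ⟨k₁, k₂, k₃, k₄, E, k₅, k₆⟩ := h₃.bounds hP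
    refine ⟨h₄.trans k₁, h₁, by omega, by rw [add_one_mul]; omega, E, k₅, ?_⟩
    obtain ⟨c, rfl⟩ := Nat.exists_eq_add_of_le h₅
    rw [h₇, Nat.add_sub_cancel_left]
    have := hP d
    have := Nat.mul_le_mul_left c (hP i)
    nlinarith

/-- A sequence of steps describes a sequence of degrees, which are those of a graph as soon as
their sum is even. -/
theorem Reach.exists_degrees {P : ℕ → ℕ} {N D h d e s X : ℕ} (H : Reach P N D h h d e s X) :
    ∃ n ≤ N, ∃ f : ℕ → ℕ, (∀ i < n, f i ≤ max D h) ∧ ∑ i ∈ range n, P (f i) = X + e * P h ∧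
      (Even (∑ i ∈ range n, f i) → ∃ G : SimpleGraph (Fin n), ∀ i, deg G i = f i) := by
  obtain ⟨dd, ee, ss, XX, rfl, rfl, rfl, rfl, hD, hN, hs, hX, step⟩ := H.exists_seq
  have hdd : ∀ i j, i ≤ j → j ≤ h → dd j ≤ dd i := by
    intro i j hij
    induction j, hij using Nat.le_induction with
    | base => exact fun _ => le_rfl
    | succ j hj ih => exact fun hj' => (step j hj').2.1.trans (ih (by omega))
  have hee : ∀ i j, i ≤ j → j ≤ h → ee j ≤ ee i := by
    intro i j hij
    induction j, hij using Nat.le_induction with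
    | base => exact fun _ => le_rfl
    | succ j hj ih => exact fun hj' => (step j hj').2.2.1.trans (ih (by omega))
  have hss : ∀ i ≤ h, ss i + ∑ j ∈ range i, (dd (j + 1) + 1) =
      i * h + ∑ j ∈ range i, ee (j + 1) := by
    intro i
    induction i with
    | zero => simp [hs]
    | succ i ih =>
      intro hi
      have := ih (by omega)
      have := (step i hi).2.2.2.1
      rw [sum_range_succ, sum_range_succ, add_one_mul]
      omega
  have hXX : ∀ i ≤ h, XX i =
      ∑ j ∈ range i, P (dd (j + 1)) + ∑ j ∈ range i, (ee j - ee (j + 1)) * P j := by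
    intro i
    induction i with
    | zero => simp [hX]
    | succ i ih =>
      intro hi
      rw [sum_range_succ, sum_range_succ, (step i hi).2.2.2.2, ih (by omega)]
      ring
  -- The low degrees are the partition conjugate to e₁ ≥ … ≥ e_h; the first `ee 0` of them, possibly
  -- zero, are used.
  set g : ℕ → ℕ := fun j => #{t ∈ range h | j < ee (t + 1)} with hg
  have hgh : ∀ j, g j ≤ h := fun j => (card_filter_le _ _).trans (card_range h).le
  have hg_iff : ∀ t < h, ∀ j, t + 1 ≤ g j ↔ j < ee (t + 1) := by
    intro t ht j
    constructor
    · intro h₁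
      by_contra h₂
      have : ({t ∈ range h | j < ee (t + 1)} : Finset ℕ) ⊆ range t := by
        intro t' ht'
        simp only [mem_filter, mem_range] at ht' ⊢
        by_contra h₃
        exact h₂ (ht'.2.trans_le (hee (t + 1) (t' + 1) (by omega) (by omega)))
      have := card_le_card this
      rw [card_range] at this
      simp only [hg] at h₁
      omega
    · intro h₁
      have : range (t + 1) ⊆ ({t ∈ range h | j < ee (t + 1)} : Finset ℕ) := by
        intro t' ht'
        simp only [mem_filter, mem_range] at ht' ⊢
        exact ⟨by omega, h₁.trans_le (hee (t' + 1) (t + 1) (by omega) (by omega))⟩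
      have := card_le_card this
      rwa [card_range] at this
  have hcard : ∀ t ≤ h, #{j ∈ range (ee 0) | t ≤ g j} = ee t := by
    intro t ht
    have : ({j ∈ range (ee 0) | t ≤ g j} : Finset ℕ) = range (ee t) := by
      ext j
      simp only [mem_filter, mem_range]
      rcases t with _ | t
      · simp
      · rw [hg_iff t (by omega)]
        have := hee 0 (t + 1) (by omega) ht
        omega
    rw [this, card_range]
  have hgmono : ∀ i j, i ≤ j → g j ≤ g i := fun i j hij =>
    card_le_card (monotone_filter_right _ fun t _ ht => hij.trans_lt ht)
  set f : ℕ → ℕ := fun i => if i < h then dd (i + 1) else g (i - h) with hf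
  have hftop : ∀ i < h, f i = dd (i + 1) := fun i hi => if_pos hi
  have hflow : ∀ j, f (h + j) = g j := fun j => by simp [hf]
  have hsplit : ∀ F : ℕ → ℕ, ∀ k ≤ h, ∑ i ∈ Ico k (h + ee 0), F (f i) =
      ∑ i ∈ Ico k h, F (dd (i + 1)) + ∑ j ∈ range (ee 0), F (g j) := by
    intro F k hk
    rw [← sum_Ico_consecutive _ hk (Nat.le_add_right h (ee 0))]
    congr 1
    · exact sum_congr rfl fun i hi => by rw [hftop i (mem_Ico.1 hi).2]
    · rw [sum_Ico_eq_sum_range, Nat.add_sub_cancel_left]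
      exact sum_congr rfl fun j _ => by rw [hflow]
  have hsplit' : ∀ k ≤ h, ∑ i ∈ range k, f i = ∑ i ∈ range k, dd (i + 1) := fun k hk =>
    sum_congr rfl fun i hi => hftop i ((mem_range.1 hi).trans_le hk)
  -- The top degrees with index from k to h contribute k each, so the right-hand side is k (h - 1) +
  -- ∑_{t≤k} eₜ. The inequality then says that the slack, a natural number, is nonnegative (`hss`).
  have hEG : ∀ k ≤ h,
      ∑ i ∈ range k, f i ≤ k * (k - 1) + ∑ j ∈ Ico k (h + ee 0), min (f j) k := by
    intro k hk
    rw [hsplit (fun x => min x k) k hk, hsplit' k hk, sum_min_eq _ g,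
      sum_congr rfl (s₂ := range k) (g := fun t => ee (t + 1)) fun t ht =>
        hcard (t + 1) (by rw [mem_range] at ht; omega),
      sum_congr rfl (s₂ := Ico k h) (g := fun _ => k) fun t ht =>
        min_eq_right (hk.trans (step t (mem_Ico.1 ht).2).1), sum_const, Nat.card_Ico, smul_eq_mul]
    have h₁ := hss k hk
    rw [sum_add_distrib, sum_const, card_range, smul_eq_mul, mul_one] at h₁
    obtain ⟨c, rfl⟩ := Nat.exists_eq_add_of_le hk
    rw [Nat.add_sub_cancel_left]
    rcases k with _ | k
    · simp
    · rw [Nat.add_sub_cancel]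
      nlinarith
  refine ⟨h + ee 0, hN, f, ?_, ?_, fun heven => exists_graph_of_nat ?_ heven ?_⟩
  · intro i _
    simp only [hf]
    split_ifs with hi
    · exact le_max_of_le_left (hD ▸ hdd 0 (i + 1) (by omega) hi)
    · exact le_max_of_le_right (hgh _)
  · rw [range_eq_Ico, hsplit P 0 h.zero_le, sum_comp_eq _ g P fun j _ => hgh j, hcard h le_rfl,
      hXX h le_rfl, ← range_eq_Ico, ← add_assoc]
    congr 2
    refine sum_congr rfl fun i hi => ?_
    rw [mem_range] at hi
    rw [hcard i (by omega), hcard (i + 1) hi]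
  · intro i j hij hj
    simp only [hf]
    split_ifs with h₁ h₂ h₂
    · exact hdd (i + 1) (j + 1) (by omega) (by omega)
    · omega
    · exact (hgh _).trans (step i h₂).1
    · exact hgmono _ _ (by omega)
  -- For k > h the inequality follows from the one for h. Each of the k - h additional degrees is at
  -- most h, so at most 2h is lost for each of them, whereas k (k - 1) - h (h - 1) = (k - h)(k + h -
  -- 1) ≥ 2h (k - h).
  · intro k hk₁ hk₂
    rcases le_or_gt k h with hk | hk
    · exact hEG k hk
    · have h₁ := hEG h le_rfl
      have hfle : ∀ j, h ≤ j → f j ≤ h := fun j hj => by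
        obtain ⟨c, rfl⟩ := Nat.exists_eq_add_of_le hj
        rw [hflow]
        exact hgh c
      rw [range_eq_Ico, ← sum_Ico_consecutive _ h.zero_le hk.le, ← range_eq_Ico]
      rw [← sum_Ico_consecutive _ hk.le hk₂] at h₁
      have h₂ : ∑ i ∈ Ico h k, f i ≤ (k - h) * h := by
        have := sum_le_card_nsmul (Ico h k) f h fun j hj => hfle j (mem_Ico.1 hj).1
        simpa using this
      have h₃ : ∑ i ∈ Ico h k, min (f i) h ≤ (k - h) * h := by
        refine le_trans (sum_le_sum fun i _ => min_le_left _ _) h₂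
      have h₄ : ∑ i ∈ Ico k (h + ee 0), min (f i) h ≤ ∑ i ∈ Ico k (h + ee 0), min (f i) k :=
        sum_le_sum fun i _ => min_le_min_left _ hk.le
      obtain ⟨c, rfl⟩ := Nat.exists_eq_add_of_lt hk
      have h₅ : h + c + 1 - h = c + 1 := by omega
      rw [h₅] at h₂ h₃
      rw [Nat.add_sub_cancel]
      have h₆ : h * (h - 1) + h = h * h := by
        rcases h with _ | h
        · rfl
        · rw [Nat.add_sub_cancel]; ring
      nlinarith

theorem exists_antitone_relabel {n : ℕ} (G : SimpleGraph (Fin n)) :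
    ∃ G' : SimpleGraph (Fin n), ∃ σ : Equiv.Perm (Fin n), (∀ i, deg G' i = deg G (σ i)) ∧
      Antitone (deg G') := by
  set σ : Equiv.Perm (Fin n) := Fin.revPerm.trans (Tuple.sort (deg G)) with hσ
  have hdeg : ∀ i, deg (G.comap σ) i = deg G (σ i) := by
    intro i
    simp only [deg]
    refine card_bij (fun j _ => σ j) ?_ (fun _ _ _ _ h => σ.injective h) ?_
    · simp
    · intro b hb
      exact ⟨σ.symm b, by simpa using hb, by simp⟩
  refine ⟨G.comap σ, σ, hdeg, fun i j hij => ?_⟩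
  rw [hdeg, hdeg]
  have := Tuple.monotone_sort (deg G) (Fin.rev_le_rev.2 hij)
  simpa [hσ] using this

/-- The degrees of a graph are found by the search. -/
theorem exists_reach {P : ℕ → ℕ} {N D n : ℕ} (hn : n ≤ N) (G : SimpleGraph (Fin n))
    (hD : ∀ v, deg G v ≤ D) :
    ∃ h d e s X, h ≤ D ∧ Reach P N D h h d e s X ∧ ∑ v, P (deg G v) = X + e * P h := by
  obtain ⟨G', σ, hσ, hanti⟩ := exists_antitone_relabel G
  set f : ℕ → ℕ := fun i => if hi : i < n then deg G' ⟨i, hi⟩ else 0 with hf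
  have hfG : ∀ i : Fin n, deg G' i = f i := fun i => by simp [hf]
  have hfD : ∀ i, f i ≤ D := by
    intro i
    simp only [hf]
    split_ifs with hi
    · rw [hσ]; exact hD _
    · exact D.zero_le
  have hfa : ∀ i j, i ≤ j → f j ≤ f i := by
    intro i j hij
    simp only [hf]
    split_ifs with hj hi
    · exact hanti (Fin.mk_le_mk.2 hij)
    · omega
    · exact Nat.zero_le _
    · exact le_rfl
  have hfn : f n ≤ n := by simp [hf]
  classical
  have hex : ∃ h, f h ≤ h := ⟨n, hfn⟩
  -- The split point: the first h sorted degrees are at least h and the others at most h. It exists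
  -- because the sequence is continued by zeros.
  set h := Nat.find hex with hh
  have hhn : h ≤ n := Nat.find_min' hex hfn
  have htop : ∀ i < h, h ≤ f i := by
    intro i hi
    have h₁ := Nat.find_min hex (show h - 1 < h by omega)
    have h₂ := hfa i (h - 1) (by omega)
    omega
  have hlow : ∀ j, h ≤ j → f j ≤ h := fun j hj => (hfa h j hj).trans (Nat.find_spec hex)
  have hhD : h ≤ D := by
    rcases Nat.eq_zero_or_pos h with h₀ | h₀
    · omega
    · exact (htop 0 h₀).trans (hfD 0)
  set ee : ℕ → ℕ := fun t => #{j ∈ Ico h n | t ≤ f j} with hee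
  have hEG : ∀ k ≤ h, ∑ j ∈ range k, (f j + 1) ≤ k * h + ∑ j ∈ range k, ee (j + 1) := by
    intro k hk
    have h₁ := sum_deg_le_of_nat G' hfG (hk.trans hhn)
    rw [← sum_Ico_consecutive _ hk hhn, sum_min_eq (Ico h n)] at h₁
    have h₂ : ∑ i ∈ Ico k h, min (f i) k ≤ (h - k) * k := by
      have := sum_le_card_nsmul (Ico k h) (fun i => min (f i) k) k fun j _ => min_le_right _ _
      simpa using this
    rw [sum_add_distrib, sum_const, card_range, smul_eq_mul, mul_one]
    change _ ≤ k * h + ∑ j ∈ range k, #{i ∈ Ico h n | j + 1 ≤ f i}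
    obtain ⟨c, hc⟩ := Nat.exists_eq_add_of_le hk
    rw [hc, Nat.add_sub_cancel_left] at h₂
    rw [hc] at h₁ ⊢
    rcases k with _ | k
    · simp
    · rw [Nat.add_sub_cancel] at h₁
      nlinarith
  -- By `hEG` the subtraction is not truncated for k ≤ h.
  set ss : ℕ → ℕ := fun k => k * h + ∑ j ∈ range k, ee (j + 1) - ∑ j ∈ range k, (f j + 1) with hss
  set XX : ℕ → ℕ := fun k =>
    ∑ j ∈ range k, P (f j) + ∑ j ∈ range k, (ee j - ee (j + 1)) * P j with hXX
  -- The sequence of top degrees is shifted by one and preceded by the upper bound D, so that the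
  -- first guess is only required to be at most D.
  have key := reach_of_seq (P := P) (N := N) (D := D) (h := h)
    (dd := fun k => if k = 0 then D else f (k - 1)) (ee := ee) (ss := ss) (XX := XX) rfl
    (by
      have : ee 0 ≤ n - h := (card_filter_le _ _).trans (Nat.card_Ico h n).le
      omega) (by simp [hss]) (by simp [hXX]) (fun i hi => by
        refine ⟨by simpa using htop i hi, ?_, ?_, ?_, ?_⟩
        · rcases i with _ | i
          · simpa using hfD 0
          · simpa using hfa i (i + 1) (by omega)
        · exact card_le_card (monotone_filter_right _ fun j _ (hj : i + 1 ≤ f j) => by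
            omega)
        · have h₁ := hEG i hi.le
          have h₂ := hEG (i + 1) hi
          simp only [hss, Nat.add_sub_cancel, Nat.add_eq_zero_iff, one_ne_zero, and_false, if_false]
          rw [sum_range_succ, sum_range_succ, add_one_mul] at h₂ ⊢
          omega
        · simp only [hXX, Nat.add_sub_cancel, Nat.add_eq_zero_iff, one_ne_zero, and_false, if_false]
          rw [sum_range_succ, sum_range_succ]
          ring) h le_rfl
  refine ⟨h, _, _, _, _, hhD, key, ?_⟩
  have h₁ : ∑ v, P (deg G v) = ∑ i ∈ range n, P (f i) := by
    rw [← Fin.sum_univ_eq_sum_range (fun i => P (f i)), ← Equiv.sum_comp σ]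
    exact sum_congr rfl fun i _ => by rw [← hσ, hfG]
  rw [h₁, range_eq_Ico, ← sum_Ico_consecutive _ h.zero_le hhn,
    sum_comp_eq (Ico h n) f P fun j hj => hlow j (mem_Ico.1 hj).1, ← range_eq_Ico, ← add_assoc]

end ErdosGallai

/-! ### Solvable instances have small solutions. -/

namespace StarSubRec

open Finset SimpleGraph ErdosGallai

/-- Induction with Pascal's rule: each further element adds at least one subset. A vertex of large
degree is thus the centre of many stars, which bounds the degrees by the counts. -/
theorem add_one_sub_le_choose {d r : ℕ} (hr : 1 ≤ r) (h : r ≤ d) : d + 1 - r ≤ d.choose r := by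
  obtain ⟨c, rfl⟩ := Nat.exists_eq_add_of_le h
  obtain ⟨r, rfl⟩ := Nat.exists_eq_add_of_le' hr
  induction c with
  | zero => simp
  | succ c ih =>
    have h₁ := ih (by omega)
    have h₂ : r + 1 + (c + 1) = (r + 1 + c) + 1 := by ring
    rw [h₂, Nat.choose_succ_succ']
    have : 0 < (r + 1 + c).choose r := Nat.choose_pos (by omega)
    omega

/-- Only the vertices of large degree and their neighbours contribute to the numbers of copies of
large stars. -/
theorem exists_small_graph {N ρ K L : ℕ} (G : SimpleGraph (Fin N)) (hρ : 1 ≤ ρ) (hρL : ρ ≤ L)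
    (hK : ∑ v, (deg G v).choose ρ ≤ K) :
    ∃ n ≤ K * (K + L + 1), ∃ G' : SimpleGraph (Fin n), (∀ v, deg G' v ≤ K + L) ∧
      ∀ r, ρ ≤ r → ∑ v, (deg G' v).choose r = ∑ v, (deg G v).choose r := by
  classical
  set A : Finset (Fin N) := {v | ρ ≤ deg G v} with hA
  have hdeg : ∀ v, deg G v ≤ K + L := by
    intro v
    by_cases hv : ρ ≤ deg G v
    · have h₁ := add_one_sub_le_choose hρ hv
      have h₂ : (deg G v).choose ρ ≤ K :=
        (single_le_sum (f := fun v => (deg G v).choose ρ) (fun _ _ => Nat.zero_le _)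
          (mem_univ v)).trans hK
      omega
    · omega
  have hAK : #A ≤ K := by
    refine le_trans ?_ hK
    rw [card_eq_sum_ones, hA, sum_filter]
    refine sum_le_sum fun v _ => ?_
    split_ifs with hv
    · exact Nat.choose_pos hv
    · exact Nat.zero_le _
  -- In the graph induced on B the vertices of A keep all their neighbours, and the others still
  -- have degree below ρ, hence are the centre of no star with r ≥ ρ leaves.
  set B : Finset (Fin N) := A ∪ A.biUnion fun v => {w | G.Adj v w} with hB
  have hBK : #B ≤ K * (K + L + 1) := by
    refine (card_union_le _ _).trans ?_
    have h₁ : #(A.biUnion fun v => {w | G.Adj v w}) ≤ #A * (K + L) :=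
      card_biUnion_le_card_mul _ _ _ fun v _ => (show _ = deg G v by rw [deg]).trans_le (hdeg v)
    have h₂ := Nat.mul_le_mul_right (K + L) hAK
    nlinarith
  set e := B.equivFin with he
  set G' : SimpleGraph (Fin #B) := G.comap fun i => (e.symm i : Fin N) with hG'
  have hdeg' : ∀ i, deg G' i = #{w ∈ B | G.Adj (e.symm i) w} := by
    intro i
    rw [deg]
    refine card_bij (fun j _ => (e.symm j : Fin N)) ?_ ?_ ?_
    · intro j hj
      simpa [hG'] using hj
    · intro a _ b _ hab
      exact e.symm.injective (Subtype.ext hab)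
    · intro w hw
      simp only [mem_filter] at hw
      exact ⟨e ⟨w, hw.1⟩, by simpa [hG'] using hw.2, by simp⟩
  have hle : ∀ v, #{w ∈ B | G.Adj v w} ≤ deg G v := by
    intro v
    rw [deg]
    refine card_le_card fun w => ?_
    simp only [mem_filter, mem_univ, true_and]
    exact And.right
  have heq : ∀ v ∈ A, #{w ∈ B | G.Adj v w} = deg G v := by
    intro v hv
    rw [deg]
    congr 1
    ext w
    simp only [mem_filter, mem_univ, true_and, and_iff_right_iff_imp]
    exact fun h => mem_union_right _ (mem_biUnion.2 ⟨v, hv, by simpa using h⟩)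
  refine ⟨#B, hBK, G', fun i => (hdeg' i).trans_le ((hle _).trans (hdeg _)), fun r hr => ?_⟩
  have hzero : ∀ v ∉ A, ∀ d ≤ deg G v, d.choose r = 0 := by
    intro v hv d hd
    simp only [hA, mem_filter, mem_univ, true_and, not_le] at hv
    exact Nat.choose_eq_zero_of_lt (by omega)
  have h₁ : ∑ i, (deg G' i).choose r = ∑ v ∈ B, (#{w ∈ B | G.Adj v w}).choose r := by
    rw [← sum_coe_sort B fun v => (#{w ∈ B | G.Adj v w}).choose r]
    exact Fintype.sum_equiv e.symm _ _ fun i => by rw [hdeg']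
  rw [h₁, ← sum_subset (subset_univ A) fun v _ hv => hzero v hv _ le_rfl,
    ← sum_subset (subset_union_left : A ⊆ B) fun v _ hv => hzero v hv _ (hle v)]
  exact sum_congr rfl fun v hv => by rw [heq v hv]

theorem StarConstraint.one_le_order (p : StarConstraint) : 1 ≤ p.order := by
  obtain ⟨c⟩ := p.isStar.1.nonempty
  exact c.pos

/-- The prescribed value of the sum of the binomial coefficients `(deg v).choose (order - 1)`. -/
def StarConstraint.target (p : StarConstraint) : ℕ :=
  (if p.order = 2 then 2 else 1) * p.count

theorem StarConstraint.copyCount_eq_iff (p : StarConstraint) {V : Type} [Fintype V]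
    (G : SimpleGraph V) :
    G.copyCount p.graph = p.count ↔ ∑ v, (deg G v).choose (p.order - 1) = p.target := by
  rw [← mul_copyCount p.isStar, target]
  split_ifs <;> simp

/-- A solvable instance has a solution of bounded size. -/
theorem Solvable.exists_small {I : List StarConstraint} (h : Solvable I) (hI : I ≠ []) {m L : ℕ}
    (hm : ∀ p ∈ I, p.count ≤ m) (hL : ∀ p ∈ I, p.order ≤ L) :
    ∃ n ≤ (2 * m + L + 1) ^ 2, ∃ G : SimpleGraph (Fin n), (∀ v, deg G v ≤ 2 * m + L) ∧
      ∀ p ∈ I, ∑ v, (deg G v).choose (p.order - 1) = p.target := by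
  classical
  obtain ⟨N, G, hG⟩ := h
  simp only [StarConstraint.copyCount_eq_iff] at hG
  have ht : ∀ p ∈ I, p.target ≤ 2 * m := by
    intro p hp
    have := hm p hp
    rw [StarConstraint.target]
    split_ifs <;> omega
  -- For a one-vertex star the sum of the C(deg v, 0) is the number of vertices, so the graph itself
  -- is small. Otherwise the smallest star has at least one leaf, as `exists_small_graph` requires.
  by_cases h₁ : ∃ p ∈ I, p.order = 1
  · obtain ⟨p, hp, h₁⟩ := h₁
    have hN := hG p hp
    have := ht p hp
    simp only [h₁, Nat.sub_self, Nat.choose_zero_right, sum_const, card_univ,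
      Fintype.card_fin, smul_eq_mul, mul_one] at hN
    have h₂ := Nat.le_self_pow two_ne_zero (2 * m + L + 1)
    refine ⟨N, by omega, G, fun v => ?_, hG⟩
    have : deg G v ≤ N := (card_le_univ _).trans (Fintype.card_fin N).le
    omega
  · push Not at h₁
    obtain ⟨p, hp, hmin⟩ := exists_min_image I.toFinset StarConstraint.order
      (List.toFinset_nonempty_iff I |>.2 hI)
    simp only [List.mem_toFinset] at hp hmin
    have := h₁ p hp
    have := p.one_le_order
    have := hL p hp
    obtain ⟨n, hn, G', hD, hG'⟩ := exists_small_graph (ρ := p.order - 1) (K := 2 * m) (L := L) G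
      (by omega) (by omega) ((hG p hp).trans_le (ht p hp))
    refine ⟨n, hn.trans (by nlinarith), G', hD, fun q hq => ?_⟩
    have := hmin q hq
    rw [hG' _ (by omega), hG q hq]

end StarSubRec

/-! ### Formulas for tables of powers and of reachable states. -/

namespace StackProg

@[simp] theorem Tm.eval_var (S : St) (i : ℕ) : (Tm.var i).eval S = (S i).length := rfl

@[simp] theorem Tm.eval_add (S : St) (a b : Tm) : (a + b).eval S = a.eval S + b.eval S := rfl

@[simp] theorem Tm.eval_mul (S : St) (a b : Tm) : (a * b).eval S = a.eval S * b.eval S := rfl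

@[simp] theorem Tm.eval_zero (S : St) : (0 : Tm).eval S = 0 := rfl

@[simp] theorem Tm.eval_two (S : St) : (2 : Tm).eval S = 2 := rfl

@[simp] theorem Tm.eval_one (S : St) : (1 : Tm).eval S = 1 := rfl

namespace Fm

/-- Equality of terms. -/
def eq (a b : Tm) : Fm := .and (.le a b) (.le b a)

/-- Strict inequality of terms. -/
def lt (a b : Tm) : Fm := .le (a + 1) b

/-- Disjunction. -/
def or (φ ψ : Fm) : Fm := .not (.and (.not φ) (.not ψ))

/-- Implication. -/
def imp (φ ψ : Fm) : Fm := .not (.and φ (.not ψ))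

/-- The universal quantifier, bounded by a term. -/
def all (i : ℕ) (t : Tm) (φ : Fm) : Fm := .not (.ex i t (.not φ))

@[simp] theorem sat_le (S : St) (a b : Tm) : (le a b).Sat S ↔ a.eval S ≤ b.eval S := Iff.rfl

@[simp] theorem sat_tab (S : St) (k : ℕ) (t : Tm) :
    (tab k t).Sat S ↔ (S k)[t.eval S]? = some true := Iff.rfl

@[simp] theorem sat_and (S : St) (φ ψ : Fm) : (φ.and ψ).Sat S ↔ φ.Sat S ∧ ψ.Sat S := Iff.rfl

@[simp] theorem sat_not (S : St) (φ : Fm) : φ.not.Sat S ↔ ¬ φ.Sat S := Iff.rfl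

@[simp] theorem sat_ex (S : St) (i : ℕ) (t : Tm) (φ : Fm) :
    (ex i t φ).Sat S ↔ ∃ x < t.eval S, φ.Sat (upd S i (un x)) := Iff.rfl

@[simp] theorem sat_eq (S : St) (a b : Tm) : (eq a b).Sat S ↔ a.eval S = b.eval S :=
  le_antisymm_iff.symm

@[simp] theorem sat_lt (S : St) (a b : Tm) : (lt a b).Sat S ↔ a.eval S < b.eval S := Iff.rfl

@[simp] theorem sat_or (S : St) (φ ψ : Fm) : (φ.or ψ).Sat S ↔ φ.Sat S ∨ ψ.Sat S := by
  change ¬ (¬ φ.Sat S ∧ ¬ ψ.Sat S) ↔ _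
  tauto

@[simp] theorem sat_imp (S : St) (φ ψ : Fm) : (φ.imp ψ).Sat S ↔ (φ.Sat S → ψ.Sat S) := by
  change ¬ (φ.Sat S ∧ ¬ ψ.Sat S) ↔ _
  tauto

@[simp] theorem sat_all (S : St) (i : ℕ) (t : Tm) (φ : Fm) :
    (all i t φ).Sat S ↔ ∀ x < t.eval S, φ.Sat (upd S i (un x)) := by
  change ¬ (∃ x < t.eval S, ¬ φ.Sat (upd S i (un x))) ↔ _
  push Not
  rfl

/-- The defining property of a table of the powers of `c` modulo `M`. Bit `d * M + x` of table `k`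
tells whether `x` is the `d`-th power. -/
def powTable (k : ℕ) (c M : Tm) : Fm :=
  ex 21 (.var 20 + 1) (ex 22 M (and (eq (.var 20) (.var 21 * M + .var 22))
    (or (and (eq (.var 21) 0) (eq (.var 22) 1))
      (ex 23 (.var 21) (and (eq (.var 23 + 1) (.var 21)) (ex 24 M
        (and (tab k (.var 23 * M + .var 24))
          (ex 25 (c + 1) (eq (.var 24 * c) (.var 25 * M + .var 22))))))))))

/-- The defining property of the table of the reachable states of the search for a degree
sequence. -/
def reachTable (k N D M U P : ℕ) : Fm :=
  ex 21 (.var U) <| ex 22 (.var U) <| ex 23 (.var U) <| ex 24 (.var U) <| ex 25 (.var U) <|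
  ex 26 (.var U) <|
  and (eq (.var 20) (((((.var 21 * .var U + .var 22) * .var U + .var 23) * .var U + .var 24) *
    .var U + .var 25) * .var U + .var 26)) <|
  or
    (and (eq (.var 21) 0) <| and (eq (.var 23) (.var D)) <| and (le (.var 22 + .var 24) (.var N)) <|
      and (eq (.var 25) 0) (eq (.var 26) 0))
    (ex 27 (.var U) <| ex 28 (.var U) <| ex 29 (.var U) <| ex 30 (.var U) <| ex 31 (.var U) <|
      and (eq (.var 27 + 1) (.var 21)) <| and (le (.var 21) (.var 22)) <|
      and (le (.var 22) (.var 23)) <|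
      and (tab k (((((.var 27 * .var U + .var 22) * .var U + .var 28) * .var U + .var 29) *
        .var U + .var 30) * .var U + .var 31)) <|
      and (le (.var 23) (.var 28)) <| and (le (.var 24) (.var 29)) <|
      and (eq (.var 25 + .var 23 + 1) (.var 30 + .var 22 + .var 24)) <|
      ex 32 (.var U) <| ex 33 (.var M) <| ex 34 (.var M) <|
      and (eq (.var 24 + .var 32) (.var 29)) <|
      and (tab P (.var 23 * .var M + .var 33)) <|
      and (tab P (.var 27 * .var M + .var 34)) <|
      eq (.var 26) (.var 31 + .var 33 + .var 32 * .var 34))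

end Fm

theorem lt_of_pack {a b x y M : ℕ} (hx : x < M) (hab : a < b) : a * M + x < b * M + y := by
  have := Nat.mul_le_mul_right M (show a + 1 ≤ b from hab)
  rw [add_one_mul] at this
  omega

theorem pack_inj {a b x y M : ℕ} (hx : x < M) (hy : y < M) (h : a * M + x = b * M + y) :
    a = b ∧ x = y := by
  rcases lt_trichotomy a b with h₁ | h₁ | h₁
  · have := lt_of_pack (y := y) hx h₁; omega
  · subst h₁; omega
  · have := lt_of_pack (y := x) hy h₁; omega

theorem pack_lt {a b x M : ℕ} (ha : a < b) (hx : x < M) : a * M + x < b * M := by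
  simpa using lt_of_pack (y := 0) hx ha

theorem Fm.sat_powTable {k c m : ℕ} {S : St} {y cv M : ℕ} (hk : k < 20) (hc : c < 20)
    (hm : m < 20) (hcv : (S c).length = cv) (hMv : (S m).length = M) (hy : (S 20).length = y) :
    (Fm.powTable k (.var c) (.var m)).Sat S ↔ ∃ d < y + 1, ∃ x < M, y = d * M + x ∧
      (d = 0 ∧ x = 1 ∨ ∃ d' < d, d' + 1 = d ∧ ∃ z < M, (S k)[d' * M + z]? = some true ∧
        ∃ q < cv + 1, z * cv = q * M + x) := by
  have hk' : ∀ j, 20 ≤ j → k ≠ j := fun j hj => by omega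
  have hc' : ∀ j, 20 ≤ j → c ≠ j := fun j hj => by omega
  have hm' : ∀ j, 20 ≤ j → m ≠ j := fun j hj => by omega
  simp [Fm.powTable, upd, hk', hc', hm', hcv, hMv, hy]

/-- The d-th power comes from the previous one by a multiplication with c and a division by M. The
previous power has a smaller index, so its entry exists already. The condition M ≥ 2 makes 1 its own
residue. -/
theorem tabulate_powTable {k c m : ℕ} {S : St} {n cv M : ℕ} (hk : k < 20) (hc : c < 20)
    (hm : m < 20) (hkc : c ≠ k) (hkm : m ≠ k) (hcv : (S c).length = cv) (hMv : (S m).length = M)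
    (h2 : 2 ≤ M) {d : ℕ} : ∀ {x : ℕ}, x < M → d * M + x < n →
      ((tabulate (.powTable k (.var c) (.var m)) k 20 S n)[d * M + x]? = some true ↔
        x = cv ^ d % M) := by
  have hsat : ∀ {d x}, x < M → d * M + x < n →
      ((tabulate (.powTable k (.var c) (.var m)) k 20 S n)[d * M + x]? = some true ↔
        (d = 0 ∧ x = 1 ∨ ∃ d' < d, d' + 1 = d ∧ ∃ z < M,
          (tabulate (.powTable k (.var c) (.var m)) k 20 S n)[d' * M + z]? = some true ∧
          ∃ q < cv + 1, z * cv = q * M + x)) := by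
    intro d x hx hn
    rw [getElem?_tabulate_eq hn, Fm.sat_powTable (cv := cv) (M := M) (y := d * M + x) hk hc hm
      (by rw [upd_ne _ _ (by omega), upd_ne _ _ hkc, hcv])
      (by rw [upd_ne _ _ (by omega), upd_ne _ _ hkm, hMv]) (by simp)]
    rw [upd_ne _ _ (show k ≠ 20 by omega), upd_same]
    constructor
    · rintro ⟨d', -, x', hx', h, H⟩
      obtain ⟨rfl, rfl⟩ := pack_inj hx hx' h
      refine H.imp_right ?_
      rintro ⟨d', hd, h₁, z, hz, h₂, h₃⟩
      exact ⟨d', hd, h₁, z, hz, ((getElem?_tabulate_lt hn.le).1 h₂).2, h₃⟩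
    · intro H
      have := Nat.le_mul_of_pos_right d (show 0 < M by omega)
      refine ⟨d, by omega, x, hx, rfl, H.imp_right ?_⟩
      rintro ⟨d', hd, h₁, z, hz, h₂, h₃⟩
      exact ⟨d', hd, h₁, z, hz, (getElem?_tabulate_lt hn.le).2 ⟨lt_of_pack hz hd, h₂⟩, h₃⟩
  induction d with
  | zero =>
    intro x hx hn
    rw [hsat hx hn, pow_zero, Nat.mod_eq_of_lt h2]
    simp
  | succ d ih =>
    intro x hx hn
    rw [hsat hx hn]
    constructor
    · rintro (⟨h, -⟩ | ⟨d', -, h₁, z, hz, h₂, q, -, h₃⟩)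
      · exact absurd h d.succ_ne_zero
      · obtain rfl : d' = d := by omega
        have := (ih hz ((lt_of_pack hz (Nat.lt_succ_self d')).trans hn)).1 h₂
        rw [pow_succ, ← Nat.mod_mul_mod, ← this, h₃, Nat.mul_add_mod', Nat.mod_eq_of_lt hx]
    · intro h
      have hz : cv ^ d % M < M := Nat.mod_lt _ (by omega)
      refine .inr ⟨d, by omega, rfl, _, hz,
        (ih hz ((lt_of_pack hz (Nat.lt_succ_self d)).trans hn)).2 rfl,
        cv ^ d % M * cv / M, ?_, ?_⟩
      -- The residue multiplied is less than M, so the quotient is at most c and is found within the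
      -- bound of its quantifier.
      · refine Nat.lt_succ_of_le (Nat.div_le_of_le_mul (Nat.mul_le_mul_right _ hz.le))
      · rw [h, pow_succ, ← Nat.mod_mul_mod]
        exact (Nat.div_add_mod' _ _).symm

end StackProg

/-! ### The table of reachable states. -/

namespace StackProg

open ErdosGallai

/-- The index of a state of the search for a degree sequence. -/
def pack (U i h d e s X : ℕ) : ℕ := ((((i * U + h) * U + d) * U + e) * U + s) * U + X

theorem pack_injective {U i h d e s X i' h' d' e' s' X' : ℕ} (hh : h < U) (hd : d < U) (he : e < U)
    (hs : s < U) (hX : X < U) (hh' : h' < U) (hd' : d' < U) (he' : e' < U) (hs' : s' < U)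
    (hX' : X' < U) (heq : pack U i h d e s X = pack U i' h' d' e' s' X') :
    i = i' ∧ h = h' ∧ d = d' ∧ e = e' ∧ s = s' ∧ X = X' := by
  obtain ⟨heq, h₁⟩ := pack_inj hX hX' heq
  obtain ⟨heq, h₂⟩ := pack_inj hs hs' heq
  obtain ⟨heq, h₃⟩ := pack_inj he he' heq
  obtain ⟨heq, h₄⟩ := pack_inj hd hd' heq
  obtain ⟨heq, h₅⟩ := pack_inj hh hh' heq
  exact ⟨heq, h₅, h₄, h₃, h₂, h₁⟩

/-- The step number is the most significant component, so all states of earlier steps are in the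
table before they are looked up. -/
theorem pack_lt_pack {U i h d e s X i' h' d' e' s' X' : ℕ} (hh : h < U) (hd : d < U) (he : e < U)
    (hs : s < U) (hX : X < U) (hi : i < i') : pack U i h d e s X < pack U i' h' d' e' s' X' :=
  lt_of_pack hX <| lt_of_pack hs <| lt_of_pack he <| lt_of_pack hd <| lt_of_pack hh hi

theorem pack_lt_pow {U i h d e s X : ℕ} (hi : i < U) (hh : h < U) (hd : d < U) (he : e < U)
    (hs : s < U) (hX : X < U) : pack U i h d e s X < U ^ 6 := by
  have : U ^ 6 = U * U * U * U * U * U := by ring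
  rw [this]
  exact pack_lt (pack_lt (pack_lt (pack_lt (pack_lt hi hh) hd) he) hs) hX

theorem Fm.sat_reachTable {S : St} {y : ℕ} (hy : (S 20).length = y) {N D M U : ℕ}
    (hD : (S 4).length = D) (hN : (S 6).length = N) (hM : (S 9).length = M)
    (hU : (S 13).length = U) :
    (Fm.reachTable 14 6 4 9 13 11).Sat S ↔ ∃ i < U, ∃ h < U, ∃ d < U, ∃ e < U, ∃ s < U, ∃ X < U,
      y = pack U i h d e s X ∧
      (i = 0 ∧ d = D ∧ h + e ≤ N ∧ s = 0 ∧ X = 0 ∨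
        ∃ j < U, ∃ d₀ < U, ∃ e₀ < U, ∃ s₀ < U, ∃ X₀ < U, j + 1 = i ∧ i ≤ h ∧ h ≤ d ∧
          (S 14)[pack U j h d₀ e₀ s₀ X₀]? = some true ∧ d ≤ d₀ ∧ e ≤ e₀ ∧
          s + d + 1 = s₀ + h + e ∧ ∃ c < U, ∃ p < M, ∃ q < M, e + c = e₀ ∧
          (S 11)[d * M + p]? = some true ∧ (S 11)[j * M + q]? = some true ∧
          X = X₀ + p + c * q) := by
  simp [Fm.reachTable, upd, hD, hN, hM, hU, hy, pack]

/-- Every component of a reachable state is less than U, so quantifiers bounded by U lose no states.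
-/
theorem reach_lt {P : ℕ → ℕ} {N D M U : ℕ} (hP : ∀ n, P n < M)
    (hU : N * (N + M) + D + 1 ≤ U) {h i d e s X : ℕ} (H : Reach P N D h i d e s X) :
    i < U ∧ h < U ∧ d < U ∧ e < U ∧ s < U ∧ X < U := by
  obtain ⟨h₁, h₂, h₃, h₄, E, h₅, h₆⟩ := H.bounds (Q := M) fun n => (hP n).le
  have hM := hP 0
  have h₇ := Nat.mul_le_mul_right N (h₂.trans (show h ≤ N by omega))
  have h₈ := Nat.mul_le_mul_right M (show i + E ≤ N by omega)
  have h₉ := Nat.le_mul_of_pos_right N (show 0 < M by omega)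
  rw [mul_add] at hU
  refine ⟨?_, ?_, ?_, ?_, ?_, ?_⟩ <;> omega

/-- The table of the states that are reached. -/
theorem tabulate_reachTable {S : St} {N D M U c n : ℕ}
    (hD : (S 4).length = D) (hN : (S 6).length = N) (hM : (S 9).length = M)
    (hU : (S 13).length = U)
    (hP : ∀ d ≤ D, ∀ x < M, (S 11)[d * M + x]? = some true ↔ x = c ^ d % M) (hM0 : 0 < M)
    (hUbd : N * (N + M) + D + 1 ≤ U) {i : ℕ} :
    ∀ {h d e s X : ℕ}, i < U → h < U → d < U → e < U → s < U → X < U → pack U i h d e s X < n →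
      ((tabulate (.reachTable 14 6 4 9 13 11) 14 20 S n)[pack U i h d e s X]? = some true ↔
        Reach (fun d => c ^ d % M) N D h i d e s X) := by
  have hPM : ∀ d, c ^ d % M < M := fun d => Nat.mod_lt _ hM0
  have hsat : ∀ {i h d e s X : ℕ}, i < U → h < U → d < U → e < U → s < U → X < U →
      pack U i h d e s X < n →
      ((tabulate (.reachTable 14 6 4 9 13 11) 14 20 S n)[pack U i h d e s X]? = some true ↔
        (i = 0 ∧ d = D ∧ h + e ≤ N ∧ s = 0 ∧ X = 0 ∨
        ∃ j < U, ∃ d₀ < U, ∃ e₀ < U, ∃ s₀ < U, ∃ X₀ < U, j + 1 = i ∧ i ≤ h ∧ h ≤ d ∧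
          (tabulate (.reachTable 14 6 4 9 13 11) 14 20 S n)[pack U j h d₀ e₀ s₀ X₀]? = some true ∧
          d ≤ d₀ ∧ e ≤ e₀ ∧
          s + d + 1 = s₀ + h + e ∧ ∃ c < U, ∃ p < M, ∃ q < M, e + c = e₀ ∧
          (S 11)[d * M + p]? = some true ∧ (S 11)[j * M + q]? = some true ∧
          X = X₀ + p + c * q)) := by
    intro i h d e s X hi hh hd he hs hX hn
    have hS : ∀ j < 14, ∀ l l', upd (upd S 14 l) 20 l' j = S j := fun j hj l l' => by
      rw [upd_ne _ _ (by omega), upd_ne _ _ (by omega)]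
    rw [getElem?_tabulate_eq hn, Fm.sat_reachTable (y := pack U i h d e s X) (by simp) (by rw [hS _ (by omega), hD])
      (by rw [hS _ (by omega), hN]) (by rw [hS _ (by omega), hM]) (by rw [hS _ (by omega), hU]),
      hS 11 (by omega), upd_ne _ _ (show 14 ≠ 20 by omega), upd_same]
    constructor
    · rintro ⟨i', hi', h', hh', d', hd', e', he', s', hs', X', hX', heq, H⟩
      obtain ⟨rfl, rfl, rfl, rfl, rfl, rfl⟩ :=
        pack_injective hh hd he hs hX hh' hd' he' hs' hX' heq
      refine H.imp_right ?_
      rintro ⟨j, hj, d₀, hd₀, e₀, he₀, s₀, hs₀, X₀, hX₀, h₁, h₂, h₃, h₄, H⟩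
      exact ⟨j, hj, d₀, hd₀, e₀, he₀, s₀, hs₀, X₀, hX₀, h₁, h₂, h₃,
        ((getElem?_tabulate_lt hn.le).1 h₄).2, H⟩
    · intro H
      refine ⟨i, hi, h, hh, d, hd, e, he, s, hs, X, hX, rfl, H.imp_right ?_⟩
      rintro ⟨j, hj, d₀, hd₀, e₀, he₀, s₀, hs₀, X₀, hX₀, h₁, h₂, h₃, h₄, H⟩
      exact ⟨j, hj, d₀, hd₀, e₀, he₀, s₀, hs₀, X₀, hX₀, h₁, h₂, h₃,
        (getElem?_tabulate_lt hn.le).2 ⟨pack_lt_pack hh hd₀ he₀ hs₀ hX₀ (by omega), h₄⟩, H⟩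
  induction i with
  | zero =>
    intro h d e s X hi hh hd he hs hX hn
    rw [hsat hi hh hd he hs hX hn]
    simp [Reach]
  | succ i ih =>
    intro h d e s X hi hh hd he hs hX hn
    rw [hsat hi hh hd he hs hX hn]
    constructor
    · rintro (⟨h₀, -⟩ | ⟨j, hj, d₀, hd₀, e₀, he₀, s₀, hs₀, X₀, hX₀, h₁, h₂, h₃, h₄, h₅, h₆, h₇,
        r, hr, p, hp, q, hq, h₈, h₉, h₁₀, h₁₁⟩)
      · exact absurd h₀ i.succ_ne_zero
      · obtain rfl : j = i := by omega
        rw [ih hj hh hd₀ he₀ hs₀ hX₀ ((pack_lt_pack hh hd₀ he₀ hs₀ hX₀ (by omega)).trans hn)] at h₄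
        have hdD := (h₄.bounds fun n => (hPM n).le).1
        rw [hP d (by omega) p hp] at h₉
        rw [hP j (by omega) q hq] at h₁₀
        refine ⟨h₂, h₃, d₀, e₀, s₀, X₀, h₄, h₅, h₆, h₇, ?_⟩
        change X = X₀ + c ^ d % M + (e₀ - e) * (c ^ j % M)
        rw [← h₉, ← h₁₀, ← h₈, Nat.add_sub_cancel_left, h₁₁]
    · rintro ⟨h₁, h₂, d₀, e₀, s₀, X₀, h₃, h₄, h₅, h₆, h₇⟩
      obtain ⟨k₁, -, k₃, k₄, k₅, k₆⟩ := reach_lt hPM hUbd h₃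
      have hdD := (h₃.bounds fun n => (hPM n).le).1
      refine .inr ⟨i, k₁, d₀, k₃, e₀, k₄, s₀, k₅, X₀, k₆, rfl, h₁, h₂,
        (ih k₁ hh k₃ k₄ k₅ k₆ ((pack_lt_pack hh k₃ k₄ k₅ k₆ (by omega)).trans hn)).2 h₃, h₄, h₅, h₆,
        e₀ - e, by omega, _, hPM d, _, hPM i, by omega, (hP d (by omega) _ (hPM d)).2 rfl,
        (hP i (by omega) _ (hPM i)).2 rfl, h₇⟩

end StackProg

/-! ### Reading the constraints from the input string. -/

namespace StarSubRec

open StackProg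

/-- The code of a constraint. -/
noncomputable def StarConstraint.code (p : StarConstraint) : List Bool :=
  encodeGraph p.graph ++ encodeUnary p.count

theorem encode_append (I J : List StarConstraint) : encode (I ++ J) = encode I ++ encode J :=
  List.flatMap_append

theorem encode_cons (p : StarConstraint) (I : List StarConstraint) :
    encode (p :: I) = p.code ++ encode I := rfl

/-- The bits of the adjacency matrix, row by row. -/
noncomputable def matrixBits {n : ℕ} (F : SimpleGraph (Fin n)) : List Bool :=
  (List.finRange n).flatMap fun i =>
    (List.finRange n).map fun j => @decide (F.Adj i j) (Classical.propDecidable _)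

theorem length_matrixBits {n : ℕ} (F : SimpleGraph (Fin n)) : (matrixBits F).length = n * n := by
  simp [matrixBits, List.length_flatMap]

theorem StarConstraint.length_code (p : StarConstraint) :
    p.code.length = p.order + p.order * p.order + p.count + 2 := by
  have := length_matrixBits p.graph
  rw [matrixBits] at this
  rw [code, encodeGraph, encodeUnary, encodeUnary, List.length_append, List.length_append, this]
  simp
  ring

theorem unary_iff {u v : List Bool} {n a p : ℕ} (hp : u.length = p) :
    ((∀ i < a, (u ++ (encodeUnary n ++ v))[p + i]? = some true) ∧
      ¬ (u ++ (encodeUnary n ++ v))[p + a]? = some true) ↔ a = n := by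
  have h₁ : ∀ i, (u ++ (encodeUnary n ++ v))[p + i]? = (encodeUnary n ++ v)[i]? := fun i => by
    rw [List.getElem?_append_right (by omega), ← hp, Nat.add_sub_cancel_left]
  have h₂ : ∀ i < n, (encodeUnary n ++ v)[i]? = some true := fun i hi => by
    rw [encodeUnary, List.append_assoc, List.getElem?_append_left (by simpa using hi)]
    simp [hi]
  have h₃ : (encodeUnary n ++ v)[n]? = some false := by
    rw [encodeUnary, List.append_assoc, List.getElem?_append_right (by simp)]
    simp
  simp only [h₁]
  constructor
  · rintro ⟨h₄, h₅⟩
    rcases lt_trichotomy a n with h | h | h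
    · exact absurd (h₂ a h) h₅
    · exact h
    · rw [h₄ n h] at h₃; simp at h₃
  · rintro rfl
    exact ⟨h₂, by simp [h₃]⟩

/-- At position `p` of `w` there is a block of bits that has the shape of the code of a constraint of
order `n` and count `c`. -/
def IsBlock (w : List Bool) (p n c : ℕ) : Prop :=
  ((∀ i < n, w[p + i]? = some true) ∧ ¬ w[p + n]? = some true) ∧
  ((∀ i < c, w[p + n + 1 + n * n + i]? = some true) ∧ ¬ w[p + n + 1 + n * n + c]? = some true) ∧
  p + n + n * n + c + 2 ≤ w.length

/-- The adjacency matrix is skipped without being read: the input codes stars, and a star is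
determined up to isomorphism by its order. The two unary codes fix n and c because each ends at its
first `false`. -/
theorem isBlock_iff {u v : List Bool} (q : StarConstraint) {n c : ℕ} :
    IsBlock (u ++ (q.code ++ v)) u.length n c ↔ n = q.order ∧ c = q.count := by
  have h₁ : u ++ (q.code ++ v) =
      u ++ (encodeUnary q.order ++ (matrixBits q.graph ++ (encodeUnary q.count ++ v))) := by
    simp [StarConstraint.code, encodeGraph, matrixBits]
  have h₂ : u ++ (q.code ++ v) =
      (u ++ encodeUnary q.order ++ matrixBits q.graph) ++ (encodeUnary q.count ++ v) := by
    simp [StarConstraint.code, encodeGraph, matrixBits]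
  have h₃ : (u ++ encodeUnary q.order ++ matrixBits q.graph).length =
      u.length + q.order + 1 + q.order * q.order := by
    simp [length_matrixBits, encodeUnary]; ring
  rw [IsBlock]
  constructor
  · rintro ⟨h₄, h₅, -⟩
    rw [h₁, unary_iff rfl] at h₄
    subst h₄
    rw [h₂, unary_iff h₃] at h₅
    exact ⟨rfl, h₅⟩
  · rintro ⟨rfl, rfl⟩
    refine ⟨?_, ?_, ?_⟩
    · rw [h₁, unary_iff rfl]
    · rw [h₂, unary_iff h₃]
    · simp [q.length_code]
      omega

theorem not_isBlock_length {w : List Bool} {p n c : ℕ} (hp : w.length ≤ p) : ¬ IsBlock w p n c := by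
  rintro ⟨-, -, h⟩
  omega

/-- The code of some constraint of `I` starts at position `y`, or the code of `I` ends there. -/
def IsStart (I : List StarConstraint) (y : ℕ) : Prop := ∃ u v, u ++ v = I ∧ (encode u).length = y

/-- `I` contains a constraint of order `n` and count `c`. -/
def HasConstraint (I : List StarConstraint) (n c : ℕ) : Prop :=
  ∃ q ∈ I, q.order = n ∧ q.count = c

theorem isBlock_of_split {I u v : List StarConstraint} {n c : ℕ} (h : u ++ v = I) :
    IsBlock (encode I) (encode u).length n c ↔
      ∃ q v', v = q :: v' ∧ n = q.order ∧ c = q.count := by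
  subst h
  rw [encode_append]
  cases v with
  | nil => simpa using not_isBlock_length (by simp [encode])
  | cons q v => rw [encode_cons, isBlock_iff]; simp

/-- The bits inside a block may look like another block by accident, so blocks only count at genuine
starts. -/
theorem hasConstraint_iff {I : List StarConstraint} {n c : ℕ} :
    HasConstraint I n c ↔ ∃ y < (encode I).length + 1, IsStart I y ∧ IsBlock (encode I) y n c := by
  constructor
  · rintro ⟨q, hq, rfl, rfl⟩
    obtain ⟨u, v, rfl⟩ := List.append_of_mem hq
    refine ⟨(encode u).length, ?_, ⟨u, _, rfl, rfl⟩, (isBlock_of_split rfl).2 ⟨q, v, rfl, rfl, rfl⟩⟩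
    rw [encode_append, List.length_append]
    omega
  · rintro ⟨_, -, ⟨u, v, rfl, rfl⟩, h⟩
    obtain ⟨q, v', rfl, rfl, rfl⟩ := (isBlock_of_split rfl).1 h
    exact ⟨q, by simp, rfl, rfl⟩

/-- A start other than 0 is the end of the block at an earlier start, so the starts can be tabulated
by course-of-values recursion. -/
theorem isStart_iff {I : List StarConstraint} {y : ℕ} :
    IsStart I y ↔ y = 0 ∨ ∃ p < y, ∃ n < y, ∃ c < y, IsStart I p ∧ IsBlock (encode I) p n c ∧
      y = p + n + n * n + c + 2 := by
  constructor
  · rintro ⟨u, v, rfl, rfl⟩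
    rcases List.eq_nil_or_concat u with rfl | ⟨u, q, rfl⟩
    · exact .inl rfl
    · right
      have h : (encode (u ++ [q])).length =
          (encode u).length + q.order + q.order * q.order + q.count + 2 := by
        rw [encode_append, List.length_append, encode_cons, List.length_append, q.length_code]
        simp [encode]
        omega
      rw [List.concat_eq_append, h]
      exact ⟨_, by omega, q.order, by omega, q.count, by omega, ⟨u, [q] ++ v, by simp, rfl⟩,
        (isBlock_of_split (v := q :: v) (by simp)).2 ⟨q, v, rfl, rfl, rfl⟩, rfl⟩
  · rintro (rfl | ⟨_, -, n, -, c, -, ⟨u, v, rfl, rfl⟩, h, rfl⟩)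
    · exact ⟨[], I, rfl, rfl⟩
    · obtain ⟨q, v', rfl, rfl, rfl⟩ := (isBlock_of_split rfl).1 h
      refine ⟨u ++ [q], v', by simp, ?_⟩
      rw [encode_append, List.length_append, encode_cons, List.length_append, q.length_code]
      simp [encode]
      omega

end StarSubRec

namespace StackProg

open StarSubRec

namespace Fm

/-- The formula for `IsBlock`, with auxiliary variable `t`. -/
def block (p n c t : ℕ) : Fm :=
  and (and (all t (.var n) (tab 0 (.var p + .var t))) (not (tab 0 (.var p + .var n)))) <|
  and (and (all t (.var c) (tab 0 (.var p + .var n + 1 + .var n * .var n + .var t)))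
    (not (tab 0 (.var p + .var n + 1 + .var n * .var n + .var c)))) <|
  le (.var p + .var n + .var n * .var n + .var c + 2) (.var 0)

theorem sat_block {S : St} {w : List Bool} (hw : S 0 = w) {p n c t : ℕ} (hp : t ≠ p) (hn : t ≠ n)
    (h₀ : t ≠ 0) : (block p n c t).Sat S ↔
      IsBlock w (S p).length (S n).length (S c).length := by
  simp [block, IsBlock, upd, hw, hp.symm, hn.symm, h₀.symm]

/-- The defining property of the table of the starts of blocks. -/
def startTable : Fm :=
  or (eq (.var 20) 0) <| ex 21 (.var 20) <| ex 22 (.var 20) <| ex 23 (.var 20) <|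
    and (tab 1 (.var 21)) <| and (block 21 22 23 24) <|
    eq (.var 20) (.var 21 + .var 22 + .var 22 * .var 22 + .var 23 + 2)

theorem sat_startTable {S : St} {w : List Bool} (hw : S 0 = w) {y : ℕ} (hy : (S 20).length = y) :
    startTable.Sat S ↔ y = 0 ∨ ∃ p < y, ∃ n < y, ∃ c < y, (S 1)[p]? = some true ∧
      IsBlock w p n c ∧ y = p + n + n * n + c + 2 := by
  have : ∀ p n c, (block 21 22 23 24).Sat (upd (upd (upd S 21 (un p)) 22 (un n)) 23 (un c)) ↔
      IsBlock w p n c := fun p n c => by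
    rw [sat_block (w := w) (by simpa [upd] using hw) (by simp) (by simp) (by simp)]
    simp [upd]
  simp [startTable, this, -List.length_eq_zero_iff]
  simp [upd, hy, -List.length_eq_zero_iff]

/-- The formula that says that there is a constraint of a given order and count. -/
def constraint (n c p t : ℕ) : Fm := ex p (.var 0 + 1) <| and (tab 1 (.var p)) (block p n c t)

end Fm

theorem tabulate_startTable {S : St} {I : List StarConstraint} (hS : S 0 = encode I) {n y : ℕ} :
    y < n → ((tabulate .startTable 1 20 S n)[y]? = some true ↔ IsStart I y) := by
  induction y using Nat.strong_induction_on with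
  | _ y ih =>
    intro hn
    rw [getElem?_tabulate_eq hn, isStart_iff,
      Fm.sat_startTable (w := encode I) (y := y) (by simpa [upd] using hS) (by simp)]
    refine or_congr Iff.rfl ?_
    refine exists_congr fun p => and_congr_right fun hp => exists_congr fun n => and_congr_right
      fun _ => exists_congr fun c => and_congr_right fun _ => and_congr_left fun _ => ?_
    rw [upd_ne _ _ (by omega), upd_same, getElem?_tabulate_lt hn.le, ih p hp (hp.trans hn)]
    exact and_iff_right hp

theorem Fm.sat_constraint {S : St} {I : List StarConstraint} (hS : S 0 = encode I)
    (h₁ : ∀ y < (encode I).length + 1, (S 1)[y]? = some true ↔ IsStart I y) {n c p t : ℕ}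
    (hn : n ≠ p) (hc : c ≠ p) (hp : 1 < p) (ht : t ≠ p) (htn : t ≠ n) (ht0 : t ≠ 0) :
    (Fm.constraint n c p t).Sat S ↔ HasConstraint I (S n).length (S c).length := by
  have hb : ∀ x, (block p n c t).Sat (upd S p (un x)) ↔
      IsBlock (encode I) x (S n).length (S c).length := fun x => by
    rw [sat_block (w := encode I) (by rw [upd_ne _ _ (by omega), hS]) ht htn ht0]
    simp [upd, hn, hc]
  rw [hasConstraint_iff]
  simp only [constraint, sat_ex, sat_and, hb, sat_tab, Tm.eval_var, Tm.eval_add, Tm.eval_one, hS,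
    upd_same, List.length_replicate, upd_ne S _ (show 1 ≠ p by omega)]
  exact exists_congr fun y => and_congr_right fun hy => and_congr_left fun _ => h₁ y hy

end StackProg

/-! ### All star counts as the digits of one number. -/

namespace StarSubRec

open Finset SimpleGraph ErdosGallai StackProg

theorem sum_pow_lt {a : ℕ → ℕ} {B k : ℕ} (ha : ∀ r < k, a r < B) :
    ∑ r ∈ range k, a r * B ^ r < B ^ k := by
  induction k with
  | zero => simp
  | succ k ih =>
    rw [sum_range_succ, pow_succ, add_comm, mul_comm (B ^ k)]
    exact (lt_of_pack (y := 0) (ih fun r hr => ha r (by omega)) (ha k (by omega))).trans_le (by simp)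

theorem digit_sum_pow {a : ℕ → ℕ} {B k : ℕ} (ha : ∀ r < k, a r < B) {j : ℕ} (hj : j < k) :
    (∑ r ∈ range k, a r * B ^ r) / B ^ j % B = a j := by
  have hB : 0 < B := (Nat.zero_le _).trans_lt (ha j hj)
  obtain ⟨i, rfl⟩ := Nat.exists_eq_add_of_lt hj
  have h₁ : ∑ r ∈ range (j + i + 1), a r * B ^ r = ∑ r ∈ range j, a r * B ^ r +
      B ^ j * (a j + B * ∑ r ∈ range i, a (j + 1 + r) * B ^ r) := by
    rw [show j + i + 1 = j + (i + 1) by ring, sum_range_add, add_right_inj, sum_range_succ',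
      mul_add, mul_sum, mul_sum, add_comm (B ^ j * a j)]
    congr 1
    · exact sum_congr rfl fun r _ => by rw [show j + (r + 1) = j + 1 + r by ring]; ring
    · simp [mul_comm]
  rw [h₁, Nat.add_mul_div_left _ _ (pow_pos hB j),
    Nat.div_eq_of_lt (sum_pow_lt fun r hr => ha r (by omega)), zero_add, Nat.add_mul_mod_self_left,
    Nat.mod_eq_of_lt (ha j hj)]

/-- Binomial theorem: the terms with exponent k or more vanish modulo B ^ k, and the remaining
coefficients are digits because they are less than B. -/
theorem add_one_pow_mod {B k d : ℕ} (hd : ∀ r < k, d.choose r < B) :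
    (B + 1) ^ d % B ^ k = ∑ r ∈ range k, d.choose r * B ^ r := by
  have h₁ : (B + 1) ^ d = ∑ r ∈ range (d + 1), d.choose r * B ^ r := by
    rw [add_pow]
    exact sum_congr rfl fun r _ => by simp [mul_comm]
  have h₂ : (B + 1) ^ d = ∑ r ∈ range (k + (d + 1)), d.choose r * B ^ r := by
    rw [h₁]
    refine sum_subset (fun r => ?_) fun r _ hr => ?_
    · simp only [mem_range]; omega
    · rw [mem_range, not_lt] at hr
      rw [Nat.choose_eq_zero_of_lt (by omega), zero_mul]
  have h₃ : ∑ r ∈ range (d + 1), d.choose (k + r) * B ^ (k + r) =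
      B ^ k * ∑ r ∈ range (d + 1), d.choose (k + r) * B ^ r := by
    rw [mul_sum]
    exact sum_congr rfl fun r _ => by rw [pow_add]; ring
  rw [h₂, sum_range_add, h₃, Nat.add_mul_mod_self_left, Nat.mod_eq_of_lt (sum_pow_lt hd)]

/-- By Vandermonde's identity C(2m + k, r) is a sum of products C(2m, i) C(k, j), at most (2m + 1)^k
2^k in total. The cruder bound (2m + k)^k would leave a factor log ℓ in the final exponent. -/
theorem choose_le_pow_of_le {m k d r : ℕ} (hd : d ≤ 2 * m + k) (hr : r ≤ k) :
    d.choose r ≤ (4 * m + 2) ^ k := by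
  refine (Nat.choose_le_choose r hd).trans ?_
  rw [Nat.add_choose_eq]
  have h₁ : ∀ ij ∈ antidiagonal r, (2 * m).choose ij.1 * k.choose ij.2 ≤
      (2 * m + 1) ^ k * k.choose ij.2 := by
    intro ij hij
    rw [HasAntidiagonal.mem_antidiagonal] at hij
    refine Nat.mul_le_mul_right _ ((Nat.choose_le_pow _ _).trans ?_)
    exact (Nat.pow_le_pow_left (by omega) _).trans (Nat.pow_le_pow_right (by omega) (by omega))
  refine (sum_le_sum h₁).trans ?_
  rw [← mul_sum, Nat.sum_antidiagonal_eq_sum_range_succ_mk,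
    show 4 * m + 2 = (2 * m + 1) * 2 by ring, mul_pow, ← Nat.sum_range_choose k]
  refine Nat.mul_le_mul_left _ ?_
  rw [← sum_range_reflect]
  calc ∑ j ∈ range (r + 1), k.choose (r - (r + 1 - 1 - j)) = ∑ j ∈ range (r + 1), k.choose j :=
        sum_congr rfl fun j hj => by rw [mem_range] at hj; congr 1; omega
    _ ≤ ∑ j ∈ range (k + 1), k.choose j :=
        sum_le_sum_of_subset (range_subset_range.2 (by omega))

/-- The numbers of copies of the stars are the digits of a sum of powers. -/
theorem digit_sum_degrees {n N D B k Q : ℕ} {f : Fin n → ℕ} (hn : n ≤ N) (hf : ∀ i, f i ≤ D)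
    (hQ : ∀ d ≤ D, ∀ r ≤ k, d.choose r ≤ Q) (hB : N * Q < B) (hDB : Q < B) {r : ℕ} (hr : r ≤ k) :
    (∑ i, (B + 1) ^ f i % B ^ (k + 1)) / B ^ r % B = ∑ i, (f i).choose r := by
  have hc : ∀ i, ∀ r < k + 1, (f i).choose r ≤ Q := fun i r hr => hQ _ (hf i) r (by omega)
  have h₁ : ∑ i, (B + 1) ^ f i % B ^ (k + 1) =
      ∑ r ∈ range (k + 1), (∑ i, (f i).choose r) * B ^ r := by
    rw [sum_congr rfl fun i _ => add_one_pow_mod fun r hr => (hc i r hr).trans_lt hDB, sum_comm]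
    exact sum_congr rfl fun r _ => (sum_mul _ _ _).symm
  rw [h₁, digit_sum_pow (a := fun r => ∑ i, (f i).choose r) (fun r hr => ?_) (by omega)]
  have := sum_le_card_nsmul univ (fun i => (f i).choose r) Q fun i _ => hc i r hr
  rw [card_univ, Fintype.card_fin, smul_eq_mul] at this
  exact (this.trans (Nat.mul_le_mul_right _ hn)).trans_lt hB

theorem even_sum_deg {n : ℕ} (G : SimpleGraph (Fin n)) : Even (∑ v, deg G v) := by
  classical
  have : ∀ v, deg G v = G.degree v := fun v => by
    rw [deg, ← card_neighborFinset_eq_degree, neighborFinset_eq_filter]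
  simp only [this, G.sum_degrees_eq_twice_card_edges, even_two_mul]

theorem reach_self_le {P : ℕ → ℕ} {N D h d e s X : ℕ} (hP : ∃ Q, ∀ n, P n ≤ Q)
    (H : Reach P N D h h d e s X) : h ≤ D := by
  obtain ⟨Q, hP⟩ := hP
  have := (H.bounds hP).1
  rcases h with _ | h
  · exact D.zero_le
  · exact H.2.1.trans this

/-- The decision procedure. -/
theorem solvable_iff {I : List StarConstraint} (hI : I ≠ []) {m k D N B : ℕ}
    (hm : ∀ p ∈ I, p.count ≤ m) (hk : ∀ p ∈ I, p.order ≤ k) (hD : D = 2 * m + k)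
    (hN : N = (D + 1) ^ 2) (hB : B = N * (4 * m + 2) ^ k + 1) :
    Solvable I ↔ ∃ h d e s X, Reach (fun d => (B + 1) ^ d % B ^ (k + 1)) N D h h d e s X ∧
      Even ((X + e * ((B + 1) ^ h % B ^ (k + 1))) / B ^ 1 % B) ∧
      ∀ p ∈ I, (X + e * ((B + 1) ^ h % B ^ (k + 1))) / B ^ (p.order - 1) % B = p.target := by
  obtain ⟨p₀, hp₀⟩ := List.exists_mem_of_ne_nil I hI
  have hk1 : 1 ≤ k := p₀.one_le_order.trans (hk p₀ hp₀)
  have hQ : ∀ d ≤ D, ∀ r ≤ k, d.choose r ≤ (4 * m + 2) ^ k := fun d hd r hr =>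
    choose_le_pow_of_le (hD ▸ hd) hr
  have hB1 : N * (4 * m + 2) ^ k < B := by omega
  have hB2 : (4 * m + 2) ^ k < B := by
    have : 1 * (4 * m + 2) ^ k ≤ N * (4 * m + 2) ^ k := Nat.mul_le_mul_right _ (by rw [hN]; exact Nat.one_le_pow _ _ (by omega))
    omega
  have hord : ∀ p ∈ I, p.order - 1 ≤ k := fun p hp => by have := hk p hp; omega
  constructor
  · intro hs
    obtain ⟨n, hn, G, hdeg, hG⟩ := hs.exists_small hI hm hk
    rw [← hD, ← hN] at hn
    rw [← hD] at hdeg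
    obtain ⟨h, d, e, s, X, -, H, hY⟩ :=
      exists_reach (P := fun d => (B + 1) ^ d % B ^ (k + 1)) hn G hdeg
    refine ⟨h, d, e, s, X, H, ?_, fun p hp => ?_⟩
    -- Digit number 1 is the sum of the degrees, which is even.
    · rw [← hY, digit_sum_degrees hn hdeg hQ hB1 hB2 hk1]
      simpa using even_sum_deg G
    · rw [← hY, digit_sum_degrees hn hdeg hQ hB1 hB2 (hord p hp), hG p hp]
  · rintro ⟨h, d, e, s, X, H, heven, hI⟩
    have hhD : h ≤ D := reach_self_le
      ⟨B ^ (k + 1), fun n => (Nat.mod_lt _ (pow_pos (by omega) _)).le⟩ H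
    obtain ⟨n, hn, f, hf, hY, hG⟩ := H.exists_degrees
    rw [max_eq_left hhD] at hf
    rw [← hY, ← Fin.sum_univ_eq_sum_range (fun i => (B + 1) ^ f i % B ^ (k + 1))] at heven hI
    have hf' : ∀ i : Fin n, f i ≤ D := fun i => hf i i.2
    rw [digit_sum_degrees hn hf' hQ hB1 hB2 hk1] at heven
    -- Conversely, evenness of digit 1 is the parity condition that the Erdős–Gallai theorem needs.
    obtain ⟨G, hG⟩ := hG (by rw [← Fin.sum_univ_eq_sum_range]; simpa using heven)
    refine ⟨n, G, fun p hp => ?_⟩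
    rw [p.copyCount_eq_iff, ← hI p hp, digit_sum_degrees hn hf' hQ hB1 hB2 (hord p hp)]
    exact sum_congr rfl fun v _ => by rw [hG]

end StarSubRec

/-! ### The accepting formula. -/

namespace StackProg

open StarSubRec ErdosGallai

namespace Fm

/-- Digit number `r` of the number `x₂₅ + x₂₃ * x₂₆` is `v`. -/
def digit (r v : Tm) : Fm :=
  ex 37 (.var 9) <| and (tab 12 (r * .var 9 + .var 37)) <|
  ex 38 (.var 25 + .var 23 * .var 26 + 1) <| ex 39 (.var 37) <|
  and (lt v (.var 7)) <|
  eq (.var 25 + .var 23 * .var 26) ((.var 38 * .var 7 + v) * .var 37 + .var 39)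

/-- Two divisions with remainder, by p = B ^ r and by B. The power is read from a table of residues
modulo M, which shows its true value because B ^ r < M for r ≤ k. -/
theorem digit_iff {Y B M k r v : ℕ} (hM : M = B ^ (k + 1)) (hB : 2 ≤ B) (hr : r ≤ k) :
    (∃ p < M, p = B ^ r % M ∧ ∃ a < Y + 1, ∃ w < p, v < B ∧ Y = (a * B + v) * p + w) ↔
      Y / B ^ r % B = v := by
  have hlt : B ^ r < M := hM ▸ Nat.pow_lt_pow_right hB (by omega)
  have hpos : 0 < B ^ r := pow_pos (by omega) r
  rw [Nat.mod_eq_of_lt hlt]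
  constructor
  · rintro ⟨p, -, rfl, a, -, w, hw, hv, rfl⟩
    rw [mul_comm, Nat.mul_add_div hpos, Nat.div_eq_of_lt hw, add_zero, Nat.mul_add_mod',
      Nat.mod_eq_of_lt hv]
  · rintro rfl
    refine ⟨_, hlt, rfl, Y / B ^ r / B, ?_, Y % B ^ r, Nat.mod_lt _ hpos,
      Nat.mod_lt _ (by omega), ?_⟩
    · exact Nat.lt_succ_of_le ((Nat.div_le_self _ _).trans (Nat.div_le_self _ _))
    · rw [Nat.div_add_mod', Nat.div_add_mod']

theorem sat_digit {S : St} {B M k : ℕ} (hS7 : (S 7).length = B) (hS9 : (S 9).length = M)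
    (hM : M = B ^ (k + 1)) (hB : 2 ≤ B)
    (hS12 : ∀ r ≤ k, ∀ x < M, (S 12)[r * M + x]? = some true ↔ x = B ^ r % M)
    {r v : Tm} (hr : r.bd ≤ 37) (hv : v.bd ≤ 37) (hrk : r.eval S ≤ k) :
    (digit r v).Sat S ↔
      ((S 25).length + (S 23).length * (S 26).length) / B ^ r.eval S % B = v.eval S := by
  have h₁ : ∀ p, r.eval (upd S 37 (un p)) = r.eval S := fun p =>
    r.eval_congr fun j hj => upd_ne _ _ (by omega)
  have h₂ : ∀ p a w, v.eval (upd (upd (upd S 37 (un p)) 38 (un a)) 39 (un w)) = v.eval S :=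
    fun p a w => v.eval_congr fun j hj => by
      rw [upd_ne _ _ (by omega), upd_ne _ _ (by omega), upd_ne _ _ (by omega)]
  rw [← digit_iff hM hB hrk]
  simp only [digit, sat_ex, sat_and, sat_tab, sat_lt, sat_eq, Tm.eval_add, Tm.eval_mul,
    Tm.eval_var, h₁, h₂, Tm.eval_one]
  simp only [upd, List.length_replicate, Nat.reduceEqDiff, if_true, if_false, hS7, hS9]
  exact exists_congr fun p => and_congr_right fun hp =>
    and_congr_left fun _ => hS12 _ hrk p hp

/-- The upper bounds of the counts of all constraints. -/
def countBound : Fm :=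
  all 31 (.var 0 + 1) <| all 32 (.var 0 + 1) <|
    imp (constraint 31 32 33 34) (le (.var 32) (.var 2))

/-- The upper bounds of the orders of all constraints. -/
def orderBound : Fm :=
  all 31 (.var 0 + 1) <| all 32 (.var 0 + 1) <|
    imp (constraint 31 32 33 34) (le (.var 31) (.var 3))

/-- The digits of the number `x₂₅ + x₂₃ * x₂₆` are as prescribed. -/
def targets : Fm :=
  all 31 (.var 0 + 1) <| all 32 (.var 0 + 1) <| imp (constraint 31 32 33 34) <|
  ex 35 (.var 8) <| and (eq (.var 35 + 1) (.var 31)) <|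
  or (and (eq (.var 31) 2) (digit (.var 35) (2 * .var 32)))
    (and (not (eq (.var 31) 2)) (digit (.var 35) (.var 32)))

/-- The final state of the search is reached with digits as prescribed. -/
def accepts : Fm :=
  ex 21 (.var 13) <| ex 22 (.var 13) <| ex 23 (.var 13) <| ex 24 (.var 13) <| ex 25 (.var 13) <|
  and (tab 14 (((((.var 21 * .var 13 + .var 21) * .var 13 + .var 22) * .var 13 + .var 23) *
    .var 13 + .var 24) * .var 13 + .var 25)) <|
  ex 26 (.var 9) <| and (tab 11 (.var 21 * .var 9 + .var 26)) <|
  and (ex 30 (.var 7) (digit 1 (2 * .var 30))) targets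

end Fm

end StackProg

namespace StarSubRec

open StackProg

/-- Orders and counts are written in unary, so none of them exceeds the length of the input and the
bounded quantifiers reach all constraints. -/
theorem forall_hasConstraint {I : List StarConstraint} {Q : ℕ → ℕ → Prop} :
    (∀ n < (encode I).length + 1, ∀ c < (encode I).length + 1, HasConstraint I n c → Q n c) ↔
      ∀ p ∈ I, Q p.order p.count := by
  constructor
  · intro h p hp
    obtain ⟨u, v, rfl⟩ := List.append_of_mem hp
    have h₁ := p.length_code
    have h₂ : (encode (u ++ p :: v)).length = (encode u).length + (p.code.length + (encode v).length) := by
      rw [encode_append, encode_cons, List.length_append, List.length_append]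
    exact h _ (by omega) _ (by omega) ⟨p, hp, rfl, rfl⟩
  · rintro h _ - _ - ⟨p, hp, rfl, rfl⟩
    exact h p hp

end StarSubRec

namespace StackProg

open StarSubRec ErdosGallai

namespace Fm

theorem sat_countBound {S : St} {I : List StarConstraint} (hS : S 0 = encode I)
    (h₁ : ∀ y < (encode I).length + 1, (S 1)[y]? = some true ↔ IsStart I y) :
    countBound.Sat S ↔ ∀ p ∈ I, p.count ≤ (S 2).length := by
  rw [← forall_hasConstraint (Q := fun n c => c ≤ (S 2).length)]
  have : ∀ n c, (constraint 31 32 33 34).Sat (upd (upd S 31 (un n)) 32 (un c)) ↔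
      HasConstraint I n c := fun n c => by
    rw [sat_constraint (I := I) (by simpa [upd] using hS) (by simpa [upd] using h₁) (by simp)
      (by simp) (by simp) (by simp) (by simp) (by simp)]
    simp [upd]
  simp only [countBound, sat_all, sat_imp, this]
  simp [upd, hS]

theorem sat_orderBound {S : St} {I : List StarConstraint} (hS : S 0 = encode I)
    (h₁ : ∀ y < (encode I).length + 1, (S 1)[y]? = some true ↔ IsStart I y) :
    orderBound.Sat S ↔ ∀ p ∈ I, p.order ≤ (S 3).length := by
  rw [← forall_hasConstraint (Q := fun n c => n ≤ (S 3).length)]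
  have : ∀ n c, (constraint 31 32 33 34).Sat (upd (upd S 31 (un n)) 32 (un c)) ↔
      HasConstraint I n c := fun n c => by
    rw [sat_constraint (I := I) (by simpa [upd] using hS) (by simpa [upd] using h₁) (by simp)
      (by simp) (by simp) (by simp) (by simp) (by simp)]
    simp [upd]
  simp only [orderBound, sat_all, sat_imp, this]
  simp [upd, hS]

/-- The contents of the stacks when the final formula is evaluated. -/
structure Env (I : List StarConstraint) (k D N B M U : ℕ) (S : St) : Prop where
  h0 : S 0 = encode I
  h1 : ∀ y < (encode I).length + 1, (S 1)[y]? = some true ↔ IsStart I y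
  h7 : (S 7).length = B
  h8 : (S 8).length = k + 1
  h9 : (S 9).length = M
  h11 : ∀ d ≤ D, ∀ x < M, (S 11)[d * M + x]? = some true ↔ x = (B + 1) ^ d % M
  h12 : ∀ r ≤ k, ∀ x < M, (S 12)[r * M + x]? = some true ↔ x = B ^ r % M
  h13 : (S 13).length = U
  h14 : ∀ i < U, ∀ h < U, ∀ d < U, ∀ e < U, ∀ s < U, ∀ X < U,
    (S 14)[pack U i h d e s X]? = some true ↔ Reach (fun d => (B + 1) ^ d % M) N D h i d e s X

variable {I : List StarConstraint} {k D N B M U : ℕ} {S : St}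

theorem Env.upd (H : Env I k D N B M U S) {i : ℕ} (hi : 20 ≤ i) (l : List Bool) :
    Env I k D N B M U (upd S i l) := by
  have : ∀ j < 20, StackProg.upd S i l j = S j := fun j hj => upd_ne _ _ (by omega)
  constructor <;> rw [this _ (by omega)]
  exacts [H.h0, H.h1, H.h7, H.h8, H.h9, H.h11, H.h12, H.h13, H.h14]

theorem Env.sat_digit (H : Env I k D N B M U S) (hB : 2 ≤ B) (hM : M = B ^ (k + 1))
    {r v : Tm} (hr : r.bd ≤ 37) (hv : v.bd ≤ 37) (hrk : r.eval S ≤ k) :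
    (digit r v).Sat S ↔
      ((S 25).length + (S 23).length * (S 26).length) / B ^ r.eval S % B = v.eval S :=
  Fm.sat_digit H.h7 H.h9 hM hB H.h12 hr hv hrk

theorem Env.sat_targets (H : Env I k D N B M U S) (hB : 2 ≤ B) (hM : M = B ^ (k + 1))
    (hk : ∀ p ∈ I, p.order ≤ k) : targets.Sat S ↔ ∀ p ∈ I,
      ((S 25).length + (S 23).length * (S 26).length) / B ^ (p.order - 1) % B = p.target := by
  set Y := (S 25).length + (S 23).length * (S 26).length with hY
  have h₁ : ∀ n c, (constraint 31 32 33 34).Sat (StackProg.upd (StackProg.upd S 31 (un n)) 32 (un c)) ↔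
      HasConstraint I n c := fun n c => by
    have H' := (H.upd (i := 31) (by omega) (un n)).upd (i := 32) (by omega) (un c)
    rw [sat_constraint H'.h0 H'.h1 (by simp) (by simp) (by simp) (by simp) (by simp) (by simp)]
    simp [StackProg.upd]
  have h₂ : ∀ n c r, r ≤ k → ∀ v : Tm, v.bd ≤ 37 → ((digit (.var 35) v).Sat
      (StackProg.upd (StackProg.upd (StackProg.upd S 31 (un n)) 32 (un c)) 35 (un r)) ↔
        Y / B ^ r % B = v.eval
          (StackProg.upd (StackProg.upd (StackProg.upd S 31 (un n)) 32 (un c)) 35 (un r))) := by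
    intro n c r hr v hv
    have H' := ((H.upd (i := 31) (by omega) (un n)).upd (i := 32) (by omega) (un c)).upd
      (i := 35) (by omega) (un r)
    rw [H'.sat_digit hB hM (by simp [Tm.bd]) hv (by simpa using hr)]
    simp [StackProg.upd, hY]
  simp only [StarConstraint.target]
  rw [← forall_hasConstraint (Q := fun n c => Y / B ^ (n - 1) % B = (if n = 2 then 2 else 1) * c)]
  simp only [targets, sat_all, sat_imp, h₁, Tm.eval_var, Tm.eval_add, Tm.eval_one, H.h0, upd_ne S _ (show 0 ≠ 31 by decide)]
  refine forall_congr' fun n => imp_congr_right fun _ => forall_congr' fun c => imp_congr_right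
    fun _ => imp_congr_right fun hc => ?_
  obtain ⟨p, hp, rfl, rfl⟩ := hc
  have hp₁ := p.one_le_order
  have hp₂ := hk p hp
  have hr : p.order - 1 ≤ k := by omega
  simp only [sat_ex, sat_and, sat_or, sat_not, sat_eq, Tm.eval_var, Tm.eval_add, Tm.eval_one,
    Tm.eval_two]
  simp only [StackProg.upd, List.length_replicate, Nat.reduceEqDiff, if_true, if_false, H.h8]
  have h₃ := h₂ p.order p.count (p.order - 1) (by omega) (2 * .var 32) (by decide)
  have h₄ := h₂ p.order p.count (p.order - 1) (by omega) (.var 32) (by decide)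
  have h₅ : (StackProg.upd (StackProg.upd (StackProg.upd S 31 (un p.order)) 32 (un p.count)) 35
    (un (p.order - 1)) 32).length = p.count := by simp [StackProg.upd]
  simp only [Tm.eval_mul, Tm.eval_two, Tm.eval_var, h₅] at h₃ h₄
  constructor
  · rintro ⟨r, hr, h, H'⟩
    obtain rfl : r = p.order - 1 := by omega
    rw [h₃, h₄] at H'
    rcases H' with ⟨h, H'⟩ | ⟨h, H'⟩
    · rw [if_pos h, H']
    · rw [if_neg h, H', one_mul]
  · intro H'
    refine ⟨p.order - 1, by omega, by omega, ?_⟩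
    rw [h₃, h₄]
    by_cases h : p.order = 2
    · rw [if_pos h] at H'
      exact .inl ⟨h, H'⟩
    · rw [if_neg h, one_mul] at H'
      exact .inr ⟨h, H'⟩

theorem Env.sat_accepts (H : Env I k D N B M U S) (hB : 2 ≤ B) (hM : M = B ^ (k + 1))
    (hk : ∀ p ∈ I, p.order ≤ k) (hk1 : 1 ≤ k) (hU : N * (N + M) + D + 1 ≤ U) :
    accepts.Sat S ↔ ∃ h d e s X, Reach (fun d => (B + 1) ^ d % B ^ (k + 1)) N D h h d e s X ∧
      Even ((X + e * ((B + 1) ^ h % B ^ (k + 1))) / B ^ 1 % B) ∧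
      ∀ p ∈ I, (X + e * ((B + 1) ^ h % B ^ (k + 1))) / B ^ (p.order - 1) % B = p.target := by
  have hPM : ∀ d, (B + 1) ^ d % M < M := fun d =>
    Nat.mod_lt _ (hM ▸ pow_pos (by omega) _)
  rw [← hM]
  have key : ∀ h d e s X q, ((ex 30 (.var 7) (digit 1 (2 * .var 30))).and targets).Sat
      (StackProg.upd (StackProg.upd (StackProg.upd (StackProg.upd (StackProg.upd (StackProg.upd S
        21 (un h)) 22 (un d)) 23 (un e)) 24 (un s)) 25 (un X)) 26 (un q)) ↔
      Even ((X + e * q) / B ^ 1 % B) ∧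
        ∀ p ∈ I, (X + e * q) / B ^ (p.order - 1) % B = p.target := by
    intro h d e s X q
    have H' := (((((H.upd (i := 21) (by omega) (un h)).upd (i := 22) (by omega) (un d)).upd
      (i := 23) (by omega) (un e)).upd (i := 24) (by omega) (un s)).upd (i := 25) (by omega)
      (un X)).upd (i := 26) (by omega) (un q)
    rw [sat_and, H'.sat_targets hB hM hk, sat_ex]
    refine and_congr ?_ ?_
    · have : ∀ z, (digit 1 (2 * .var 30)).Sat (StackProg.upd (StackProg.upd (StackProg.upd
        (StackProg.upd (StackProg.upd (StackProg.upd (StackProg.upd S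
        21 (un h)) 22 (un d)) 23 (un e)) 24 (un s)) 25 (un X)) 26 (un q)) 30 (un z)) ↔
        (X + e * q) / B ^ 1 % B = 2 * z := by
        intro z
        rw [(H'.upd (i := 30) (by omega) (un z)).sat_digit hB hM (by decide) (by decide)
          (by simpa using hk1)]
        simp [StackProg.upd]
      simp only [this, Tm.eval_var, H'.h7]
      have hlt : (X + e * q) / B ^ 1 % B < B := Nat.mod_lt _ (by omega)
      constructor
      · rintro ⟨z, -, hz⟩
        rw [hz]; exact even_two_mul z
      · rintro ⟨z, hz⟩
        exact ⟨z, by omega, by omega⟩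
    · simp [StackProg.upd]
  simp only [accepts, sat_ex, key, sat_and _ (tab _ _), sat_tab, Tm.eval_var, Tm.eval_add,
    Tm.eval_mul]
  simp only [StackProg.upd, List.length_replicate, Nat.reduceEqDiff, if_true, if_false, H.h13,
    H.h9]
  constructor
  · rintro ⟨h, hh, d, hd, e, he, s, hs, X, hX, h₁, q, hq, h₂, h₃⟩
    have h₁ := (H.h14 h hh h hh d hd e he s hs X hX).1 h₁
    have hhD := reach_self_le ⟨M, fun n => (hPM n).le⟩ h₁
    rw [H.h11 h hhD q hq] at h₂
    exact ⟨h, d, e, s, X, h₁, h₂ ▸ h₃⟩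
  · rintro ⟨h, d, e, s, X, h₁, h₂⟩
    obtain ⟨hh, -, hd, he, hs, hX⟩ := reach_lt hPM hU h₁
    have hhD := reach_self_le ⟨M, fun n => (hPM n).le⟩ h₁
    exact ⟨h, hh, d, hd, e, he, s, hs, X, hX, (H.h14 h hh h hh d hd e he s hs X hX).2 h₁, _, hPM h,
      (H.h11 h hhD _ (hPM h)).2 rfl, h₂⟩

end Fm

end StackProg

/-! ### Parameters, the program and its correctness. -/

namespace StarSubRec

open StackProg ErdosGallai

theorem foldr_max_le_iff {l : List ℕ} {x : ℕ} : l.foldr max 0 ≤ x ↔ ∀ y ∈ l, y ≤ x := by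
  induction l with
  | nil => simp
  | cons a l ih => simp [ih]

theorem maxCount_le_iff {I : List StarConstraint} {x : ℕ} :
    maxCount I ≤ x ↔ ∀ p ∈ I, p.count ≤ x := by
  simp [maxCount, foldr_max_le_iff]

theorem maxOrder_le_iff {I : List StarConstraint} {x : ℕ} :
    maxOrder I ≤ x ↔ ∀ p ∈ I, p.order ≤ x := by
  simp [maxOrder, foldr_max_le_iff]

theorem length_code_le {I : List StarConstraint} {p : StarConstraint} (hp : p ∈ I) :
    p.code.length ≤ (encode I).length := by
  obtain ⟨u, v, rfl⟩ := List.append_of_mem hp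
  rw [encode_append, encode_cons, List.length_append, List.length_append]
  omega

theorem maxCount_le (I : List StarConstraint) : maxCount I ≤ (encode I).length :=
  maxCount_le_iff.2 fun p hp => by
    have := length_code_le hp
    have := p.length_code
    omega

theorem maxOrder_le (I : List StarConstraint) : maxOrder I ≤ (encode I).length :=
  maxOrder_le_iff.2 fun p hp => by
    have := length_code_le hp
    have := p.length_code
    omega

section Parameters

variable (I : List StarConstraint)

/-- A bound of the degrees in a solution. -/
def degreeBound : ℕ := 2 * maxCount I + maxOrder I

/-- A bound of the numbers of copies at a single vertex. -/
def chooseBound : ℕ := (4 * maxCount I + 2) ^ maxOrder I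

/-- A bound of the order of a solution. -/
def sizeBound : ℕ := (degreeBound I + 1) * (degreeBound I + 1)

/-- The base of the number system in which the numbers of copies are digits. -/
def base : ℕ := sizeBound I * chooseBound I + 1

/-- A bound of the numbers with one digit for each size of a star. -/
def modulus : ℕ := base I ^ (maxOrder I + 1)

/-- A strict bound of the components of the states of the search. -/
def stateBound : ℕ := sizeBound I * (sizeBound I + modulus I) + degreeBound I + 1

/-- A bound of the sizes of all stacks. -/
noncomputable def spaceBound : ℕ := (encode I).length + 1 + stateBound I ^ 6

theorem one_le_sizeBound : 1 ≤ sizeBound I := Nat.mul_pos (Nat.succ_pos _) (Nat.succ_pos _)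

theorem one_le_chooseBound : 1 ≤ chooseBound I := Nat.pow_pos (Nat.succ_pos _)

theorem two_le_base : 2 ≤ base I :=
  Nat.succ_le_succ (Nat.mul_pos (one_le_sizeBound I) (one_le_chooseBound I))

theorem base_le_modulus : base I ≤ modulus I :=
  Nat.le_self_pow (Nat.succ_ne_zero _) _

theorem two_le_modulus : 2 ≤ modulus I := (two_le_base I).trans (base_le_modulus I)

theorem sizeBound_add_modulus_le : sizeBound I + modulus I + degreeBound I + 1 ≤ stateBound I := by
  have := Nat.le_mul_of_pos_left (sizeBound I + modulus I) (one_le_sizeBound I)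
  rw [stateBound]
  omega

theorem stateBound_mul_le : stateBound I * stateBound I ≤ spaceBound I := by
  have := sizeBound_add_modulus_le I
  have : stateBound I ^ 2 ≤ stateBound I ^ 6 := Nat.pow_le_pow_right (by omega) (by omega)
  rw [spaceBound, ← sq]
  omega

theorem stateBound_le : stateBound I ≤ spaceBound I := by
  have := sizeBound_add_modulus_le I
  exact (Nat.le_mul_of_pos_left _ (by omega)).trans (stateBound_mul_le I)

theorem maxOrder_le_degreeBound : maxOrder I ≤ degreeBound I := Nat.le_add_left _ _

theorem chooseBound_lt_base : chooseBound I < base I :=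
  Nat.lt_succ_of_le (Nat.le_mul_of_pos_left _ (one_le_sizeBound I))

theorem le_chooseBound (h : 1 ≤ maxOrder I) : 4 * maxCount I + 2 ≤ chooseBound I :=
  Nat.le_self_pow (by omega) _

end Parameters

/-- The intended contents of the stacks. -/
def Fact (I : List StarConstraint) : ℕ → List Bool → Prop
  | 0, l => l = encode I
  | 1, l => l.length = (encode I).length + 1 ∧
      ∀ y < (encode I).length + 1, l[y]? = some true ↔ IsStart I y
  | 2, l => l.length = maxCount I
  | 3, l => l.length = maxOrder I
  | 4, l => l.length = degreeBound I
  | 5, l => l.length = chooseBound I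
  | 6, l => l.length = sizeBound I
  | 7, l => l.length = base I
  | 8, l => l.length = maxOrder I + 1
  | 9, l => l.length = modulus I
  | 10, l => l.length = base I + 1
  | 11, l => l.length = (degreeBound I + 1) * modulus I ∧
      ∀ d ≤ degreeBound I, ∀ x < modulus I,
        l[d * modulus I + x]? = some true ↔ x = (base I + 1) ^ d % modulus I
  | 12, l => l.length = (maxOrder I + 1) * modulus I ∧
      ∀ r ≤ maxOrder I, ∀ x < modulus I,
        l[r * modulus I + x]? = some true ↔ x = base I ^ r % modulus I
  | 13, l => l.length = stateBound I
  | 14, l => l.length = stateBound I ^ 6 ∧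
      ∀ i < stateBound I, ∀ h < stateBound I, ∀ d < stateBound I, ∀ e < stateBound I,
        ∀ s < stateBound I, ∀ X < stateBound I,
          l[pack (stateBound I) i h d e s X]? = some true ↔
            Reach (fun d => (base I + 1) ^ d % modulus I) (sizeBound I) (degreeBound I) h i d e s X
  | 15, l => l.length ≤ 1 ∧ (l = [] ↔ Solvable I)
  | _, _ => False

theorem Fact.length_le {I : List StarConstraint} : ∀ {j : ℕ} {l : List Bool}, Fact I j l →
    l.length ≤ spaceBound I := by
  intro j l h
  have h₁ := maxCount_le I
  have h₂ := maxOrder_le I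
  have h₃ := sizeBound_add_modulus_le I
  have h₄ := stateBound_mul_le I
  have h₅ := stateBound_le I
  have h₆ := base_le_modulus I
  have h₇ := chooseBound_lt_base I
  have h₈ := maxOrder_le_degreeBound I
  have h₉ := one_le_sizeBound I
  have h₁₀ : (encode I).length + 1 + stateBound I ^ 6 = spaceBound I := rfl
  -- Both factors of the length of a power table are at most the bound on the state components.
  have h₁₁ : ∀ d ≤ degreeBound I, (d + 1) * modulus I ≤ spaceBound I := fun d hd =>
    (Nat.mul_le_mul (by omega) (by omega)).trans h₄
  match j, h with
  | 0, h => rw [h]; omega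
  | 1, h => rw [h.1]; omega
  | 2, h => rw [show l.length = _ from h]; omega
  | 3, h => rw [show l.length = _ from h]; omega
  | 4, h => rw [show l.length = _ from h]; omega
  | 5, h => rw [show l.length = _ from h]; omega
  | 6, h => rw [show l.length = _ from h]; omega
  | 7, h => rw [show l.length = _ from h]; omega
  | 8, h => rw [show l.length = _ from h]; omega
  | 9, h => rw [show l.length = _ from h]; omega
  | 10, h => rw [show l.length = _ from h]; omega
  | 11, h => rw [h.1]; exact h₁₁ _ le_rfl
  | 12, h => rw [h.1]; exact h₁₁ _ h₈
  | 13, h => rw [show l.length = _ from h]; omega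
  | 14, h => rw [h.1]; omega
  | 15, h => have := h.1; omega

/-- The stacks below `n` are as intended, and the others are empty. -/
def Inv (I : List StarConstraint) (n : ℕ) (S : St) : Prop :=
  (∀ j < n, Fact I j (S j)) ∧ ∀ j, n ≤ j → S j = []

theorem Inv.length_le {I : List StarConstraint} {n : ℕ} {S : St} (h : Inv I n S) (j : ℕ) :
    (S j).length ≤ spaceBound I := by
  rcases lt_or_ge j n with hj | hj
  · exact (h.1 j hj).length_le
  · rw [h.2 j hj]; exact Nat.zero_le _

theorem Inv.upd {I : List StarConstraint} {n : ℕ} {S : St} (h : Inv I n S) {l : List Bool}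
    (hl : Fact I n l) : Inv I (n + 1) (upd S n l) := by
  constructor
  · intro j hj
    rcases Nat.lt_succ_iff_lt_or_eq.1 hj with hj | rfl
    · rw [upd_ne _ _ hj.ne]; exact h.1 j hj
    · rwa [upd_same]
  · intro j hj
    rw [upd_ne _ _ (by omega)]
    exact h.2 j (by omega)

/-- Stack 20 is the index variable of every table. It lies beyond all results, so it is empty before
the construction and emptied after it. -/
theorem Inv.build {I : List StarConstraint} {n : ℕ} {S : St} (h : Inv I n S) (hn : n ≤ 20) {t : Tm}
    {φ : Fm} (hl : Fact I n (tabulate φ n 20 S (t.eval S))) :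
    Inv I (n + 1) ((Op.build n 20 t φ).eval S) := by
  have : StackProg.upd S 20 [] = S := by rw [← h.2 20 hn, upd_self]
  rw [Op.eval, this]
  exact h.upd hl

/-- The program for the decision problem. -/
def ops : List Op :=
  [.build 1 20 (.var 0 + 1) .startTable,
    .find 2 (.var 0 + 1) .countBound,
    .find 3 (.var 0 + 1) .orderBound,
    .assign 4 (2 * .var 2 + .var 3),
    .assign 5 (2 * (2 * .var 2) + 2),
    .pow 5 5 3,
    .assign 6 ((.var 4 + 1) * (.var 4 + 1)),
    .assign 7 (.var 6 * .var 5 + 1),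
    .assign 8 (.var 3 + 1),
    .pow 9 7 8,
    .assign 10 (.var 7 + 1),
    .build 11 20 ((.var 4 + 1) * .var 9) (.powTable 11 (.var 10) (.var 9)),
    .build 12 20 ((.var 3 + 1) * .var 9) (.powTable 12 (.var 7) (.var 9)),
    .assign 13 (.var 6 * (.var 6 + .var 9) + .var 4 + 1),
    .build 14 20 (.var 13 * .var 13 * .var 13 * .var 13 * .var 13 * .var 13)
      (.reachTable 14 6 4 9 13 11),
    .find 15 1 .accepts]

set_option maxRecDepth 100000 in
theorem ops_bd : ∀ o ∈ ops, o.bd ≤ 40 := by decide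

theorem ops_wf : ∀ o ∈ ops, o.WF := by simp [ops, Op.WF]

/-- The maxima of counts and orders are found as least upper bounds. -/
theorem leastBelow_max {p : ℕ → Prop} {m n : ℕ} (hp : ∀ x, p x ↔ m ≤ x) (hm : m < n) :
    leastBelow p n = m :=
  leastBelow_eq hm ((hp m).2 le_rfl) fun y hy h => absurd ((hp y).1 h) (by omega)

/-- Each instruction fills the next stack, so the invariant advances by one with every instruction
and bounds all stacks on the way. Only the power on stack 5 takes two instructions. -/
theorem ops_correct {I : List StarConstraint} (hI : I ≠ []) :
    Op.Ok 40 (spaceBound I) ops (upd (fun _ => []) 0 (encode I)) ∧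
      Fact I 15 (Op.evalAll ops (upd (fun _ => []) 0 (encode I)) 15) := by
  have hk1 : 1 ≤ maxOrder I := by
    obtain ⟨p, hp⟩ := List.exists_mem_of_ne_nil I hI
    exact p.one_le_order.trans (maxOrder_le_iff.1 le_rfl p hp)
  have step : ∀ {n : ℕ} {S : St} {o : Op} {os : List Op}, Inv I n S → o.Fits S (spaceBound I) →
      Inv I (n + 1) (o.eval S) → (∀ S, Inv I (n + 1) S →
        Op.Ok 40 (spaceBound I) os S ∧ Fact I 15 (Op.evalAll os S 15)) →
      Op.Ok 40 (spaceBound I) (o :: os) S ∧ Fact I 15 (Op.evalAll (o :: os) S 15) :=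
    fun h hf h' H => ⟨⟨fun j _ => h.length_le j, hf, (H _ h').1⟩, (H _ h').2⟩
  have assign : ∀ {n : ℕ} {S : St} {t : Tm} {os : List Op}, Inv I n S →
      Fact I n (un (t.eval S)) → (∀ S, Inv I (n + 1) S →
        Op.Ok 40 (spaceBound I) os S ∧ Fact I 15 (Op.evalAll os S 15)) →
      Op.Ok 40 (spaceBound I) (.assign n t :: os) S ∧
        Fact I 15 (Op.evalAll (.assign n t :: os) S 15) :=
    fun h hf H => step h trivial (h.upd hf) H
  have h0 : Inv I 1 (upd (fun _ => []) 0 (encode I)) := by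
    constructor
    · intro j hj
      obtain rfl : j = 0 := by omega
      rw [upd_same]; rfl
    · intro j hj
      rw [upd_ne _ _ (by omega)]
  generalize upd (fun _ => []) 0 (encode I) = S at h0
  have hmod : modulus I ≤ spaceBound I := by
    have := sizeBound_add_modulus_le I
    have := stateBound_le I
    omega
  refine step h0 trivial (h0.build (by omega) ?_) fun S h1 => ?_
  · have g0 : S 0 = encode I := h0.1 0 (by omega)
    rw [Tm.eval_add, Tm.eval_var, Tm.eval_one, g0]
    exact ⟨length_tabulate _ _ _ _ _, fun y hy => tabulate_startTable g0 hy⟩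
  refine step h1 trivial (h1.upd (n := 2) ?_) fun S h2 => ?_
  · have g0 : S 0 = encode I := h1.1 0 (by omega)
    have g1 : _ ∧ _ := h1.1 1 (by omega)
    change (un _).length = _
    rw [List.length_replicate, Tm.eval_add, Tm.eval_var, Tm.eval_one, g0]
    refine leastBelow_max (fun x => ?_) (Nat.lt_succ_of_le (maxCount_le I))
    rw [Fm.sat_countBound (I := I) (by rw [upd_ne _ _ (by decide), g0])
      (by rw [upd_ne _ _ (by decide)]; exact g1.2), maxCount_le_iff, upd_same,
      List.length_replicate]
  refine step h2 trivial (h2.upd (n := 3) ?_) fun S h3 => ?_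
  · have g0 : S 0 = encode I := h2.1 0 (by omega)
    have g1 : _ ∧ _ := h2.1 1 (by omega)
    change (un _).length = _
    rw [List.length_replicate, Tm.eval_add, Tm.eval_var, Tm.eval_one, g0]
    refine leastBelow_max (fun x => ?_) (Nat.lt_succ_of_le (maxOrder_le I))
    rw [Fm.sat_orderBound (I := I) (by rw [upd_ne _ _ (by decide), g0])
      (by rw [upd_ne _ _ (by decide)]; exact g1.2), maxOrder_le_iff, upd_same,
      List.length_replicate]
  refine assign h3 ?_ fun S h4 => ?_
  · have g2 : (S 2).length = _ := h3.1 2 (by omega)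
    have g3 : (S 3).length = _ := h3.1 3 (by omega)
    change (un _).length = _
    simp [g2, g3, degreeBound]
  -- Stack 5 first receives the base 4m + 2 and is then overwritten by its power. The invariant
  -- fails in between, so both instructions are treated as one step.
  have h5 : Inv I 6 ((Op.pow 5 5 3).eval
      ((Op.assign 5 (2 * (2 * .var 2) + 2)).eval S)) ∧
      ((Op.assign 5 (2 * (2 * .var 2) + 2)).eval S 5).length = 4 * maxCount I + 2 ∧
      ((Op.assign 5 (2 * (2 * .var 2) + 2)).eval S 3).length = maxOrder I := by
    have g2 : (S 2).length = _ := h4.1 2 (by omega)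
    have g3 : (S 3).length = _ := h4.1 3 (by omega)
    have e : (2 * (2 * Tm.var 2) + 2).eval S = 4 * maxCount I + 2 := by
      simp [g2]; ring
    rw [Op.eval, Op.eval, upd_same, upd_ne _ _ (show 3 ≠ 5 by decide), upd_upd,
      List.length_replicate, g3, e]
    refine ⟨h4.upd ?_, rfl, rfl⟩
    change (un _).length = _
    rw [List.length_replicate, chooseBound]
  obtain ⟨h5, e₁, e₂⟩ := h5
  have hch := le_chooseBound I hk1
  have hcs : chooseBound I ≤ spaceBound I := by
    have := chooseBound_lt_base I
    have := base_le_modulus I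
    omega
  suffices H : ∀ S, Inv I 6 S → Op.Ok 40 (spaceBound I) (ops.drop 6) S ∧
      Fact I 15 (Op.evalAll (ops.drop 6) S 15) by
    refine ⟨⟨fun j _ => h4.length_le j, trivial, fun j _ => ?_, ⟨?_, ?_⟩, (H _ h5).1⟩, (H _ h5).2⟩
    · rw [Op.eval]
      by_cases hj : j = 5
      · subst hj
        exact e₁.trans_le (hch.trans hcs)
      · rw [upd_ne _ _ hj]; exact h4.length_le j
    · rw [e₁]; omega
    · rw [e₁, e₂]; exact hcs
  clear h5 e₁ e₂ h4 h3 h2 h1 h0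
  intro S h5
  refine assign h5 ?_ fun S h6 => ?_
  · have g4 : (S 4).length = _ := h5.1 4 (by omega)
    change (un _).length = _
    simp [g4, sizeBound]
  refine assign h6 ?_ fun S h7 => ?_
  · have g5 : (S 5).length = _ := h6.1 5 (by omega)
    have g6 : (S 6).length = _ := h6.1 6 (by omega)
    change (un _).length = _
    simp [g5, g6, base]
  refine assign h7 ?_ fun S h8 => ?_
  · have g3 : (S 3).length = _ := h7.1 3 (by omega)
    change (un _).length = _
    simp [g3]
  have g7 : (S 7).length = _ := h8.1 7 (by omega)
  have g8 : (S 8).length = _ := h8.1 8 (by omega)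
  refine step h8 ⟨?_, ?_⟩ (h8.upd (n := 9) ?_) fun S h9 => ?_
  · rw [g7]; have := two_le_base I; omega
  · rw [g7, g8]; exact hmod
  · change (un _).length = _
    rw [List.length_replicate, g7, g8, modulus]
  clear g7 g8
  refine assign h9 ?_ fun S h10 => ?_
  · have g7 : (S 7).length = _ := h9.1 7 (by omega)
    change (un _).length = _
    simp [g7]
  refine step h10 trivial (h10.build (by omega) ?_) fun S h11 => ?_
  · have g4 : (S 4).length = _ := h10.1 4 (by omega)
    have g9 : (S 9).length = _ := h10.1 9 (by omega)
    have g10 : (S 10).length = _ := h10.1 10 (by omega)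
    rw [Tm.eval_mul, Tm.eval_add, Tm.eval_var, Tm.eval_var, Tm.eval_one, g4, g9]
    exact ⟨length_tabulate _ _ _ _ _, fun d hd x hx => tabulate_powTable (by decide) (by decide)
      (by decide) (by decide) (by decide) g10 g9 (two_le_modulus I) hx
      (pack_lt (Nat.lt_succ_of_le hd) hx)⟩
  refine step h11 trivial (h11.build (by omega) ?_) fun S h12 => ?_
  · have g3 : (S 3).length = _ := h11.1 3 (by omega)
    have g9 : (S 9).length = _ := h11.1 9 (by omega)
    have g7 : (S 7).length = _ := h11.1 7 (by omega)
    rw [Tm.eval_mul, Tm.eval_add, Tm.eval_var, Tm.eval_var, Tm.eval_one, g3, g9]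
    exact ⟨length_tabulate _ _ _ _ _, fun d hd x hx => tabulate_powTable (by decide) (by decide)
      (by decide) (by decide) (by decide) g7 g9 (two_le_modulus I) hx
      (pack_lt (Nat.lt_succ_of_le hd) hx)⟩
  refine assign h12 ?_ fun S h13 => ?_
  · have g4 : (S 4).length = _ := h12.1 4 (by omega)
    have g6 : (S 6).length = _ := h12.1 6 (by omega)
    have g9 : (S 9).length = _ := h12.1 9 (by omega)
    change (un _).length = _
    simp [g4, g6, g9, stateBound]
  refine step h13 trivial (h13.build (by omega) ?_) fun S h14 => ?_
  · have g4 : (S 4).length = _ := h13.1 4 (by omega)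
    have g6 : (S 6).length = _ := h13.1 6 (by omega)
    have g9 : (S 9).length = _ := h13.1 9 (by omega)
    have g11 : _ ∧ _ := h13.1 11 (by omega)
    have g13 : (S 13).length = _ := h13.1 13 (by omega)
    have e : (Tm.var 13 * .var 13 * .var 13 * .var 13 * .var 13 * .var 13).eval S =
        stateBound I ^ 6 := by
      simp [g13]; ring
    rw [e]
    exact ⟨length_tabulate _ _ _ _ _, fun i hi h hh d hd e he s hs X hX =>
      tabulate_reachTable g4 g6 g9 g13 g11.2 ((two_le_modulus I).trans' (by omega)) le_rfl
        hi hh hd he hs hX (pack_lt_pow hi hh hd he hs hX)⟩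
  refine step h14 trivial (h14.upd (n := 15) ?_) fun S h15 =>
    ⟨fun j _ => h15.length_le j, h15.1 15 (by omega)⟩
  have henv : Fm.Env I (maxOrder I) (degreeBound I) (sizeBound I) (base I) (modulus I)
      (stateBound I) S := by
    have g1 : _ ∧ _ := h14.1 1 (by omega)
    have g11 : _ ∧ _ := h14.1 11 (by omega)
    have g12 : _ ∧ _ := h14.1 12 (by omega)
    have g14 : _ ∧ _ := h14.1 14 (by omega)
    exact ⟨h14.1 0 (by omega), g1.2, h14.1 7 (by omega), h14.1 8 (by omega), h14.1 9 (by omega),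
      g11.2, g12.2, h14.1 13 (by omega), g14.2⟩
  -- The search variable on stack 15 does not influence the formula.
  have hsat : ∀ x, Fm.accepts.Sat (upd S 15 (un x)) ↔ Solvable I := by
    intro x
    have henv' : Fm.Env I (maxOrder I) (degreeBound I) (sizeBound I) (base I) (modulus I)
        (stateBound I) (upd S 15 (un x)) := by
      have : ∀ j < 15, upd S 15 (un x) j = S j := fun j hj => upd_ne _ _ (by omega)
      constructor <;> rw [this _ (by omega)]
      exacts [henv.h0, henv.h1, henv.h7, henv.h8, henv.h9, henv.h11, henv.h12, henv.h13, henv.h14]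
    rw [henv'.sat_accepts (two_le_base I) rfl (maxOrder_le_iff.1 le_rfl) hk1 le_rfl,
      solvable_iff (D := degreeBound I) (N := sizeBound I) (B := base I) hI (maxCount_le_iff.1 le_rfl) (maxOrder_le_iff.1 le_rfl) rfl (sq _).symm rfl]
  simp only [hsat, Tm.eval_one]
  -- A search below 1 yields 0 if the formula holds and 1 otherwise, so the empty stack means yes.
  change (un _).length ≤ 1 ∧ (un _ = [] ↔ Solvable I)
  rw [List.length_replicate, List.replicate_eq_nil_iff]
  refine ⟨leastBelow_le _ _, ?_⟩
  rw [← Nat.lt_one_iff, leastBelow_lt_iff]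
  exact ⟨fun ⟨_, _, h⟩ => h, fun h => ⟨0, by omega, h⟩⟩

end StarSubRec

/-! ### The running time. -/

namespace StarSubRec

open StackProg

theorem length_encode_le {I : List StarConstraint} {T : ℕ} (h : ∀ p ∈ I, p.code.length ≤ T) :
    (encode I).length ≤ I.length * T := by
  induction I with
  | nil => simp [encode]
  | cons p I ih =>
    rw [encode_cons, List.length_append, List.length_cons, add_one_mul]
    have := h p (by simp)
    have := ih fun q hq => h q (by simp [hq])
    omega

section Bounds

variable {μ m l : ℕ}

theorem le_pow_of_two_le (hμ : 2 ≤ μ) : l + 1 ≤ μ ^ l :=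
  (Nat.lt_two_pow_self).trans_le (Nat.pow_le_pow_left hμ l)

/-- A sum costs one unit of the exponent because the base is at least 2; this is why max(m, 2)
appears instead of m. -/
theorem add_le_pow {a b x y : ℕ} (hμ : 2 ≤ μ) (ha : a ≤ μ ^ x) (hb : b ≤ μ ^ y) {z : ℕ}
    (hx : x < z) (hy : y < z) : a + b ≤ μ ^ z := by
  have h₁ := ha.trans (Nat.pow_le_pow_right (by omega) (show x ≤ z - 1 by omega))
  have h₂ := hb.trans (Nat.pow_le_pow_right (by omega) (show y ≤ z - 1 by omega))
  calc a + b ≤ μ ^ (z - 1) * 2 := by omega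
    _ ≤ μ ^ (z - 1) * μ := Nat.mul_le_mul_left _ hμ
    _ = μ ^ z := by rw [← pow_succ]; congr 1; omega

theorem mul_le_pow {a b x y : ℕ} (ha : a ≤ μ ^ x) (hb : b ≤ μ ^ y) :
    a * b ≤ μ ^ (x + y) := pow_add μ x y ▸ Nat.mul_le_mul ha hb

end Bounds

variable (I : List StarConstraint)

/-- The base of the number system has exponent O(ℓ), and ℓ + 1 digits make the modulus exponent
O(ℓ²), which dominates everything else. -/
theorem stateBound_le_pow (h : 1 ≤ maxOrder I) :
    stateBound I ≤ max (maxCount I) 2 ^ (30 * maxOrder I ^ 2) := by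
  set μ := max (maxCount I) 2 with hμ
  set l := maxOrder I with hl
  have h2 : 2 ≤ μ := le_max_right _ _
  have hm : maxCount I ≤ μ ^ 1 := by rw [pow_one]; exact le_max_left _ _
  have hll : l ≤ l ^ 2 := Nat.le_self_pow two_ne_zero l
  have h2' : 2 ≤ μ ^ 1 := by rwa [pow_one]
  have hD : degreeBound I + 1 ≤ μ ^ (3 * l) := by
    rw [degreeBound, add_assoc, ← hl]
    exact add_le_pow h2 (mul_le_pow h2' hm) (le_pow_of_two_le h2) (by omega) (by omega)
  have hb : 4 * maxCount I + 2 ≤ μ ^ 4 :=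
    add_le_pow h2 (mul_le_pow (show 4 ≤ μ ^ 2 from Nat.pow_le_pow_left h2 2) hm) h2' (by omega)
      (by omega)
  have hQ : chooseBound I ≤ μ ^ (4 * l) := by
    rw [chooseBound, pow_mul]
    exact Nat.pow_le_pow_left hb _
  have hN : sizeBound I ≤ μ ^ (3 * l + 3 * l) := mul_le_pow hD hD
  have hB : base I ≤ μ ^ (11 * l) :=
    add_le_pow h2 (mul_le_pow hN hQ) (show 1 ≤ μ ^ 0 by simp) (by omega) (by omega)
  have hM : modulus I ≤ μ ^ (11 * l * (l + 1)) := by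
    rw [modulus, pow_mul]
    exact Nat.pow_le_pow_left hB _
  have hM' : 11 * l * (l + 1) ≤ 22 * l ^ 2 := by nlinarith
  rw [stateBound, add_assoc]
  -- The exponent 6ℓ of the size bound and 22ℓ² + 1 of the inner sum add up to less than 30ℓ²,
  -- because 1 ≤ ℓ ≤ ℓ².
  refine add_le_pow h2 (mul_le_pow hN (add_le_pow h2 hN hM (z := 22 * l ^ 2 + 1) ?_ ?_)) hD ?_ ?_ <;>
    omega

/-- The state table takes the sixth power of the state bound, exponent 6 · 30ℓ² = 180ℓ², and each of
two additions is covered by one more ℓ². Only the input length depends on the number of constraints.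
-/
theorem spaceBound_le (hI : I ≠ []) (h : 1 ≤ maxOrder I) :
    spaceBound I ≤ I.length * max (maxCount I) 2 ^ (182 * maxOrder I ^ 2) := by
  have hU := stateBound_le_pow I h
  set μ := max (maxCount I) 2 with hμ
  set l := maxOrder I with hl
  have h2 : 2 ≤ μ := le_max_right _ _
  have hm : maxCount I ≤ μ ^ 1 := by rw [pow_one]; exact le_max_left _ _
  have h2' : 2 ≤ μ ^ 1 := by rwa [pow_one]
  have hll : l ≤ l ^ 2 := Nat.le_self_pow two_ne_zero l
  have hl' : l ≤ μ ^ l := (Nat.le_succ l).trans (le_pow_of_two_le h2)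
  have hlen : (encode I).length ≤ I.length * μ ^ (5 * l ^ 2) := by
    refine length_encode_le fun p hp => ?_
    have h₁ := maxOrder_le_iff.1 (le_refl (maxOrder I)) p hp
    have h₂ := maxCount_le_iff.1 (le_refl (maxCount I)) p hp
    rw [← hl] at h₁
    rw [p.length_code]
    refine add_le_pow h2 (add_le_pow h2 (add_le_pow h2 (h₁.trans hl') (mul_le_pow (h₁.trans hl')
      (h₁.trans hl')) (z := 2 * l + 1) ?_ ?_) (h₂.trans hm) (z := 2 * l + 2) ?_ ?_) h2' ?_ ?_ <;>
    omega
  have hk : 1 ≤ I.length := List.length_pos_iff.2 hI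
  have hU6 : stateBound I ^ 6 ≤ μ ^ (180 * l ^ 2) := by
    rw [show 180 * l ^ 2 = 30 * l ^ 2 * 6 by ring, pow_mul]
    exact Nat.pow_le_pow_left hU 6
  have h₁ : 1 + stateBound I ^ 6 ≤ μ ^ (181 * l ^ 2) :=
    add_le_pow h2 (show 1 ≤ μ ^ 0 by simp) hU6 (by omega) (by omega)
  calc spaceBound I = (encode I).length + (1 + stateBound I ^ 6) := by rw [spaceBound, add_assoc]
    _ ≤ I.length * μ ^ (5 * l ^ 2) + I.length * μ ^ (181 * l ^ 2) :=
        add_le_add hlen (h₁.trans (Nat.le_mul_of_pos_left _ hk))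
    _ = I.length * (μ ^ (5 * l ^ 2) + μ ^ (181 * l ^ 2)) := (mul_add _ _ _).symm
    _ ≤ _ := Nat.mul_le_mul_left _ (add_le_pow h2 le_rfl le_rfl (by omega) (by omega))

/-- Pairwise non-isomorphic stars have different orders. -/
theorem length_le_maxOrder (h : I.Pairwise fun p q => IsEmpty (p.graph ≃g q.graph)) :
    I.length ≤ maxOrder I := by
  have hnd : (I.map StarConstraint.order).Nodup := by
    rw [List.Nodup, List.pairwise_map]
    refine h.imp fun {p q} hpq heq => ?_
    obtain ⟨n, F, hF, c⟩ := p
    obtain ⟨n', F', hF', c'⟩ := q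
    obtain rfl : n = n' := heq
    exact (hF.nonempty_iso hF').elim hpq.false
  rw [← List.length_map StarConstraint.order, ← List.toFinset_card_of_nodup hnd,
    ← Nat.card_Icc 1 (maxOrder I) |>.trans (Nat.add_sub_cancel _ _)]
  refine Finset.card_le_card fun n hn => ?_
  rw [List.mem_toFinset, List.mem_map] at hn
  obtain ⟨p, hp, rfl⟩ := hn
  exact Finset.mem_Icc.2 ⟨p.one_le_order, maxOrder_le_iff.1 le_rfl p hp⟩

/-- There is a machine that decides solvability within the claimed time. -/
theorem exists_machine_answersInTime :
    ∃ (M : Turing.TM2ComputableAux Bool Bool) (c : ℕ),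
      (∀ s : M.tm.K, Finite (M.tm.Γ s)) ∧
      ∀ I : List StarConstraint, I ≠ [] →
        (I.Pairwise (fun p q => IsEmpty (p.graph ≃g q.graph)) →
          AnswersInTime M I
            (max (maxCount I) 2 ^ (c * maxOrder I ^ 2))) ∧
        AnswersInTime M I
          (I.length ^ c * max (maxCount I) 2 ^ (c * maxOrder I ^ 2)) := by
  obtain ⟨M, C, hM, hC⟩ := exists_machine ops ops_bd ops_wf (r := 15) (by omega)
  -- The time is the C-th power of the space bound, whose exponent has the factor 182; the remaining
  -- unit pays for the number of constraints when the stars are pairwise non-isomorphic.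
  refine ⟨M, 183 * C, hM, fun I hI => ?_⟩
  obtain ⟨hok, -, hfact⟩ := ops_correct hI
  have h2 : 2 ≤ max (maxCount I) 2 := le_max_right _ _
  have hA : 2 ≤ spaceBound I := (two_le_modulus I).trans (by
    have := sizeBound_add_modulus_le I
    have := stateBound_le I
    omega)
  have hk1 : 1 ≤ maxOrder I := by
    obtain ⟨p, hp⟩ := List.exists_mem_of_ne_nil I hI
    exact p.one_le_order.trans (maxOrder_le_iff.1 le_rfl p hp)
  have hk : 1 ≤ I.length := List.length_pos_iff.2 hI
  have hspace := spaceBound_le I hI hk1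
  have key : ∀ T, spaceBound I ^ C ≤ T → AnswersInTime M I T := fun T hT =>
    hC (encode I) (spaceBound I) (answer I) hA hok (by
      rw [hfact, answer]
      exact @decide_eq_true_iff _ (Classical.propDecidable _)) T hT
  constructor
  · intro hp
    refine key _ ?_
    have h₁ : I.length ≤ max (maxCount I) 2 ^ maxOrder I ^ 2 :=
      (length_le_maxOrder I hp).trans ((Nat.le_self_pow two_ne_zero _).trans
        ((Nat.le_succ _).trans (le_pow_of_two_le h2)))
    calc spaceBound I ^ C
        ≤ (max (maxCount I) 2 ^ (maxOrder I ^ 2 + 182 * maxOrder I ^ 2)) ^ C :=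
          Nat.pow_le_pow_left (hspace.trans (mul_le_pow h₁ le_rfl)) C
      _ = _ := by rw [← pow_mul]; congr 1; ring
  · refine key _ ?_
    calc spaceBound I ^ C ≤ (I.length * max (maxCount I) 2 ^ (182 * maxOrder I ^ 2)) ^ C :=
          Nat.pow_le_pow_left hspace C
      _ = I.length ^ C * max (maxCount I) 2 ^ (182 * maxOrder I ^ 2 * C) := by
          rw [mul_pow, ← pow_mul]
      _ ≤ _ := Nat.mul_le_mul (Nat.pow_le_pow_right hk (by omega))
          (Nat.pow_le_pow_right (by omega) (by nlinarith))

end StarSubRec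

theorem corollary4 :
    ∃ (M : Turing.TM2ComputableAux Bool Bool) (c : ℕ),
      (∀ s : M.tm.K, Finite (M.tm.Γ s)) ∧
      ∀ I : List StarSubRec.StarConstraint, I ≠ [] →
        (I.Pairwise (fun p q => IsEmpty (p.graph ≃g q.graph)) →
          StarSubRec.AnswersInTime M I
            (max (StarSubRec.maxCount I) 2 ^ (c * StarSubRec.maxOrder I ^ 2))) ∧
        StarSubRec.AnswersInTime M I
          (I.length ^ c * max (StarSubRec.maxCount I) 2 ^ (c * StarSubRec.maxOrder I ^ 2)) :=
  StarSubRec.exists_machine_answersInTime
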